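/- Let $d\ge 2$, $\alpha\in(-\infty,1)$ and $0<r<\min(1-\alpha,1)$. Write points of the half space $\mathbb{R}^{d+1}_+$ as $(t,x',x_d)$ with $t\in\mathbb{R}$, $x'\in\mathbb{R}^{d-1}$, $x_d>0$. For $x_d,\tau>0$ and $z'\in\mathbb{R}^{d-1}$ put $$Q^{\alpha}_{x_d}(\tau,z')=\frac{1}{4^{(d-\alpha)/2}\pi^{(d-1)/2}\Gamma((1-\alpha)/2)}\cdot\frac{x_d^{1-\alpha}}{\tau^{(d-\alpha)/2+1}}\,e^{-(x_d^2+|z'|^2)/(4\tau)},$$ and for a scalar (real or complex) function $g=g(t,x')$ on $\mathbb{R}^d$ put $$u(t,x',x_d)=[Q^{\alpha}_{x_d}\ast g](t,x')=\int_0^\infty\!\!\int_{\mathbb{R}^{d-1}}Q^{\alpha}_{x_d}(\tau,z')\,g(t-\tau,x'-z')\,dz'\,d\tau .$$ For $p,q\in[1,\infty]$ let $$[g]_{B^{r/2,r}_{p,q}(\mathbb{R}^d)}=\left\{\int_{\mathbb{R}^{d-1}}\left[\frac{\|g(t,x'+h)-2g(t,x')+g(t,x'-h)\|_{L_p(\mathbb{R}^d_{t,x'})}}{|h|^{r}}\right]^q\frac{dh}{|h|^{d-1}}\right\}^{1/q}+\left\{\int_{\mathbb{R}}\left[\frac{\|g(t+\tau,x')-g(t,x')\|_{L_p(\mathbb{R}^d_{t,x'})}}{|\tau|^{r/2}}\right]^q\frac{d\tau}{|\tau|}\right\}^{1/q}\in[0,\infty]$$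 (essential suprema of the brackets over $h$ and over $\tau$ if $q=\infty$), and let $L_q^*L_p$ denote $L_q\big((0,\infty),\frac{dx_d}{x_d};L_p(\mathbb{R}^d_{t,x'})\big)$. Then there is a constant $C>0$ depending only on $d,\alpha,r$ such that for all $p,q\in[1,\infty]$ and all $g\in L_p(\mathbb{R}^d)$ the integral defining $u$ converges absolutely at every point of $\mathbb{R}^{d+1}_+$, $u$ is differentiable in $\mathbb{R}^{d+1}_+$, and, with $Du=(D_1u,\dots,D_du)$ the spatial gradient, $$C^{-1}[g]_{B^{r/2,r}_{p,q}(\mathbb{R}^d)}\le\|x_d^{1-r}Du\|_{L_q^*L_p}+\|x_d^{2-r}\partial_tu\|_{L_q^*L_p}\le C\,[g]_{B^{r/2,r}_{p,q}(\mathbb{R}^d)} ,$$ as inequalities in $[0,\infty]$. -/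

import Mathlib

open MeasureTheory Set
open scoped ENNReal

noncomputable section

namespace ParabolicBesov

/-- The boundary space `ℝ^d = ℝ_t × ℝ^{d-1}_{x'}`, where `d = n + 1`. It carries Lebesgue measure,
and `ℝ^{d-1}` carries the Euclidean norm. -/
abbrev Bdry (n : ℕ) : Type := ℝ × EuclideanSpace ℝ (Fin n)

/-- The kernel `Q^α_{x_d}(τ, z')` for `d = n + 1`, meant for `x_d, τ > 0`. -/
def kernel (n : ℕ) (α xd : ℝ) (w : Bdry n) : ℝ :=
  1 / ((4 : ℝ) ^ (((n : ℝ) + 1 - α) / 2) * Real.pi ^ ((n : ℝ) / 2) * Real.Gamma ((1 - α) / 2)) *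
    (xd ^ (1 - α) / w.1 ^ (((n : ℝ) + 1 - α) / 2 + 1)) *
    Real.exp (-(xd ^ 2 + ‖w.2‖ ^ 2) / (4 * w.1))

variable {𝕜 : Type*} [RCLike 𝕜]

/-- The integrand `(τ, z') ↦ Q^α_{x_d}(τ, z') g(t - τ, x' - z')`. -/
def integrand {n : ℕ} (α : ℝ) (g : Bdry n → 𝕜) (t : ℝ) (x' : EuclideanSpace ℝ (Fin n)) (xd : ℝ)
    (w : Bdry n) : 𝕜 :=
  kernel n α xd w • g (t - w.1, x' - w.2)

/-- The range of integration `(0, ∞) × ℝ^{d-1}` of `(τ, z')`. -/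
def past (n : ℕ) : Set (Bdry n) := Ioi 0 ×ˢ univ

/-- The weighted caloric extension `u(t, x', x_d) = [Q^α_{x_d} ∗ g](t, x')`. -/
def extension {n : ℕ} (α : ℝ) (g : Bdry n → 𝕜) (t : ℝ) (x' : EuclideanSpace ℝ (Fin n)) (xd : ℝ) :
    𝕜 :=
  ∫ w in past n, integrand α g t x' xd w

/-- The spatial gradient `Du = (D_1 u, …, D_{d-1} u, D_d u)`, normed by the Euclidean norm. -/
def spatialGradient {n : ℕ} (u : ℝ → EuclideanSpace ℝ (Fin n) → ℝ → 𝕜)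
    (t : ℝ) (x' : EuclideanSpace ℝ (Fin n)) (xd : ℝ) : EuclideanSpace 𝕜 (Fin (n + 1)) :=
  WithLp.toLp 2 (Fin.snoc (α := fun _ => 𝕜)
    (fun i : Fin n => lineDeriv ℝ (fun v => u t v xd) x' (EuclideanSpace.single i 1))
    (deriv (fun y => u t x' y) xd))

/-- The time derivative `∂_t u`. -/
def timeDeriv {n : ℕ} (u : ℝ → EuclideanSpace ℝ (Fin n) → ℝ → 𝕜)
    (t : ℝ) (x' : EuclideanSpace ℝ (Fin n)) (xd : ℝ) : 𝕜 :=
  deriv (fun s => u s x' xd) t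

/-- The measure `dx_d / x_d` on `(0, ∞)`. -/
def normalMeasure : Measure ℝ :=
  (volume.restrict (Ioi 0)).withDensity fun y => ENNReal.ofReal (y⁻¹)

/-- The norm of `L_q((0, ∞), dx_d / x_d; L_p(ℝ^d_{t,x'}))`, with values in `[0, ∞]`. -/
def mixedNorm {n : ℕ} {V : Type*} [NormedAddCommGroup V] (p q : ℝ≥0∞)
    (F : ℝ → EuclideanSpace ℝ (Fin n) → ℝ → V) : ℝ≥0∞ :=
  eLpNorm (fun xd : ℝ => eLpNorm (fun z : Bdry n => F z.1 z.2 xd) p volume) q normalMeasure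

/-- `‖x_d^{1-r} Du‖ + ‖x_d^{2-r} ∂_t u‖` in `L_q((0, ∞), dx_d / x_d; L_p(ℝ^d_{t,x'}))`. -/
def weightedNorm {n : ℕ} (r : ℝ) (p q : ℝ≥0∞)
    (u : ℝ → EuclideanSpace ℝ (Fin n) → ℝ → 𝕜) : ℝ≥0∞ :=
  mixedNorm p q (fun t x' xd => xd ^ (1 - r) • spatialGradient u t x' xd) +
    mixedNorm p q (fun t x' xd => xd ^ (2 - r) • timeDeriv u t x' xd)

/-- The part of the Besov seminorm made of second differences in `x'`, with respect to the measure
`dh / |h|^{d-1}`. -/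
def spaceSeminorm {n : ℕ} (s : ℝ) (p q : ℝ≥0∞) (f : Bdry n → 𝕜) : ℝ≥0∞ :=
  eLpNorm
    (fun h : EuclideanSpace ℝ (Fin n) =>
      eLpNorm (fun z : Bdry n => f (z.1, z.2 + h) - 2 * f z + f (z.1, z.2 - h)) p volume /
        ENNReal.ofReal (‖h‖ ^ s))
    q (volume.withDensity fun h => ENNReal.ofReal ((‖h‖ ^ n)⁻¹))

/-- The part of the Besov seminorm made of first differences in `t`, with respect to the measure
`dτ / |τ|`. -/
def timeSeminorm {n : ℕ} (s : ℝ) (p q : ℝ≥0∞) (f : Bdry n → 𝕜) : ℝ≥0∞ :=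
  eLpNorm
    (fun τ : ℝ =>
      eLpNorm (fun z : Bdry n => f (z.1 + τ, z.2) - f z) p volume /
        ENNReal.ofReal (|τ| ^ (s / 2)))
    q (volume.withDensity fun τ => ENNReal.ofReal (|τ|⁻¹))

/-- The parabolic Besov seminorm `[f]` of `B^{s/2,s}_{p,q}(ℝ^d)`, `0 < s < 2`, with values in
`[0, ∞]`. For `q = ∞` the outer norms are essential suprema. -/
def besovSeminorm {n : ℕ} (s : ℝ) (p q : ℝ≥0∞) (f : Bdry n → 𝕜) : ℝ≥0∞ :=
  spaceSeminorm s p q f + timeSeminorm s p q f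

end ParabolicBesov

end

/-!
The idea is that every quantity is, up to constants, an average in the logarithm of a scale, and
that averages with exponentially decaying weights are bounded on `L_q` uniformly in `q`.

The kernel `Q` at height `y` is dominated by `y^{1-α} (y² + |z'|² + |τ|)^{-(d-α)/2-1}`; each of
its spatial derivatives costs a further factor `1/y`, its time derivative a factor `1/y²`
(`exists_abs_fullKernel_le`, `exists_abs_fderiv_fullKernel_le`). This is seen by writing `Q` as a
power of `R = y² + |z'|²` times a function of `τ / R` that is smooth across `τ = 0`. In
particular the extension `u` of any `g` in `L_p` is an absolutely convergent integral that may be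
differentiated under the integral sign (`hasFDerivAt_halfExtension`).

*Upper bound* (`exists_weightedNorm_le`). The kernel has integral one, so the integrals of its
derivatives vanish, and `g` may be replaced by its differences `g(z - w) - g(z)` in the formula
for the derivatives of `u` (`exists_extensionDeriv_le`). Splitting a parabolic difference into one
in `x'` and one in `t`, and using Minkowski's inequality, `y^{-r}` times the resulting integral is
at most the integral of the weighted moduli of `g` at scale `ρ` against `min(ρ/y, y/ρ)^ε`. Decay
for `ρ → 0` comes from `0 < r`, and for `ρ → ∞` from `r < 1 - α`. Such kernels are bounded by
Schur's test in logarithmic coordinates (`exists_eLpNorm_logKernel_le`); the measures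
`dh / |h|^{d-1}` and `dτ / |τ|` are carried to multiples of `dy / y` by `|h|` and `√|τ|`. First
differences in `x'` are replaced by second differences by Marchaud's argument, which needs
`r < 1` and `g` in `L_p` (`exists_spaceSeminorm₁_le`).

*Lower bound* (`exists_besovSeminorm_le`). The boundary values of `u` are `g`, locally in `L_1`.
By Fatou's lemma `‖u(·, y) - g‖_p` is at most the integral of `‖D_d u(·, s)‖_p` over `0 < s ≤ y`
(`eLpNorm_sub_halfExtension_le`), and after multiplication by `y^{-r}` this is again an integral
against a logarithmically decaying kernel, which is Hardy's inequality (`exists_traceDist_le`). A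
difference of `g` with step `h` in `x'`, or `τ` in `t`, is compared with the same difference of `u`
at height `|h|`, or `√|τ|`, where the mean value theorem applies.
-/

noncomputable section

namespace ParabolicBesov

/-! ### Integral inequalities for functions with values in `[0, ∞]` -/

section Integral

variable {Y Z : Type*} [MeasurableSpace Y] [MeasurableSpace Z] {μ : Measure Y} {ν : Measure Z}

/-- Jensen's inequality for the power `q`, with respect to the measure `k • μ`. -/
lemma lintegral_mul_rpow_le {q : ℝ} (hq : 1 ≤ q) {k φ : Y → ℝ≥0∞} (hk : Measurable k)
    (hφ : Measurable φ) :
    (∫⁻ y, k y * φ y ∂μ) ^ q ≤ (∫⁻ y, k y ∂μ) ^ (q - 1) * ∫⁻ y, k y * φ y ^ q ∂μ := by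
  have hq0 : 0 < q := by linarith
  have h := eLpNorm_le_eLpNorm_mul_rpow_measure_univ (μ := μ.withDensity k) (f := φ) (p := 1)
    (q := ENNReal.ofReal q) (by simpa using hq) hφ.aestronglyMeasurable
  rw [eLpNorm_one_eq_lintegral_enorm, eLpNorm_eq_lintegral_rpow_enorm_toReal (by simpa using hq0)
    ENNReal.ofReal_ne_top, lintegral_withDensity_eq_lintegral_mul _ hk (by fun_prop),
    lintegral_withDensity_eq_lintegral_mul _ hk (by fun_prop)] at h
  simp only [Pi.mul_apply, enorm_eq_self, ENNReal.toReal_one, ENNReal.toReal_ofReal hq0.le,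
    withDensity_apply _ MeasurableSet.univ, setLIntegral_univ] at h
  calc (∫⁻ y, k y * φ y ∂μ) ^ q
      ≤ ((∫⁻ y, k y * φ y ^ q ∂μ) ^ (1 / q) * (∫⁻ y, k y ∂μ) ^ (1 / 1 - 1 / q)) ^ q := by gcongr
    _ = _ := by
      rw [ENNReal.mul_rpow_of_nonneg _ _ hq0.le, ← ENNReal.rpow_mul, ← ENNReal.rpow_mul, mul_comm]
      congr 2
      · field_simp
      · rw [one_div_mul_cancel hq0.ne', ENNReal.rpow_one]

/-- The `L_p` norm of a function of one variable is a measurable function of the other variable.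
For `p = ∞` this holds because `{w | a < ess sup F w}` is the set where `{z | a < F w z}` has
positive measure. -/
lemma measurable_eLpNorm_right [SFinite ν] {F : Y → Z → ℝ≥0∞}
    (hF : Measurable (Function.uncurry F)) (p : ℝ≥0∞) :
    Measurable fun w => eLpNorm (F w) p ν := by
  rcases eq_or_ne p 0 with rfl | h0
  · simp
  rcases eq_or_ne p ∞ with rfl | hp
  · refine measurable_of_Ioi fun a => ?_
    have hset : (fun w => eLpNorm (F w) ∞ ν) ⁻¹' Ioi a =
        {w | ν (Prod.mk w ⁻¹' {x : Y × Z | a < Function.uncurry F x}) ≠ 0} := by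
      ext w
      simp only [mem_preimage, mem_Ioi, eLpNorm_exponent_top, eLpNormEssSup, enorm_eq_self,
        mem_ofPred_eq, Function.uncurry]
      rw [← not_iff_not, not_lt, not_not]
      constructor
      · intro h
        have h1 : ∀ᵐ z ∂ν, F w z ≤ a := by
          filter_upwards [ENNReal.ae_le_essSup (μ := ν) (F w)] with z hz using hz.trans h
        simpa [ae_iff] using h1
      · intro h
        exact essSup_le_of_ae_le _ (by simpa [Filter.EventuallyLE, ae_iff] using h)
    rw [hset]
    exact (measurable_measure_prodMk_left (hF measurableSet_Ioi))
      (measurableSet_singleton (0 : ℝ≥0∞)).compl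
  · simp only [eLpNorm_eq_lintegral_rpow_enorm_toReal h0 hp, enorm_eq_self]
    exact (Measurable.lintegral_prod_right (f := fun w z => F w z ^ p.toReal)
      (hF.pow_const _)).pow_const _

/-- Minkowski's integral inequality. -/
lemma eLpNorm_lintegral_le [SFinite μ] [SFinite ν] {p : ℝ≥0∞} (hp : 1 ≤ p) {F : Y → Z → ℝ≥0∞}
    (hF : Measurable (Function.uncurry F)) :
    eLpNorm (fun z => ∫⁻ w, F w z ∂μ) p ν ≤ ∫⁻ w, eLpNorm (F w) p ν ∂μ := by
  have hE := measurable_eLpNorm_right (ν := ν) hF p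
  rcases eq_or_ne p ∞ with rfl | hpt
  · simp only [eLpNorm_exponent_top] at hE ⊢
    have h1 : ∀ᵐ z ∂ν, ∀ᵐ w ∂μ, F w z ≤ eLpNormEssSup (F w) ν := by
      rw [← Measure.ae_ae_comm (p := fun w z => F w z ≤ eLpNormEssSup (F w) ν)]
      · exact ae_of_all _ fun w => by simpa using enorm_ae_le_eLpNormEssSup (F w) ν
      · exact measurableSet_le hF (hE.comp measurable_fst)
    refine essSup_le_of_ae_le _ ?_
    filter_upwards [h1] with z hz
    simpa using lintegral_mono_ae hz
  have hp1 : 1 ≤ p.toReal := by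
    simpa using ENNReal.toReal_mono hpt hp
  have hp0 : p ≠ 0 := (zero_lt_one.trans_le hp).ne'
  have hpp : 0 < p.toReal := by linarith
  set E : Y → ℝ≥0∞ := fun w => eLpNorm (F w) p ν with hEdef
  change _ ≤ ∫⁻ w, E w ∂μ
  rcases eq_or_ne (∫⁻ w, E w ∂μ) ∞ with hM | hM
  · rw [hM]; exact le_top
  have hEpow : ∀ w, ∫⁻ z, F w z ^ p.toReal ∂ν = E w ^ p.toReal := by
    intro w
    simp only [hEdef, eLpNorm_eq_lintegral_rpow_enorm_toReal hp0 hpt, enorm_eq_self]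
    rw [← ENNReal.rpow_mul, one_div_mul_cancel hpp.ne', ENNReal.rpow_one]
  have hFw : ∀ w, Measurable (F w) := fun w => hF.comp measurable_prodMk_left
  have hFz : ∀ z, Measurable fun w => F w z := fun z => hF.comp measurable_prodMk_right
  -- `F w z = E w * (F w z / E w)` except on a null set: `F w` vanishes almost everywhere
  -- when `E w = 0`, and `E` is finite almost everywhere.
  have h1 : ∀ᵐ z ∂ν, ∀ᵐ w ∂μ, F w z = E w * (F w z / E w) := by
    rw [← Measure.ae_ae_comm (p := fun w z => F w z = E w * (F w z / E w))]
    · filter_upwards [ae_lt_top hE hM] with w hw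
      rcases eq_or_ne (E w) 0 with h0 | h0
      · have := (eLpNorm_eq_zero_iff (hFw w).aestronglyMeasurable hp0).1 h0
        filter_upwards [this] with z hz
        simp [hz]
      · exact ae_of_all _ fun z => (ENNReal.mul_div_cancel h0 hw.ne).symm
    · exact measurableSet_eq_fun hF
        ((hE.comp measurable_fst).mul (hF.div (hE.comp measurable_fst)))
  rw [eLpNorm_eq_lintegral_rpow_enorm_toReal hp0 hpt]
  simp only [enorm_eq_self, one_div]
  rw [ENNReal.rpow_inv_le_iff hpp]
  have hmeas : Measurable (Function.uncurry fun w z => E w * (F w z / E w) ^ p.toReal) :=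
    (hE.comp measurable_fst).mul ((hF.div (hE.comp measurable_fst)).pow_const _)
  calc ∫⁻ z, (∫⁻ w, F w z ∂μ) ^ p.toReal ∂ν
      ≤ ∫⁻ z, (∫⁻ w, E w ∂μ) ^ (p.toReal - 1) * ∫⁻ w, E w * (F w z / E w) ^ p.toReal ∂μ ∂ν := by
        refine lintegral_mono_ae ?_
        filter_upwards [h1] with z hz
        rw [lintegral_congr_ae hz]
        exact lintegral_mul_rpow_le hp1 hE ((hFz z).div hE)
    _ = (∫⁻ w, E w ∂μ) ^ (p.toReal - 1) *
          ∫⁻ w, ∫⁻ z, E w * (F w z / E w) ^ p.toReal ∂ν ∂μ := by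
        rw [lintegral_const_mul, lintegral_lintegral_swap hmeas.aemeasurable]
        exact Measurable.lintegral_prod_left hmeas
    _ ≤ (∫⁻ w, E w ∂μ) ^ (p.toReal - 1) * ∫⁻ w, E w ∂μ := by
        gcongr with w
        simp only [div_eq_mul_inv, ENNReal.mul_rpow_of_nonneg _ _ hpp.le]
        rw [lintegral_const_mul _ (((hFw w).pow_const _).mul_const _),
          lintegral_mul_const _ ((hFw w).pow_const _), hEpow, ENNReal.inv_rpow]
        exact mul_le_of_le_one_right' (ENNReal.mul_inv_le_one _)
    _ = (∫⁻ w, E w ∂μ) ^ p.toReal := by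
        nth_rewrite 2 [← ENNReal.rpow_one (∫⁻ w, E w ∂μ)]
        rw [← ENNReal.rpow_add_of_nonneg _ _ (by linarith) zero_le_one, sub_add_cancel]

/-- Schur's test. -/
lemma eLpNorm_lintegral_mul_le [SFinite μ] [SFinite ν] {q : ℝ≥0∞} (hq : 1 ≤ q)
    {K : Y → Z → ℝ≥0∞} (hK : Measurable (Function.uncurry K)) {A : ℝ≥0∞}
    (h1 : ∀ y, ∫⁻ z, K y z ∂ν ≤ A) (h2 : ∀ z, ∫⁻ y, K y z ∂μ ≤ A) {φ : Z → ℝ≥0∞}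
    (hφ : Measurable φ) :
    eLpNorm (fun y => ∫⁻ z, K y z * φ z ∂ν) q μ ≤ A * eLpNorm φ q ν := by
  have hKy : ∀ y, Measurable (K y) := fun w => hK.comp measurable_prodMk_left
  have hKz : ∀ z, Measurable fun y => K y z := fun z => hK.comp measurable_prodMk_right
  rcases eq_or_ne q ∞ with rfl | hqt
  · simp only [eLpNorm_exponent_top]
    refine essSup_le_of_ae_le _ (ae_of_all _ fun y => ?_)
    calc ‖∫⁻ z, K y z * φ z ∂ν‖ₑ ≤ ∫⁻ z, K y z * eLpNormEssSup φ ν ∂ν := by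
          refine lintegral_mono_ae ?_
          filter_upwards [enorm_ae_le_eLpNormEssSup φ ν] with z hz
          gcongr
          exact hz
      _ = (∫⁻ z, K y z ∂ν) * eLpNormEssSup φ ν := lintegral_mul_const _ (hKy y)
      _ ≤ _ := mul_le_mul_left (h1 y) _
  have hq1 : 1 ≤ q.toReal := by
    simpa using ENNReal.toReal_mono hqt hq
  have hq0 : q ≠ 0 := (zero_lt_one.trans_le hq).ne'
  have hqq : 0 < q.toReal := by linarith
  rw [eLpNorm_eq_lintegral_rpow_enorm_toReal hq0 hqt,
    eLpNorm_eq_lintegral_rpow_enorm_toReal hq0 hqt]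
  simp only [enorm_eq_self, one_div]
  rw [ENNReal.rpow_inv_le_iff hqq, ENNReal.mul_rpow_of_nonneg _ _ hqq.le, ← ENNReal.rpow_mul,
    inv_mul_cancel₀ hqq.ne', ENNReal.rpow_one]
  have hmeas : Measurable (Function.uncurry fun y z => K y z * φ z ^ q.toReal) :=
    hK.mul ((hφ.comp measurable_snd).pow_const _)
  calc ∫⁻ y, (∫⁻ z, K y z * φ z ∂ν) ^ q.toReal ∂μ
      ≤ ∫⁻ y, A ^ (q.toReal - 1) * ∫⁻ z, K y z * φ z ^ q.toReal ∂ν ∂μ := by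
        refine lintegral_mono fun y => (lintegral_mul_rpow_le hq1 (hKy y) hφ).trans ?_
        exact mul_le_mul_left (ENNReal.rpow_le_rpow (h1 y) (by linarith)) _
    _ = A ^ (q.toReal - 1) * ∫⁻ z, ∫⁻ y, K y z * φ z ^ q.toReal ∂μ ∂ν := by
        rw [lintegral_const_mul, lintegral_lintegral_swap hmeas.aemeasurable]
        exact Measurable.lintegral_prod_right hmeas
    _ ≤ A ^ (q.toReal - 1) * ∫⁻ z, A * φ z ^ q.toReal ∂ν := by
        gcongr with z
        rw [lintegral_mul_const _ (hKz z)]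
        gcongr
        exact h2 z
    _ = A ^ q.toReal * ∫⁻ z, φ z ^ q.toReal ∂ν := by
        rw [lintegral_const_mul _ (hφ.pow_const _), ← mul_assoc]
        nth_rewrite 2 [← ENNReal.rpow_one A]
        rw [← ENNReal.rpow_add_of_nonneg _ _ (by linarith) zero_le_one, sub_add_cancel]

end Integral

/-! ### The measure `dy / y` and its images -/

/-- In logarithmic coordinates the measure `dy / y` is Lebesgue measure. -/
lemma normalMeasure_eq_map_exp : normalMeasure = (volume : Measure ℝ).map Real.exp := by
  refine Measure.ext_of_lintegral _ fun f hf => ?_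
  rw [lintegral_map hf Real.measurable_exp, normalMeasure,
    lintegral_withDensity_eq_lintegral_mul _ (by fun_prop) hf, ← Real.range_exp, ← image_univ,
    lintegral_image_eq_lintegral_abs_deriv_mul MeasurableSet.univ
      (fun x _ => (Real.hasDerivAt_exp x).hasDerivWithinAt) Real.exp_injective.injOn,
    setLIntegral_univ]
  refine lintegral_congr fun x => ?_
  rw [abs_of_pos (Real.exp_pos x), Pi.mul_apply, ← mul_assoc,
    ← ENNReal.ofReal_mul (Real.exp_pos x).le, mul_inv_cancel₀ (Real.exp_pos x).ne',
    ENNReal.ofReal_one, one_mul]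

instance : SFinite normalMeasure := by
  rw [normalMeasure_eq_map_exp]; infer_instance

lemma ae_normalMeasure_pos : ∀ᵐ y ∂normalMeasure, 0 < y :=
  (withDensity_absolutelyContinuous _ _).ae_le (ae_restrict_mem measurableSet_Ioi)

/-- The measure `dy / y` on `(0, ∞)` is, up to a factor, the image of itself under `√`. -/
lemma map_sqrt_normalMeasure : normalMeasure.map Real.sqrt = (2 : ℝ≥0∞) • normalMeasure := by
  have hsqrt : Real.sqrt ∘ Real.exp = Real.exp ∘ fun x => (2⁻¹ : ℝ) • x := by
    ext x
    rw [Function.comp_apply, Function.comp_apply, Real.sqrt_eq_iff_mul_self_eq (Real.exp_pos x).le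
      (Real.exp_pos _).le, ← Real.exp_add, smul_eq_mul]
    congr 1; ring
  rw [normalMeasure_eq_map_exp, Measure.map_map (by fun_prop) Real.measurable_exp, hsqrt,
    ← Measure.map_map Real.measurable_exp (by fun_prop),
    Measure.map_addHaar_smul _ (by norm_num : (2⁻¹ : ℝ) ≠ 0), Measure.map_smul]
  simp

/-- Integration in polar coordinates: the image of `dh / |h|^m` under the norm is a multiple of
`dy / y`. -/
lemma map_norm_withDensity {E : Type*} [NormedAddCommGroup E] [NormedSpace ℝ E]
    [FiniteDimensional ℝ E] [Nontrivial E] [MeasurableSpace E] [BorelSpace E] (μ : Measure E)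
    [μ.IsAddHaarMeasure] {m : ℕ} (hm : Module.finrank ℝ E = m) :
    (μ.withDensity fun h => ENNReal.ofReal ((‖h‖ ^ m)⁻¹)).map norm =
      μ.toSphere univ • normalMeasure := by
  have hm0 : 0 < m := hm ▸ Module.finrank_pos
  refine Measure.ext_of_lintegral _ fun f hf => ?_
  have hf' : Measurable fun y : ℝ => ENNReal.ofReal ((y ^ m)⁻¹) * f y := by fun_prop
  rw [lintegral_map hf measurable_norm,
    lintegral_withDensity_eq_lintegral_mul _ (by fun_prop)
      (g := fun h => f ‖h‖) (by fun_prop),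
    lintegral_smul_measure, smul_eq_mul, normalMeasure,
    lintegral_withDensity_eq_lintegral_mul _ (by fun_prop) hf]
  calc ∫⁻ h, ENNReal.ofReal ((‖h‖ ^ m)⁻¹) * f ‖h‖ ∂μ
      = ∫⁻ h : ({0}ᶜ : Set E), ENNReal.ofReal ((‖h.1‖ ^ m)⁻¹) * f ‖h.1‖ ∂(μ.comap (↑)) := by
        rw [lintegral_subtype_comap (measurableSet_singleton _).compl
          (fun h : E => ENNReal.ofReal ((‖h‖ ^ m)⁻¹) * f ‖h‖), restrict_compl_singleton]
    _ = ∫⁻ x, ENNReal.ofReal ((x.2.1 ^ m)⁻¹) * f x.2.1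
          ∂(μ.toSphere.prod (.volumeIoiPow (m - 1))) := by
        rw [← hm]
        have := μ.measurePreserving_homeomorphUnitSphereProd.lintegral_comp_emb
          (Homeomorph.measurableEmbedding _)
          (fun x => ENNReal.ofReal ((x.2.1 ^ m)⁻¹) * f x.2.1)
        simpa [hm] using this
    _ = μ.toSphere univ * ∫⁻ y : Ioi (0 : ℝ), ENNReal.ofReal ((y.1 ^ m)⁻¹) * f y
          ∂(.volumeIoiPow (m - 1)) := by
        rw [lintegral_prod _ (by fun_prop)]
        simp [mul_comm]
    _ = _ := by
        congr 1
        rw [Measure.volumeIoiPow, lintegral_withDensity_eq_lintegral_mul _ (by fun_prop)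
          (by fun_prop)]
        simp only [Pi.mul_apply]
        rw [lintegral_subtype_comap measurableSet_Ioi
          (fun y : ℝ => ENNReal.ofReal (y ^ (m - 1)) * (ENNReal.ofReal ((y ^ m)⁻¹) * f y))]
        refine setLIntegral_congr_fun measurableSet_Ioi fun y hy => ?_
        have hy : 0 < y := hy
        rw [← mul_assoc, ← ENNReal.ofReal_mul (by positivity)]
        congr 2
        obtain ⟨k, rfl⟩ := Nat.exists_eq_succ_of_ne_zero hm0.ne'
        simp only [Nat.succ_eq_add_one, Nat.add_sub_cancel]
        field_simp
        ring

/-- The image of `dτ / |τ|` under `τ ↦ √|τ|` is a multiple of `dy / y`. -/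
lemma map_sqrt_abs_withDensity :
    ((volume : Measure ℝ).withDensity fun τ => ENNReal.ofReal (|τ|⁻¹)).map (fun τ => √|τ|) =
      ((volume : Measure ℝ).toSphere univ * 2) • normalMeasure := by
  have h := map_norm_withDensity (volume : Measure ℝ) (m := 1) (by simp)
  simp only [pow_one, Real.norm_eq_abs] at h
  rw [mul_smul, ← map_sqrt_normalMeasure, ← Measure.map_smul, ← h,
    Measure.map_map (by fun_prop) measurable_norm]
  rfl

/-! ### Schur's test for kernels decaying in logarithmic distance -/

/-- The kernel `min(ρ / y, y / ρ)^ε`, written as `exp(-ε |log ρ - log y|)`. -/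
def logKernel (ε y ρ : ℝ) : ℝ := Real.exp (-ε * |Real.log ρ - Real.log y|)

lemma measurable_logKernel (ε : ℝ) : Measurable fun x : ℝ × ℝ => logKernel ε x.1 x.2 := by
  unfold logKernel; fun_prop

lemma lintegral_exp_neg_abs_lt_top {ε : ℝ} (hε : 0 < ε) :
    ∫⁻ x : ℝ, ENNReal.ofReal (Real.exp (-ε * |x|)) < ∞ := by
  have h : Integrable (fun x : ℝ => Real.exp (-ε * |x|)) := by
    refine (integrable_fun_norm_addHaar volume (f := fun y : ℝ => Real.exp (-ε * y))).2 ?_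
    simpa using exp_neg_integrableOn_Ioi 0 hε
  exact h.lintegral_lt_top

/-- The logarithmic kernel is bounded from `L_q(ν)` to `L_q(dy / y)` when the image of `ν` under
`ρ` is a multiple of `dy / y`, with a bound that does not depend on `q`. -/
lemma exists_eLpNorm_logKernel_le {Z : Type*} [MeasurableSpace Z] {ν : Measure Z} [SFinite ν]
    {ρ : Z → ℝ} (hρ : Measurable ρ) {c : ℝ≥0∞} (hc : c ≠ ∞) (hν : ν.map ρ = c • normalMeasure)
    {ε : ℝ} (hε : 0 < ε) :
    ∃ A : ℝ≥0∞, A ≠ ∞ ∧ ∀ (q : ℝ≥0∞), 1 ≤ q → ∀ φ : Z → ℝ≥0∞, Measurable φ →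
      eLpNorm (fun y => ∫⁻ z, ENNReal.ofReal (logKernel ε y (ρ z)) * φ z ∂ν) q normalMeasure ≤
        A * eLpNorm φ q ν := by
  set I := ∫⁻ x : ℝ, ENNReal.ofReal (Real.exp (-ε * |x|)) with hI
  have hIt : I ≠ ∞ := (lintegral_exp_neg_abs_lt_top hε).ne
  have hm := measurable_logKernel ε
  have hs : ∀ a : ℝ,
      ∫⁻ y, ENNReal.ofReal (Real.exp (-ε * |Real.log y - a|)) ∂normalMeasure = I := by
    intro a
    rw [normalMeasure_eq_map_exp, lintegral_map (by fun_prop) Real.measurable_exp]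
    simp only [Real.log_exp]
    exact lintegral_sub_right_eq_self (fun x => ENNReal.ofReal (Real.exp (-ε * |x|))) a
  refine ⟨(c + 1) * I, ENNReal.mul_ne_top (by simpa using hc) hIt, fun q hq φ hφ => ?_⟩
  refine eLpNorm_lintegral_mul_le hq ?_ (fun y => ?_) (fun z => ?_) hφ
  · exact (hm.comp (measurable_fst.prodMk (hρ.comp measurable_snd))).ennreal_ofReal
  · have : ∫⁻ z, ENNReal.ofReal (logKernel ε y (ρ z)) ∂ν = c * I := by
      rw [← hs (Real.log y), ← smul_eq_mul, ← lintegral_smul_measure, ← hν,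
        lintegral_map (by fun_prop) hρ]
      rfl
    rw [this]
    gcongr
    exact le_self_add
  · have : ∫⁻ y, ENNReal.ofReal (logKernel ε y (ρ z)) ∂normalMeasure = 1 * I := by
      rw [← hs (Real.log (ρ z)), one_mul]
      simp only [logKernel, abs_sub_comm]
    rw [this]
    gcongr
    exact le_add_self

/-! ### The one-dimensional profile of the kernel -/

/-- The function `s ↦ s^{-b} e^{-1/(4s)}`, extended by zero to `s ≤ 0`. -/
def profile (b s : ℝ) : ℝ := if 0 < s then s ^ (-b) * Real.exp (-(4 * s)⁻¹) else 0

lemma profile_of_pos {b s : ℝ} (hs : 0 < s) :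
    profile b s = s ^ (-b) * Real.exp (-(4 * s)⁻¹) := if_pos hs

lemma profile_of_nonpos {b s : ℝ} (hs : s ≤ 0) : profile b s = 0 := if_neg hs.not_gt

lemma profile_nonneg (b s : ℝ) : 0 ≤ profile b s := by
  unfold profile; split_ifs <;> positivity

lemma exists_profile_le {b : ℝ} (hb : 0 < b) :
    ∃ C, 0 < C ∧ ∀ s, profile b s ≤ C * (1 + |s|) ^ (-b) := by
  set m : ℝ := max 1 (4 * b)
  have hm1 : 1 ≤ m := le_max_left _ _
  have hm0 : 0 < m := by linarith
  refine ⟨m ^ b, by positivity, fun s => ?_⟩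
  rcases le_or_gt s 0 with hs | hs
  · rw [profile_of_nonpos hs]; positivity
  rw [profile_of_pos hs, abs_of_pos hs]
  have h1 : (1 + s⁻¹) ^ b ≤ m ^ b * Real.exp (4 * s)⁻¹ := by
    have h2 : 1 + s⁻¹ ≤ m * Real.exp (s⁻¹ / m) := by
      have := Real.add_one_le_exp (s⁻¹ / m)
      calc 1 + s⁻¹ ≤ m + s⁻¹ := by linarith
        _ = m * (s⁻¹ / m + 1) := by field_simp; ring
        _ ≤ _ := by gcongr
    calc (1 + s⁻¹) ^ b ≤ (m * Real.exp (s⁻¹ / m)) ^ b := by gcongr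
      _ = m ^ b * Real.exp (s⁻¹ / m * b) := by
        rw [Real.mul_rpow hm0.le (Real.exp_pos _).le, ← Real.exp_mul]
      _ ≤ _ := by
        have h4 : b / m ≤ 4⁻¹ := by
          rw [div_le_iff₀ hm0]
          linarith [le_max_right 1 (4 * b)]
        have h5 : s⁻¹ / m * b = b / m * s⁻¹ := by ring
        rw [mul_inv, h5]
        gcongr
  have h3 : (1 + s) = s * (1 + s⁻¹) := by field_simp; ring
  rw [h3, Real.mul_rpow hs.le (by positivity), Real.rpow_neg (x := 1 + s⁻¹) (by positivity),
    Real.exp_neg]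
  calc s ^ (-b) * (Real.exp (4 * s)⁻¹)⁻¹
      = s ^ (-b) * (m ^ b * (m ^ b * Real.exp (4 * s)⁻¹)⁻¹) := by field_simp
    _ ≤ s ^ (-b) * (m ^ b * ((1 + s⁻¹) ^ b)⁻¹) := by gcongr
    _ = _ := by ring

/-- The profile is differentiable also at `s = 0`, where it vanishes to infinite order. -/
lemma hasDerivAt_profile {b : ℝ} (hb : 0 < b) (s : ℝ) :
    HasDerivAt (profile b) (-b * profile (b + 1) s + profile (b + 2) s / 4) s := by
  rcases lt_trichotomy s 0 with hs | rfl | hs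
  · rw [profile_of_nonpos hs.le, profile_of_nonpos hs.le]
    have h : profile b =ᶠ[nhds s] fun _ => 0 := by
      filter_upwards [Iio_mem_nhds hs] with x hx using profile_of_nonpos (le_of_lt hx)
    simpa using (hasDerivAt_const s (0 : ℝ)).congr_of_eventuallyEq h
  · rw [profile_of_nonpos le_rfl, profile_of_nonpos le_rfl]
    obtain ⟨C, hC, h⟩ := exists_profile_le (b := b + 2) (by linarith)
    have hbound : ∀ x, |profile b x| ≤ C * |x| ^ 2 := by
      intro x
      rw [abs_of_nonneg (profile_nonneg _ _)]
      rcases le_or_gt x 0 with hx | hx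
      · rw [profile_of_nonpos hx]; positivity
      have h2 : profile b x = x ^ 2 * profile (b + 2) x := by
        rw [profile_of_pos hx, profile_of_pos hx, ← mul_assoc, ← Real.rpow_natCast,
          ← Real.rpow_add hx]
        congr 2; push_cast; ring
      rw [h2, abs_of_pos hx, mul_comm]
      gcongr
      refine (h x).trans (mul_le_of_le_one_right hC.le ?_)
      exact Real.rpow_le_one_of_one_le_of_nonpos (by linarith [abs_nonneg x]) (by linarith)
    rw [hasDerivAt_iff_isLittleO]
    have h0 : (fun x : ℝ => profile b x - profile b 0 - (x - 0) • (-b * 0 + 0 / 4)) =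
        profile b := by
      ext x; simp [profile_of_nonpos le_rfl]
    rw [h0]
    refine (Asymptotics.IsBigO.of_bound C (Filter.Eventually.of_forall fun x => ?_)).trans_isLittleO
      (Asymptotics.isLittleO_pow_sub_sub (0 : ℝ) (m := 2) one_lt_two)
    simpa using hbound x
  · have h : profile b =ᶠ[nhds s] fun x => x ^ (-b) * Real.exp (-(4 * x)⁻¹) := by
      filter_upwards [Ioi_mem_nhds hs] with x hx using profile_of_pos hx
    refine HasDerivAt.congr_of_eventuallyEq ?_ h
    have h1 := (Real.hasDerivAt_rpow_const (x := s) (p := -b) (Or.inl hs.ne')).mul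
      ((((hasDerivAt_id s).const_mul 4).inv (by simpa using hs.ne')).neg.exp)
    refine h1.congr_deriv ?_
    rw [profile_of_pos hs, profile_of_pos hs]
    have e1 : s ^ (-(b + 1)) = s ^ (-b - 1) := by congr 1; ring
    have e2 : s ^ (-(b + 2)) = s ^ (-b) / s ^ 2 := by
      rw [← Real.rpow_natCast, ← Real.rpow_sub hs]; congr 1; push_cast; ring
    rw [e1, e2]
    simp only [id, mul_one, Pi.neg_apply, Pi.inv_apply]
    field_simp

lemma continuous_profile {b : ℝ} (hb : 0 < b) : Continuous (profile b) :=
  continuous_iff_continuousAt.2 fun s => (hasDerivAt_profile hb s).continuousAt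

lemma deriv_profile {b : ℝ} (hb : 0 < b) :
    deriv (profile b) = fun s => -b * profile (b + 1) s + profile (b + 2) s / 4 :=
  funext fun s => (hasDerivAt_profile hb s).deriv

lemma contDiff_profile {b : ℝ} (hb : 0 < b) : ContDiff ℝ 1 (profile b) := by
  rw [contDiff_one_iff_deriv, deriv_profile hb]
  refine ⟨fun s => (hasDerivAt_profile hb s).differentiableAt, ?_⟩
  have h1 := continuous_profile (b := b + 1) (by linarith)
  have h2 := continuous_profile (b := b + 2) (by linarith)
  fun_prop

/-- The derivative of the profile decays one power faster than the profile. -/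
lemma exists_abs_deriv_profile_le {b : ℝ} (hb : 0 < b) :
    ∃ C, 0 < C ∧ ∀ s, |deriv (profile b) s| ≤ C * (1 + |s|) ^ (-b - 1) := by
  obtain ⟨C1, hC1, h1⟩ := exists_profile_le (b := b + 1) (by linarith)
  obtain ⟨C2, hC2, h2⟩ := exists_profile_le (b := b + 2) (by linarith)
  refine ⟨b * C1 + C2 / 4, by positivity, fun s => ?_⟩
  rw [deriv_profile hb]
  have hs : 1 ≤ 1 + |s| := by linarith [abs_nonneg s]
  have h3 : (1 + |s|) ^ (-(b + 2)) ≤ (1 + |s|) ^ (-b - 1) :=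
    Real.rpow_le_rpow_of_exponent_le hs (by linarith)
  have e1 : (1 + |s|) ^ (-(b + 1)) = (1 + |s|) ^ (-b - 1) := by congr 1; ring
  rw [← e1] at h3 ⊢
  have := h1 s
  have h4 := (h2 s).trans (mul_le_mul_of_nonneg_left h3 hC2.le)
  have n1 := profile_nonneg (b + 1) s
  have n2 := profile_nonneg (b + 2) s
  rw [abs_le]
  constructor <;> nlinarith [mul_le_mul_of_nonneg_left this hb.le, mul_nonneg hb.le n1]

/-! ### The kernel as a function on the whole half space -/

/-- The space of points `(t, x', x_d)`, of which the half space is the part with `x_d > 0`. -/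
abbrev Half (n : ℕ) : Type := ℝ × EuclideanSpace ℝ (Fin n) × ℝ

variable {n : ℕ}

/-- The squared distance `x_d² + |x'|²` to the edge `x' = 0`, `x_d = 0`. -/
def sqDist (P : Half n) : ℝ := P.2.2 ^ 2 + ‖P.2.1‖ ^ 2

/-- The exponent `(d - α)/2 + 1` of `τ` in the kernel, with `d = n + 1`. -/
def kernelExponent (n : ℕ) (α : ℝ) : ℝ := ((n : ℝ) + 1 - α) / 2 + 1

/-- The normalizing constant of the kernel. -/
def kernelConst (n : ℕ) (α : ℝ) : ℝ :=
  1 / ((4 : ℝ) ^ (((n : ℝ) + 1 - α) / 2) * Real.pi ^ ((n : ℝ) / 2) * Real.Gamma ((1 - α) / 2))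

/-- The kernel `Q^α_{x_d}(τ, z')` extended by zero to `τ ≤ 0`, as a function of `(τ, z', x_d)`.
With `R = x_d² + |z'|²` it is a power of `R` times the profile at `τ / R`. -/
def fullKernel (α : ℝ) (P : Half n) : ℝ :=
  kernelConst n α * (P.2.2 ^ (1 - α) * (sqDist P ^ (-kernelExponent n α) *
    profile (kernelExponent n α) (P.1 / sqDist P)))

/-- The function `x_d^{1-α} (x_d² + |z'|² + |τ|)^{-(d-α)/2-1}`, which dominates the kernel. -/
def majorant (α : ℝ) (P : Half n) : ℝ :=
  P.2.2 ^ (1 - α) * (sqDist P + |P.1|) ^ (-kernelExponent n α)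

lemma sqDist_pos {P : Half n} (hP : 0 < P.2.2) : 0 < sqDist P := by
  unfold sqDist; positivity

lemma majorant_nonneg {α : ℝ} {P : Half n} (hP : 0 < P.2.2) : 0 ≤ majorant α P := by
  have := sqDist_pos hP
  unfold majorant; positivity

lemma kernelExponent_pos {α : ℝ} (hα : α < 1) : 0 < kernelExponent n α := by
  unfold kernelExponent
  have : (0 : ℝ) ≤ n := n.cast_nonneg
  linarith

lemma kernelConst_nonneg {α : ℝ} (hα : α < 1) : 0 ≤ kernelConst n α := by
  unfold kernelConst
  have := Real.Gamma_pos_of_pos (s := (1 - α) / 2) (by linarith)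
  positivity

lemma fullKernel_of_nonpos {α : ℝ} {P : Half n} (hy : 0 < P.2.2) (hτ : P.1 ≤ 0) :
    fullKernel α P = 0 := by
  rw [fullKernel, profile_of_nonpos (div_nonpos_of_nonpos_of_nonneg hτ (sqDist_pos hy).le)]
  simp

lemma fullKernel_eq_kernel {α y : ℝ} (hy : 0 < y) {w : Bdry n} (hw : 0 < w.1) :
    fullKernel α (w.1, w.2, y) = kernel n α y w := by
  have hR : 0 < sqDist (w.1, w.2, y) := sqDist_pos (P := (w.1, w.2, y)) hy
  rw [fullKernel, profile_of_pos (div_pos hw hR), kernel, kernelConst]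
  simp only
  rw [Real.div_rpow hw.le hR.le, Real.rpow_neg hw.le, Real.rpow_neg hR.le, kernelExponent,
    mul_assoc _ _ (Real.exp _)]
  congr 1
  have h1 : sqDist (w.1, w.2, y) ^ (((n : ℝ) + 1 - α) / 2 + 1) ≠ 0 :=
    (Real.rpow_pos_of_pos hR _).ne'
  have h2 : -(4 * (w.1 / sqDist (w.1, w.2, y)))⁻¹ = -(y ^ 2 + ‖w.2‖ ^ 2) / (4 * w.1) := by
    rw [neg_div, mul_div_assoc', inv_div]; rfl
  rw [h2]
  field_simp

lemma contDiffAt_fullKernel {α : ℝ} (hα : α < 1) {P : Half n} (hP : 0 < P.2.2) :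
    ContDiffAt ℝ 1 (fullKernel (n := n) α) P := by
  have hR := sqDist_pos hP
  have hR' : ContDiffAt ℝ 1 (sqDist (n := n)) P := by
    unfold sqDist
    exact ((contDiffAt_snd.comp _ contDiffAt_snd).pow 2).add
      ((contDiffAt_fst.comp _ contDiffAt_snd).norm_sq ℝ)
  have h1 : ContDiffAt ℝ 1 (fun P : Half n => P.2.2 ^ (1 - α)) P :=
    (contDiffAt_snd.comp P contDiffAt_snd).rpow_const_of_ne hP.ne'
  exact contDiffAt_const.mul (h1.mul ((hR'.rpow_const_of_ne hR.ne').mul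
    ((contDiff_profile (kernelExponent_pos hα)).contDiffAt.comp P (contDiffAt_fst.div hR' hR.ne'))))

lemma rpow_sqDist_mul {P : Half n} (hP : 0 < P.2.2) (β : ℝ) :
    sqDist P ^ β * (1 + |P.1 / sqDist P|) ^ β = (sqDist P + |P.1|) ^ β := by
  have hR := sqDist_pos hP
  rw [← Real.mul_rpow hR.le (by positivity), abs_div, abs_of_pos hR]
  congr 1
  field_simp

lemma exists_abs_fullKernel_le (n : ℕ) {α : ℝ} (hα : α < 1) :
    ∃ C, 0 < C ∧ ∀ P : Half n, 0 < P.2.2 → |fullKernel α P| ≤ C * majorant α P := by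
  obtain ⟨C, hC, h⟩ := exists_profile_le (kernelExponent_pos (n := n) hα)
  have hc := kernelConst_nonneg (n := n) hα
  refine ⟨(kernelConst n α + 1) * C, by positivity, fun P hP => ?_⟩
  have hR := sqDist_pos hP
  have h0 := profile_nonneg (kernelExponent n α) (P.1 / sqDist P)
  rw [fullKernel, abs_of_nonneg (by positivity), majorant, ← rpow_sqDist_mul hP]
  calc _ ≤ (kernelConst n α + 1) * (P.2.2 ^ (1 - α) * (sqDist P ^ (-kernelExponent n α) *
      (C * (1 + |P.1 / sqDist P|) ^ (-kernelExponent n α)))) := by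
        gcongr
        · linarith
        · exact h _
    _ = _ := by ring

lemma fderiv_fullKernel_apply {α : ℝ} (hα : α < 1) {τ y : ℝ} (hy : 0 < y)
    (z ζ : EuclideanSpace ℝ (Fin n)) (a η : ℝ) :
    fderiv ℝ (fullKernel α) (τ, z, y) (a, ζ, η) =
      kernelConst n α * (η * (1 - α) * y ^ (1 - α - 1) *
          (sqDist (τ, z, y) ^ (-kernelExponent n α) *
            profile (kernelExponent n α) (τ / sqDist (τ, z, y))) +
        y ^ (1 - α) * ((2 * y * η + 2 * inner ℝ z ζ) * -kernelExponent n α *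
            sqDist (τ, z, y) ^ (-kernelExponent n α - 1) *
            profile (kernelExponent n α) (τ / sqDist (τ, z, y)) +
          sqDist (τ, z, y) ^ (-kernelExponent n α) *
            ((a * sqDist (τ, z, y) - τ * (2 * y * η + 2 * inner ℝ z ζ)) / sqDist (τ, z, y) ^ 2 *
              deriv (profile (kernelExponent n α)) (τ / sqDist (τ, z, y))))) := by
  have hβ := kernelExponent_pos (n := n) hα
  have hR : 0 < y ^ 2 + ‖z‖ ^ 2 := by positivity
  have hline : HasDerivAt (fun s : ℝ => (τ, z, y) + s • (a, ζ, η)) (a, ζ, η) 0 := by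
    simpa using ((hasDerivAt_id (0 : ℝ)).smul_const ((a, ζ, η) : Half n)).const_add (τ, z, y)
  have hd : HasDerivAt (fun s : ℝ => fullKernel α ((τ, z, y) + s • (a, ζ, η)))
      (fderiv ℝ (fullKernel α) (τ, z, y) (a, ζ, η)) 0 := by
    refine HasFDerivAt.comp_hasDerivAt (x := (0 : ℝ)) (l := fullKernel α) ?_ hline
    simpa using ((contDiffAt_fullKernel (P := (τ, z, y)) hα hy).differentiableAt
      one_ne_zero).hasFDerivAt
  have hτ : HasDerivAt (fun s : ℝ => τ + s * a) a 0 := by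
    simpa using ((hasDerivAt_id (0 : ℝ)).mul_const a).const_add τ
  have hy' : HasDerivAt (fun s : ℝ => y + s * η) η 0 := by
    simpa using ((hasDerivAt_id (0 : ℝ)).mul_const η).const_add y
  have hz : HasDerivAt (fun s : ℝ => z + s • ζ) ζ 0 := by
    simpa using ((hasDerivAt_id (0 : ℝ)).smul_const ζ).const_add z
  have hR0 : (y + 0 * η) ^ 2 + ‖z + (0 : ℝ) • ζ‖ ^ 2 = y ^ 2 + ‖z‖ ^ 2 := by simp
  have hRd : HasDerivAt (fun s : ℝ => (y + s * η) ^ 2 + ‖z + s • ζ‖ ^ 2)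
      (2 * y * η + 2 * inner ℝ z ζ) 0 := by
    refine ((hy'.pow 2).add hz.norm_sq).congr_deriv ?_
    simp
  have hq := hτ.div hRd (by rw [hR0]; exact hR.ne')
  have hdir := (((hy'.rpow_const (p := 1 - α) (Or.inl (by simpa using hy.ne'))).mul
    ((hRd.rpow_const (p := -kernelExponent n α) (Or.inl (by rw [hR0]; exact hR.ne'))).mul
      (HasDerivAt.scomp (0 : ℝ) (hasDerivAt_profile hβ _) hq)))).const_mul (kernelConst n α)
  have hval := hd.unique hdir
  rw [← (hasDerivAt_profile hβ _).deriv] at hval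
  have hR1 : y ^ 2 + ‖z + (0 : ℝ) • ζ‖ ^ 2 = y ^ 2 + ‖z‖ ^ 2 := by simp
  simp only [Pi.mul_apply, Function.comp_apply, zero_mul, add_zero, smul_eq_mul, hR1,
    Pi.div_apply] at hval
  exact hval

/-- The derivative of `x_d² + |z'|²` is at most `2 (x_d² + |z'|²) / x_d`. -/
lemma abs_deriv_sqDist_le {y : ℝ} (hy : 0 < y) (z ζ : EuclideanSpace ℝ (Fin n)) (η τ : ℝ) :
    |2 * y * η + 2 * inner ℝ z ζ| ≤ sqDist (τ, z, y) * (2 * ((‖ζ‖ + |η|) / y)) := by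
  have hin : |inner ℝ z ζ| ≤ ‖z‖ * ‖ζ‖ := abs_real_inner_le_norm z ζ
  have e : sqDist (τ, z, y) * (2 * ((‖ζ‖ + |η|) / y)) =
      2 * (y * ‖ζ‖ + y * |η| + ‖z‖ ^ 2 / y * ‖ζ‖ + ‖z‖ ^ 2 / y * |η|) := by
    simp only [sqDist]; field_simp; ring
  have h3 : ‖z‖ ≤ y + ‖z‖ ^ 2 / y := by
    rw [← sub_nonneg]
    have : y + ‖z‖ ^ 2 / y - ‖z‖ = ((y - ‖z‖ / 2) ^ 2 + 3 / 4 * ‖z‖ ^ 2) / y := by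
      field_simp; ring
    rw [this]; positivity
  have h4 : 0 ≤ ‖z‖ ^ 2 / y * |η| := by positivity
  rw [e]
  calc |2 * y * η + 2 * inner ℝ z ζ| ≤ 2 * (y * |η|) + 2 * |inner ℝ z ζ| := by
        refine (abs_add_le _ _).trans ?_
        rw [abs_mul, abs_mul, abs_mul, abs_of_pos hy, abs_two, mul_assoc]
    _ ≤ _ := by nlinarith [norm_nonneg ζ, mul_le_mul_of_nonneg_right h3 (norm_nonneg ζ)]

/-- The real-variable estimate behind the bound for the derivative of the kernel: `p` and `p'`
stand for the profile and its derivative at `s = τ / R`, and `R'` for the derivative of `R`. -/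
lemma abs_deriv_formula_le {β γ C1 C2 B Y S R R' y τ a η D p p' : ℝ} (hβ : 0 < β) (hγ : 0 < γ)
    (hC1 : 0 < C1) (hC2 : 0 < C2) (hB : 0 ≤ B) (hY : 0 < Y) (hS : 0 < S) (hR : 0 < R)
    (hy : 0 < y) (hyR : y ^ 2 ≤ R) (hD : 0 ≤ D) (hη : |η| / y ≤ D) (hR' : |R'| ≤ R * (2 * D))
    (hp : |p| ≤ C1 * B) (hp' : |p'| ≤ C2 * (B / (1 + |τ / R|))) :
    |η * γ * (Y / y) * (S * p) + Y * (R' * -β * (S / R) * p +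
        S * ((a * R - τ * R') / R ^ 2 * p'))| ≤
      (γ * C1 + 2 * β * C1 + 2 * C2 + C2) * (|a| / y ^ 2 + D) * (Y * (S * B)) := by
  set T := |a| / y ^ 2 with hT
  have hT0 : 0 ≤ T := by positivity
  have hp2 : |(a * R - τ * R') / R ^ 2 * p'| ≤ (T + 2 * D) * (C2 * B) := by
    have h3 : |(a * R - τ * R') / R ^ 2| ≤ (T + 2 * D) * (1 + |τ / R|) := by
      have e2 : (a * R - τ * R') / R ^ 2 = a / R - τ / R * (R' / R) := by field_simp
      have h5 : |a / R| ≤ T := by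
        rw [abs_div, abs_of_pos hR]
        exact div_le_div_of_nonneg_left (abs_nonneg a) (by positivity) hyR
      have h6 : |R' / R| ≤ 2 * D := by
        rw [abs_div, abs_of_pos hR, div_le_iff₀ hR]; linarith
      rw [e2]
      calc |a / R - τ / R * (R' / R)| ≤ |a / R| + |τ / R| * |R' / R| := by
            rw [← abs_mul]; exact abs_sub _ _
        _ ≤ T + |τ / R| * (2 * D) := by gcongr
        _ ≤ _ := by nlinarith [abs_nonneg (τ / R), mul_nonneg hT0 (abs_nonneg (τ / R))]
    rw [abs_mul]
    calc _ ≤ ((T + 2 * D) * (1 + |τ / R|)) * (C2 * (B / (1 + |τ / R|))) := by gcongr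
      _ = _ := by field_simp
  have t1 : |η * γ * (Y / y) * (S * p)| ≤ γ * D * Y * S * (C1 * B) := by
    rw [abs_mul, abs_mul, abs_mul, abs_mul, abs_of_pos hγ, abs_of_pos (div_pos hY hy),
      abs_of_pos hS]
    calc |η| * γ * (Y / y) * (S * |p|) = γ * (|η| / y) * Y * S * |p| := by ring
      _ ≤ _ := by gcongr
  have t2 : |Y * (R' * -β * (S / R) * p)| ≤ (2 * D) * β * Y * S * (C1 * B) := by
    rw [abs_mul, abs_mul, abs_mul, abs_mul, abs_neg, abs_of_pos hβ, abs_of_pos hY,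
      abs_of_pos (div_pos hS hR)]
    have h6 : |R'| / R ≤ 2 * D := by rw [div_le_iff₀ hR]; linarith
    calc Y * (|R'| * β * (S / R) * |p|) = (|R'| / R) * β * Y * S * |p| := by ring
      _ ≤ _ := by gcongr
  have t3 : |Y * (S * ((a * R - τ * R') / R ^ 2 * p'))| ≤ Y * S * ((T + 2 * D) * (C2 * B)) := by
    rw [abs_mul, abs_mul, abs_of_pos hY, abs_of_pos hS, mul_assoc]
    gcongr
  rw [mul_add]
  refine (abs_add_three _ _ _).trans' (by rw [add_assoc]) |>.trans
    ((add_le_add_three t1 t2 t3).trans ?_)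
  have h0 : 0 ≤ Y * (S * B) := by positivity
  have h1 : 0 ≤ (γ * C1 + 2 * β * C1 + 2 * C2) * T + C2 * D := by positivity
  have h2 := mul_nonneg h1 h0
  calc _ = ((γ * C1 + 2 * β * C1 + 2 * C2) * D + C2 * T) * (Y * (S * B)) := by ring
    _ ≤ ((γ * C1 + 2 * β * C1 + 2 * C2) * D + C2 * T) * (Y * (S * B)) +
      ((γ * C1 + 2 * β * C1 + 2 * C2) * T + C2 * D) * (Y * (S * B)) := by linarith
    _ = _ := by ring

/-- Each spatial derivative of the kernel costs a factor `1 / x_d`, a time derivative costs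
`1 / x_d²`. -/
lemma exists_abs_fderiv_fullKernel_le (n : ℕ) {α : ℝ} (hα : α < 1) :
    ∃ C, 0 < C ∧ ∀ P : Half n, 0 < P.2.2 → ∀ v : Half n,
      |fderiv ℝ (fullKernel α) P v| ≤
        C * (|v.1| / P.2.2 ^ 2 + (‖v.2.1‖ + |v.2.2|) / P.2.2) * majorant α P := by
  have hβ := kernelExponent_pos (n := n) hα
  obtain ⟨C1, hC1, h1⟩ := exists_profile_le hβ
  obtain ⟨C2, hC2, h2⟩ := exists_abs_deriv_profile_le hβ
  have hc := kernelConst_nonneg (n := n) hα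
  have ha : 0 < 1 - α := by linarith
  refine ⟨(kernelConst n α + 1) *
    ((1 - α) * C1 + 2 * kernelExponent n α * C1 + 2 * C2 + C2), by positivity, ?_⟩
  rintro ⟨τ, z, y⟩ hy ⟨a, ζ, η⟩
  have hy : 0 < y := hy
  have hR : 0 < sqDist (τ, z, y) := sqDist_pos (P := (τ, z, y)) hy
  have hyR : y ^ 2 ≤ sqDist (τ, z, y) := by simp only [sqDist]; nlinarith [norm_nonneg z]
  have hmaj : majorant α (τ, z, y) = y ^ (1 - α) * (sqDist (τ, z, y) ^ (-kernelExponent n α) *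
      (1 + |τ / sqDist (τ, z, y)|) ^ (-kernelExponent n α)) := by
    rw [majorant, ← rpow_sqDist_mul (P := (τ, z, y)) hy]
  have key := abs_deriv_formula_le (τ := τ) (a := a) (η := η)
    (p := profile (kernelExponent n α) (τ / sqDist (τ, z, y)))
    (p' := deriv (profile (kernelExponent n α)) (τ / sqDist (τ, z, y)))
    (B := (1 + |τ / sqDist (τ, z, y)|) ^ (-kernelExponent n α)) (D := (‖ζ‖ + |η|) / y)
    hβ ha hC1 hC2 (by positivity)
    (Real.rpow_pos_of_pos hy (1 - α)) (Real.rpow_pos_of_pos hR (-kernelExponent n α)) hR hy hyR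
    (by positivity) (by gcongr; linarith [norm_nonneg ζ]) (abs_deriv_sqDist_le hy z ζ η τ)
    (by rw [abs_of_nonneg (profile_nonneg _ _)]; exact h1 _)
    (by rw [← Real.rpow_sub_one (by positivity)]; exact h2 _)
  rw [fderiv_fullKernel_apply hα hy, hmaj, Real.rpow_sub_one hy.ne', Real.rpow_sub_one hR.ne',
    abs_mul, abs_of_nonneg hc, mul_assoc (kernelConst n α + 1), mul_assoc (kernelConst n α + 1)]
  exact mul_le_mul (by linarith) key (abs_nonneg _) (by linarith)

/-! ### Integrals of the kernel and of its majorant -/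

/-- The majorant is dominated by products of functions of `τ / y²` and of `z' / y`; the total
decay can be divided between the two factors in any way. -/
lemma majorant_le_mul {α : ℝ} {P : Half n} (hP : 0 < P.2.2) {β₁ β₂ : ℝ} (h1 : 0 ≤ β₁)
    (h2 : 0 ≤ β₂) (h12 : β₁ + β₂ = kernelExponent n α) :
    majorant α P ≤ P.2.2 ^ (-((n : ℝ) + 2)) *
      ((1 + |P.1| / P.2.2 ^ 2) ^ (-β₁) * (1 + (‖P.2.1‖ / P.2.2) ^ 2) ^ (-β₂)) := by
  obtain ⟨τ, z, y⟩ := P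
  simp only at hP ⊢
  set σ := |τ| / y ^ 2
  set ρ := (‖z‖ / y) ^ 2
  have hσ : 0 ≤ σ := by positivity
  have hρ : 0 ≤ ρ := by positivity
  have e : sqDist (τ, z, y) + |τ| = y ^ 2 * (1 + σ + ρ) := by
    simp only [sqDist, σ, ρ]; field_simp; ring
  have h3 : (1 + σ + ρ) ^ (-kernelExponent n α) ≤ (1 + σ) ^ (-β₁) * (1 + ρ) ^ (-β₂) := by
    rw [← h12, neg_add, Real.rpow_add (by positivity)]
    exact mul_le_mul (Real.rpow_le_rpow_of_nonpos (by positivity) (by linarith) (by linarith))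
      (Real.rpow_le_rpow_of_nonpos (by positivity) (by linarith) (by linarith))
      (by positivity) (by positivity)
  rw [majorant]
  simp only
  rw [e, Real.mul_rpow (by positivity) (by positivity), ← mul_assoc, ← Real.rpow_natCast,
    ← Real.rpow_mul hP.le, ← Real.rpow_add hP]
  have e2 : 1 - α + ((2 : ℕ) : ℝ) * -kernelExponent n α = -((n : ℝ) + 2) := by
    unfold kernelExponent; push_cast; ring
  rw [e2]
  gcongr

lemma lintegral_comp_inv_smul {E : Type*} [NormedAddCommGroup E] [NormedSpace ℝ E]
    [FiniteDimensional ℝ E] [MeasurableSpace E] [BorelSpace E] (μ : Measure E)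
    [μ.IsAddHaarMeasure] {f : E → ℝ≥0∞} (hf : Measurable f) {R : ℝ} (hR : 0 < R) :
    ∫⁻ x, f (R⁻¹ • x) ∂μ = ENNReal.ofReal (R ^ Module.finrank ℝ E) * ∫⁻ x, f x ∂μ := by
  rw [← lintegral_map hf (measurable_const_smul _), Measure.map_addHaar_smul μ (inv_ne_zero hR.ne'),
    lintegral_smul_measure, inv_pow, inv_inv, abs_of_pos (by positivity), smul_eq_mul]

lemma lintegral_one_add_abs_div (β : ℝ) {y : ℝ} (hy : 0 < y) :
    ∫⁻ τ : ℝ, ENNReal.ofReal ((1 + |τ| / y ^ 2) ^ (-β)) =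
      ENNReal.ofReal (y ^ 2) * ∫⁻ τ : ℝ, ENNReal.ofReal ((1 + |τ|) ^ (-β)) := by
  have h := lintegral_comp_inv_smul (volume : Measure ℝ)
    (f := fun τ => ENNReal.ofReal ((1 + |τ|) ^ (-β))) (by fun_prop) (pow_pos hy 2)
  rw [Module.finrank_self, pow_one] at h
  rw [← h]
  refine lintegral_congr fun τ => ?_
  rw [smul_eq_mul, abs_mul, abs_of_pos (inv_pos.2 (pow_pos hy 2)), div_eq_inv_mul]

lemma lintegral_one_add_sq_norm_div (β : ℝ) {y : ℝ} (hy : 0 < y) :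
    ∫⁻ z : EuclideanSpace ℝ (Fin n), ENNReal.ofReal ((1 + (‖z‖ / y) ^ 2) ^ (-β)) =
      ENNReal.ofReal (y ^ n) *
        ∫⁻ z : EuclideanSpace ℝ (Fin n), ENNReal.ofReal ((1 + ‖z‖ ^ 2) ^ (-β)) := by
  have h := lintegral_comp_inv_smul (volume : Measure (EuclideanSpace ℝ (Fin n)))
    (f := fun z => ENNReal.ofReal ((1 + ‖z‖ ^ 2) ^ (-β))) (by fun_prop) hy
  rw [finrank_euclideanSpace_fin] at h
  rw [← h]
  refine lintegral_congr fun τ => ?_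
  rw [norm_smul, norm_inv, Real.norm_eq_abs, abs_of_pos hy, div_eq_inv_mul]

lemma lintegral_one_add_abs_lt_top {β : ℝ} (hβ : 1 < β) :
    ∫⁻ τ : ℝ, ENNReal.ofReal ((1 + |τ|) ^ (-β)) < ∞ :=
  (integrable_one_add_norm (E := ℝ) (μ := volume) (r := β) (by simpa using hβ)).lintegral_lt_top

lemma lintegral_one_add_sq_norm_lt_top {β : ℝ} (hβ : (n : ℝ) < 2 * β) :
    ∫⁻ z : EuclideanSpace ℝ (Fin n), ENNReal.ofReal ((1 + ‖z‖ ^ 2) ^ (-β)) < ∞ := by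
  have h := (integrable_rpow_neg_one_add_norm_sq (E := EuclideanSpace ℝ (Fin n)) (μ := volume)
    (r := 2 * β) (by simpa using hβ)).lintegral_lt_top
  have e : -(2 * β) / 2 = -β := by ring
  rwa [e] at h

lemma continuous_majorant (α : ℝ) {y : ℝ} (hy : 0 < y) :
    Continuous fun w : Bdry n => majorant α (w.1, w.2, y) := by
  have h : ∀ w : Bdry n, sqDist (w.1, w.2, y) + |w.1| ≠ 0 := fun w => by
    have := sqDist_pos (P := (w.1, w.2, y)) hy
    positivity
  unfold majorant
  refine Continuous.mul (f := fun _ => y ^ (1 - α)) continuous_const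
    (Continuous.rpow_const ?_ fun w => Or.inl (h w))
  unfold sqDist
  fun_prop

lemma integrable_majorant {α : ℝ} (hα : α < 1) {y : ℝ} (hy : 0 < y) :
    Integrable fun w : Bdry n => majorant α (w.1, w.2, y) := by
  -- The total decay exceeds the critical one by `(1 - α) / 2`, half of which goes to each factor.
  set δ := (1 - α) / 4 with hδ
  have hδ0 : 0 < δ := by rw [hδ]; linarith
  have hn : (0 : ℝ) ≤ n := n.cast_nonneg
  refine ⟨(continuous_majorant α hy).aestronglyMeasurable, ?_⟩
  have hle : ∀ w : Bdry n, ‖majorant α (w.1, w.2, y)‖ₑ ≤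
      ENNReal.ofReal (y ^ (-((n : ℝ) + 2))) * (ENNReal.ofReal ((1 + |w.1| / y ^ 2) ^ (-(1 + δ))) *
        ENNReal.ofReal ((1 + (‖w.2‖ / y) ^ 2) ^ (-(n / 2 + δ)))) := by
    intro w
    rw [← ENNReal.ofReal_mul (by positivity), ← ENNReal.ofReal_mul (by positivity),
      Real.enorm_eq_ofReal (majorant_nonneg (P := (w.1, w.2, y)) hy)]
    exact ENNReal.ofReal_le_ofReal (majorant_le_mul (P := (w.1, w.2, y)) hy (by positivity)
      (by positivity) (by rw [hδ, kernelExponent]; ring))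
  refine (lintegral_mono hle).trans_lt ?_
  rw [lintegral_const_mul _ (by fun_prop), Measure.volume_eq_prod,
    lintegral_prod_mul (f := fun τ : ℝ => ENNReal.ofReal ((1 + |τ| / y ^ 2) ^ (-(1 + δ))))
      (g := fun z : EuclideanSpace ℝ (Fin n) =>
        ENNReal.ofReal ((1 + (‖z‖ / y) ^ 2) ^ (-((n : ℝ) / 2 + δ)))) (by fun_prop) (by fun_prop),
    lintegral_one_add_abs_div _ hy,
    lintegral_one_add_sq_norm_div _ hy]
  refine ENNReal.mul_lt_top ENNReal.ofReal_lt_top (ENNReal.mul_lt_top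
    (ENNReal.mul_lt_top ENNReal.ofReal_lt_top (lintegral_one_add_abs_lt_top (by linarith)))
    (ENNReal.mul_lt_top ENNReal.ofReal_lt_top (lintegral_one_add_sq_norm_lt_top (by linarith))))

lemma majorant_one_le {α : ℝ} (hα : α < 1) (w : Bdry n) : majorant α (w.1, w.2, 1) ≤ 1 := by
  have h : 1 ≤ sqDist (w.1, w.2, 1) + |w.1| := by
    simp only [sqDist]; nlinarith [abs_nonneg w.1, norm_nonneg w.2]
  rw [majorant]
  simp only [Real.one_rpow, one_mul]
  exact Real.rpow_le_one_of_one_le_of_nonpos h (by linarith [kernelExponent_pos (n := n) hα])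

lemma continuous_fullKernel {α : ℝ} (hα : α < 1) {y : ℝ} (hy : 0 < y) :
    Continuous fun w : Bdry n => fullKernel α (w.1, w.2, y) :=
  continuous_iff_continuousAt.2 fun w =>
    ContinuousAt.comp (f := fun w : Bdry n => ((w.1, w.2, y) : Half n)) (g := fullKernel α)
      (contDiffAt_fullKernel (P := (w.1, w.2, y)) hα hy).continuousAt (by fun_prop)

lemma integrable_fullKernel {α : ℝ} (hα : α < 1) {y : ℝ} (hy : 0 < y) :
    Integrable fun w : Bdry n => fullKernel α (w.1, w.2, y) := by
  obtain ⟨C, -, h⟩ := exists_abs_fullKernel_le n hα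
  exact ((integrable_majorant hα hy).const_mul C).mono'
    (continuous_fullKernel hα hy).aestronglyMeasurable (ae_of_all _ fun w => h _ hy)

/-- The kernel is normalized. -/
lemma integral_fullKernel {α : ℝ} (hα : α < 1) {y : ℝ} (hy : 0 < y) :
    ∫ w : Bdry n, fullKernel α (w.1, w.2, y) = 1 := by
  have hint := integrable_fullKernel (n := n) hα hy
  rw [Measure.volume_eq_prod] at hint ⊢
  rw [integral_prod _ hint]
  set a := (1 - α) / 2 with ha
  have ha0 : 0 < a := by rw [ha]; linarith
  have hΓ := Real.Gamma_pos_of_pos ha0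
  set K := kernelConst n α * y ^ (1 - α) * (4 * Real.pi) ^ ((n : ℝ) / 2) with hK
  have hin : ∀ τ ∈ Ioi (0 : ℝ), ∫ z : EuclideanSpace ℝ (Fin n), fullKernel α (τ, z, y) =
      K * (|(-1 : ℝ)| * τ ^ ((-1 : ℝ) - 1) *
        ((τ ^ (-1 : ℝ)) ^ (a - 1) * Real.exp (-(y ^ 2 / 4 * τ ^ (-1 : ℝ))))) := by
    intro τ hτ
    have hτ : 0 < τ := hτ
    have e : ∀ z : EuclideanSpace ℝ (Fin n), fullKernel α (τ, z, y) =
        (kernelConst n α * (y ^ (1 - α) / τ ^ (((n : ℝ) + 1 - α) / 2 + 1)) *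
          Real.exp (-(y ^ 2 / 4 * τ ^ (-1 : ℝ)))) * Real.exp (-(4 * τ)⁻¹ * ‖z‖ ^ 2) := by
      intro z
      rw [fullKernel_eq_kernel (w := (τ, z)) hy hτ, kernel, ← kernelConst,
        mul_assoc _ (Real.exp _) (Real.exp _), ← Real.exp_add]
      congr 2
      rw [Real.rpow_neg_one]
      field_simp
      ring
    simp only [e]
    rw [integral_const_mul, GaussianFourier.integral_rexp_neg_mul_sq_norm (by positivity),
      finrank_euclideanSpace_fin, hK]
    have e1 : Real.pi / (4 * τ)⁻¹ = (4 * Real.pi) * τ := by field_simp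
    have e2 : τ ^ ((n : ℝ) / 2) / τ ^ (((n : ℝ) + 1 - α) / 2 + 1) =
        τ ^ ((-1 : ℝ) - 1) * (τ ^ (-1 : ℝ)) ^ (a - 1) := by
      rw [← Real.rpow_sub hτ, ← Real.rpow_mul hτ.le, ← Real.rpow_add hτ]
      congr 1; rw [ha]; ring
    rw [e1, Real.mul_rpow (by positivity) hτ.le]
    calc _ = kernelConst n α * y ^ (1 - α) * (4 * Real.pi) ^ ((n : ℝ) / 2) *
          (τ ^ ((n : ℝ) / 2) / τ ^ (((n : ℝ) + 1 - α) / 2 + 1)) *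
          Real.exp (-(y ^ 2 / 4 * τ ^ (-1 : ℝ))) := by ring
      _ = _ := by rw [e2]; simp; ring
  have hsupp : ∀ τ ∉ Ioi (0 : ℝ), ∫ z : EuclideanSpace ℝ (Fin n), fullKernel α (τ, z, y) = 0 := by
    intro τ hτ
    simp [fullKernel_of_nonpos (P := (τ, _, y)) hy (not_lt.1 hτ)]
  rw [← setIntegral_eq_integral_of_forall_compl_eq_zero hsupp,
    setIntegral_congr_fun measurableSet_Ioi hin, integral_const_mul]
  have hsub := integral_comp_rpow_Ioi
    (fun t : ℝ => t ^ (a - 1) * Real.exp (-(y ^ 2 / 4 * t))) (p := -1) (by norm_num)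
  simp only [smul_eq_mul] at hsub
  rw [hsub, Real.integral_rpow_mul_exp_neg_mul_Ioi ha0 (by positivity), hK, kernelConst, ← ha]
  have e3 : (4 : ℝ) ^ (((n : ℝ) + 1 - α) / 2) = 4 ^ ((n : ℝ) / 2) * 4 ^ a := by
    rw [← Real.rpow_add (by norm_num)]; congr 1; rw [ha]; ring
  have e4 : (1 / (y ^ 2 / 4)) ^ a = 4 ^ a / y ^ (1 - α) := by
    rw [one_div_div, Real.div_rpow (by norm_num) (by positivity), ← Real.rpow_natCast y 2,
      ← Real.rpow_mul hy.le]
    congr 2; rw [ha]; push_cast; ring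
  rw [e3, e4, Real.mul_rpow (by norm_num) Real.pi_pos.le]
  have := Real.pi_pos
  field_simp

/-- Near a point of the half space, translates of the majorant are dominated by one function. -/
lemma exists_majorant_le {α : ℝ} (hα : α < 1) {P₀ : Half n} (hP : 0 < P₀.2.2) :
    ∃ C, 0 < C ∧ ∃ r > 0, ∀ P ∈ Metric.ball P₀ r, P₀.2.2 / 2 < P.2.2 ∧ ∀ w : Bdry n,
      majorant α (P.1 - w.1, P.2.1 - w.2, P.2.2) ≤
        C * majorant α (P₀.1 - w.1, P₀.2.1 - w.2, 1) := by
  obtain ⟨t₀, x₀, y₀⟩ := P₀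
  simp only at hP ⊢
  have hβ := kernelExponent_pos (n := n) hα
  refine ⟨(2 * y₀) ^ (1 - α) * (2 + 16 / y₀ ^ 2) ^ (kernelExponent n α), by positivity,
    min 1 (y₀ / 2), by positivity, ?_⟩
  rintro ⟨t, x, y⟩ hball
  simp only [Metric.mem_ball, Prod.dist_eq, max_lt_iff, lt_min_iff] at hball
  simp only [dist_eq_norm, Real.norm_eq_abs] at hball
  obtain ⟨⟨ht, hx, -⟩, -, -, hy⟩ := hball
  have hy1 : y₀ / 2 < y := by linarith [(abs_lt.1 hy).1]
  have hy2 : y ≤ 2 * y₀ := by linarith [(abs_lt.1 hy).2]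
  have hy0 : 0 < y := by linarith
  refine ⟨hy1, fun w => ?_⟩
  simp only [majorant, sqDist, Real.one_rpow, one_pow, one_mul]
  set a := |t - w.1|
  set b := ‖x - w.2‖
  set K := 2 + 16 / y₀ ^ 2
  have hK : 0 < K := by positivity
  have ha : |t₀ - w.1| ≤ a + 1 := by
    have : t₀ - w.1 = (t - w.1) - (t - t₀) := by ring
    rw [this]
    exact (abs_sub _ _).trans (by linarith)
  have hb : ‖x₀ - w.2‖ ≤ b + 1 := by
    have : x₀ - w.2 = (x - w.2) - (x - x₀) := by abel
    rw [this]
    exact (norm_sub_le _ _).trans (by linarith)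
  have hN : 1 + ‖x₀ - w.2‖ ^ 2 + |t₀ - w.1| ≤ K * (y ^ 2 + b ^ 2 + a) := by
    have h1 : ‖x₀ - w.2‖ ^ 2 ≤ (b + 1) ^ 2 := by gcongr
    have h2 : 4 ≤ 16 / y₀ ^ 2 * y ^ 2 := by
      have : y₀ ^ 2 / 4 ≤ y ^ 2 := by nlinarith
      calc (4 : ℝ) = 16 / y₀ ^ 2 * (y₀ ^ 2 / 4) := by field_simp; norm_num
        _ ≤ _ := by gcongr
    have h3 : 0 ≤ 16 / y₀ ^ 2 * (b ^ 2 + a) := by positivity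
    have h4 : 0 ≤ a := abs_nonneg _
    have h5 : K * (y ^ 2 + b ^ 2 + a) =
      2 * (y ^ 2 + b ^ 2 + a) + 16 / y₀ ^ 2 * y ^ 2 + 16 / y₀ ^ 2 * (b ^ 2 + a) := by ring
    nlinarith [sq_nonneg (b - 1), sq_nonneg y]
  have hM : 0 < y ^ 2 + b ^ 2 + a := by positivity
  have h6 : (y ^ 2 + b ^ 2 + a) ^ (-kernelExponent n α) ≤
      K ^ kernelExponent n α * (1 + ‖x₀ - w.2‖ ^ 2 + |t₀ - w.1|) ^ (-kernelExponent n α) := by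
    have h7 := Real.rpow_le_rpow_of_nonpos (by positivity) hN (neg_nonpos.2 hβ.le)
    rw [Real.mul_rpow hK.le hM.le, Real.rpow_neg hK.le] at h7
    have h8 : 0 < K ^ kernelExponent n α := by positivity
    calc _ = K ^ kernelExponent n α * ((K ^ kernelExponent n α)⁻¹ *
        (y ^ 2 + b ^ 2 + a) ^ (-kernelExponent n α)) := by field_simp
      _ ≤ _ := by gcongr
  rw [mul_assoc]
  gcongr

variable {𝕜 : Type*} [RCLike 𝕜]

/-! ### Differentiation of the extension -/

instance : (volume : Measure (Bdry n)).IsNegInvariant :=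
  ⟨((Measure.measurePreserving_neg (volume : Measure ℝ)).prod
    (Measure.measurePreserving_neg (volume : Measure (EuclideanSpace ℝ (Fin n))))).map_eq⟩

instance : (volume : Measure (Bdry n)).IsAddHaarMeasure :=
  Measure.prod.instIsAddHaarMeasure _ _

/-- The translate `(t - τ, x' - z', x_d)` of `(t, x', x_d)` by the boundary vector `(τ, z')`. -/
def translate (P : Half n) (w : Bdry n) : Half n := (P.1 - w.1, P.2.1 - w.2, P.2.2)

/-- The extension as a function on the half space, with the kernel carrying the variable. -/
def halfExtension (α : ℝ) (g : Bdry n → 𝕜) (P : Half n) : 𝕜 :=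
  ∫ w, fullKernel α (translate P w) • g w

lemma translate_eq_sub (P : Half n) (w : Bdry n) :
    translate P w = P - ((w.1, w.2, 0) : Half n) := by
  ext <;> simp [translate]

lemma continuous_translate (P : Half n) : Continuous (translate P) := by
  unfold translate; fun_prop

lemma integrable_mul_norm_of_memLp {Y : Type*} [MeasurableSpace Y] {μ : Measure Y} {p : ℝ≥0∞}
    (hp : 1 ≤ p) {M : Y → ℝ} (hM : Integrable M μ) (h0 : ∀ w, 0 ≤ M w) (h1 : ∀ w, M w ≤ 1)
    {g : Y → 𝕜} (hg : MemLp g p μ) : Integrable (fun w => M w * ‖g w‖) μ := by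
  rcases eq_or_ne p ∞ with rfl | hpt
  · obtain ⟨K, hK⟩ : ∃ K, ∀ᵐ w ∂μ, ‖g w‖ ≤ K := ⟨_, ae_le_lpNorm_exponent_top hg⟩
    refine (hM.mul_const K).mono' (hM.1.mul hg.1.norm) ?_
    filter_upwards [hK] with w hw
    rw [Real.norm_of_nonneg (mul_nonneg (h0 w) (norm_nonneg _))]
    exact mul_le_mul_of_nonneg_left hw (h0 w)
  · have hp1 : 1 ≤ p.toReal := by simpa using ENNReal.toReal_mono hpt hp
    refine (hM.add (hg.integrable_norm_rpow (zero_lt_one.trans_le hp).ne' hpt)).mono'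
      (hM.1.mul hg.1.norm) (ae_of_all _ fun w => ?_)
    rw [Real.norm_of_nonneg (mul_nonneg (h0 w) (norm_nonneg _)), Pi.add_apply]
    rcases le_total ‖g w‖ 1 with h | h
    · have := Real.rpow_nonneg (norm_nonneg (g w)) p.toReal
      nlinarith [h0 w]
    · have := Real.self_le_rpow_of_one_le h hp1
      nlinarith [h0 w, h1 w]

/-- The translates of the majorant are integrable against functions in `L_p`. -/
lemma integrable_majorant_translate_mul {α : ℝ} (hα : α < 1) {p : ℝ≥0∞} (hp : 1 ≤ p)
    {g : Bdry n → 𝕜} (hg : MemLp g p volume) (P : Half n) :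
    Integrable fun w : Bdry n => majorant α (P.1 - w.1, P.2.1 - w.2, 1) * ‖g w‖ := by
  have h0 : Integrable fun w : Bdry n => majorant α (P.1 - w.1, P.2.1 - w.2, 1) :=
    (integrable_majorant (n := n) hα one_pos).comp_sub_left ((P.1, P.2.1) : Bdry n)
  have h1 : ∀ w : Bdry n, 0 ≤ majorant α (P.1 - w.1, P.2.1 - w.2, 1) := fun w =>
    majorant_nonneg (P := (P.1 - w.1, P.2.1 - w.2, 1)) one_pos
  have h2 : ∀ w : Bdry n, majorant α (P.1 - w.1, P.2.1 - w.2, 1) ≤ 1 := fun w =>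
    majorant_one_le hα (P.1 - w.1, P.2.1 - w.2)
  exact integrable_mul_norm_of_memLp hp h0 h1 h2 hg

lemma integrable_fullKernel_smul {α : ℝ} (hα : α < 1) {p : ℝ≥0∞} (hp : 1 ≤ p)
    {g : Bdry n → 𝕜} (hg : MemLp g p volume) {P : Half n} (hP : 0 < P.2.2) :
    Integrable fun w => fullKernel α (translate P w) • g w := by
  obtain ⟨C, hC, h⟩ := exists_abs_fullKernel_le n hα
  obtain ⟨C', hC', r, hr, hball⟩ := exists_majorant_le hα hP
  refine ((integrable_majorant_translate_mul hα hp hg P).const_mul (C * C')).mono'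
    (AEStronglyMeasurable.smul ?_ hg.1) (ae_of_all _ fun w => ?_)
  · exact ((continuous_fullKernel hα hP).comp (f := fun w : Bdry n => (P.1 - w.1, P.2.1 - w.2))
      (by fun_prop)).aestronglyMeasurable
  · rw [norm_smul, Real.norm_eq_abs, ← mul_assoc]
    gcongr
    refine (h (translate P w) hP).trans ?_
    rw [mul_assoc]
    gcongr
    exact (hball P (Metric.mem_ball_self hr)).2 w

lemma integrand_eqOn {α : ℝ} {g : Bdry n → 𝕜} {t : ℝ} {x : EuclideanSpace ℝ (Fin n)} {y : ℝ}
    (hy : 0 < y) : EqOn (integrand α g t x y)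
      (fun w => fullKernel α (w.1, w.2, y) • g ((t, x) - w)) (past n) := fun w hw => by
  rw [integrand, ← fullKernel_eq_kernel hy hw.1]; rfl

lemma measurableSet_past : MeasurableSet (past n) := measurableSet_Ioi.prod MeasurableSet.univ

lemma integrableOn_integrand {α : ℝ} (hα : α < 1) {p : ℝ≥0∞} (hp : 1 ≤ p)
    {g : Bdry n → 𝕜} (hg : MemLp g p volume) (t : ℝ) (x : EuclideanSpace ℝ (Fin n)) {y : ℝ}
    (hy : 0 < y) : IntegrableOn (integrand α g t x y) (past n) volume := by
  rw [integrableOn_congr_fun (integrand_eqOn hy) measurableSet_past]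
  have h := (integrable_fullKernel_smul hα hp hg (P := (t, x, y)) hy).comp_sub_left (t, x)
  refine Integrable.integrableOn (h.congr (ae_of_all _ fun w => ?_))
  simp [translate]

lemma extension_eq_integral {α : ℝ} (g : Bdry n → 𝕜) (t : ℝ) (x : EuclideanSpace ℝ (Fin n))
    {y : ℝ} (hy : 0 < y) :
    extension α g t x y = ∫ w, fullKernel α (w.1, w.2, y) • g ((t, x) - w) := by
  rw [extension, setIntegral_congr_fun measurableSet_past (integrand_eqOn hy)]
  refine setIntegral_eq_integral_of_forall_compl_eq_zero fun w hw => ?_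
  have hw1 : w.1 ≤ 0 := by simpa [past] using hw
  rw [fullKernel_of_nonpos (P := (w.1, w.2, y)) hy hw1, zero_smul]

lemma extension_eq_halfExtension {α : ℝ} (g : Bdry n → 𝕜) (t : ℝ)
    (x : EuclideanSpace ℝ (Fin n)) {y : ℝ} (hy : 0 < y) :
    extension α g t x y = halfExtension α g (t, x, y) := by
  rw [extension_eq_integral g t x hy, halfExtension,
    ← integral_sub_left_eq_self _ volume ((t, x) : Bdry n)]
  refine integral_congr_ae (ae_of_all _ fun w => ?_)
  simp [translate]

lemma norm_fderiv_fullKernel_le (n : ℕ) {α : ℝ} (hα : α < 1) :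
    ∃ C, 0 < C ∧ ∀ P : Half n, 0 < P.2.2 →
      ‖fderiv ℝ (fullKernel α) P‖ ≤ C * (1 / P.2.2 ^ 2 + 2 / P.2.2) * majorant α P := by
  obtain ⟨C, hC, h⟩ := exists_abs_fderiv_fullKernel_le n hα
  refine ⟨C, hC, fun P hP => ContinuousLinearMap.opNorm_le_bound _ ?_ fun v => ?_⟩
  · have := majorant_nonneg (α := α) hP
    positivity
  · refine (h P hP v).trans ?_
    have h1 : |v.1| ≤ ‖v‖ := norm_fst_le v
    have h2 : ‖v.2.1‖ ≤ ‖v‖ := (norm_fst_le v.2).trans (norm_snd_le v)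
    have h3 : |v.2.2| ≤ ‖v‖ := (norm_snd_le v.2).trans (norm_snd_le v)
    have := majorant_nonneg (α := α) hP
    calc _ ≤ C * (‖v‖ / P.2.2 ^ 2 + (‖v‖ + ‖v‖) / P.2.2) * majorant α P := by gcongr
      _ = _ := by ring

/-- The derivative of the integrand of the extension is dominated by one integrable function,
locally uniformly in the half space. -/
lemma exists_bound_fderiv {α : ℝ} (hα : α < 1) {p : ℝ≥0∞} (hp : 1 ≤ p)
    {g : Bdry n → 𝕜} (hg : MemLp g p volume) {P₀ : Half n} (hP : 0 < P₀.2.2) :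
    ∃ r > 0, ∃ B : Bdry n → ℝ, Integrable B ∧ ∀ P ∈ Metric.ball P₀ r, 0 < P.2.2 ∧ ∀ w,
      ‖(fderiv ℝ (fullKernel α) (translate P w)).smulRight (g w)‖ ≤ B w := by
  obtain ⟨C, hC, h⟩ := norm_fderiv_fullKernel_le n hα
  obtain ⟨C', hC', r, hr, hball⟩ := exists_majorant_le hα hP
  refine ⟨r, hr, _, (integrable_majorant_translate_mul hα hp hg P₀).const_mul
    (C * (1 / (P₀.2.2 / 2) ^ 2 + 2 / (P₀.2.2 / 2)) * C'), fun P hPr => ?_⟩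
  obtain ⟨hy, hM⟩ := hball P hPr
  have hy0 : 0 < P.2.2 := by linarith
  refine ⟨hy0, fun w => ?_⟩
  rw [ContinuousLinearMap.norm_smulRight_apply, ← mul_assoc]
  gcongr
  refine (h (translate P w) hy0).trans ?_
  rw [mul_assoc _ C']
  have := majorant_nonneg (α := α) (P := translate P w) hy0
  have h1 : (translate P w).2.2 = P.2.2 := rfl
  rw [h1]
  gcongr
  exact hM w

lemma continuousAt_fderiv_fullKernel {α : ℝ} (hα : α < 1) {P : Half n} (hP : 0 < P.2.2) :
    ContinuousAt (fderiv ℝ (fullKernel (n := n) α)) P :=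
  ((contDiffAt_fullKernel hα hP).fderiv_right (m := 0) (by simp)).continuousAt

lemma aestronglyMeasurable_fderiv_smulRight {α : ℝ} (hα : α < 1) {g : Bdry n → 𝕜}
    (hg : AEStronglyMeasurable g volume) {P : Half n} (hP : 0 < P.2.2) :
    AEStronglyMeasurable (fun w => (fderiv ℝ (fullKernel α) (translate P w)).smulRight (g w))
      volume := by
  have h : Continuous fun w : Bdry n => fderiv ℝ (fullKernel α) (translate P w) :=
    continuous_iff_continuousAt.2 fun w =>
      (continuousAt_fderiv_fullKernel (P := translate P w) hα hP).comp
        (continuous_translate P).continuousAt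
  exact (ContinuousLinearMap.smulRightL ℝ (Half n) 𝕜).aestronglyMeasurable_comp₂
    h.aestronglyMeasurable hg

/-- The derivative of the extension, obtained by differentiating the kernel. -/
def extensionDeriv (α : ℝ) (g : Bdry n → 𝕜) (P : Half n) : Half n →L[ℝ] 𝕜 :=
  ∫ w, (fderiv ℝ (fullKernel α) (translate P w)).smulRight (g w)

lemma integrable_fderiv_smulRight {α : ℝ} (hα : α < 1) {p : ℝ≥0∞} (hp : 1 ≤ p)
    {g : Bdry n → 𝕜} (hg : MemLp g p volume) {P : Half n} (hP : 0 < P.2.2) :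
    Integrable fun w => (fderiv ℝ (fullKernel α) (translate P w)).smulRight (g w) := by
  obtain ⟨r, hr, B, hB, h⟩ := exists_bound_fderiv hα hp hg hP
  exact hB.mono' (aestronglyMeasurable_fderiv_smulRight hα hg.1 hP)
    (ae_of_all _ (h P (Metric.mem_ball_self hr)).2)

lemma hasFDerivAt_halfExtension {α : ℝ} (hα : α < 1) {p : ℝ≥0∞} (hp : 1 ≤ p)
    {g : Bdry n → 𝕜} (hg : MemLp g p volume) {P : Half n} (hP : 0 < P.2.2) :
    HasFDerivAt (halfExtension α g) (extensionDeriv α g P) P := by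
  obtain ⟨r, hr, B, hB, h⟩ := exists_bound_fderiv hα hp hg hP
  refine hasFDerivAt_integral_of_dominated_of_fderiv_le (Metric.ball_mem_nhds P hr)
    (F' := fun P w => (fderiv ℝ (fullKernel α) (translate P w)).smulRight (g w)) ?_
    (integrable_fullKernel_smul hα hp hg hP) (aestronglyMeasurable_fderiv_smulRight hα hg.1 hP)
    (ae_of_all _ fun w P hPr => (h P hPr).2 w) hB (ae_of_all _ fun w Q hQ => ?_)
  · filter_upwards [Metric.ball_mem_nhds P hr] with Q hQ
    exact (integrable_fullKernel_smul hα hp hg (h Q hQ).1).1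
  · have h1 := ((contDiffAt_fullKernel (P := translate Q w) hα (h Q hQ).1).differentiableAt
      one_ne_zero).hasFDerivAt
    simp only [translate_eq_sub] at h1 ⊢
    exact ((hasFDerivAt_comp_sub _).2 h1).smul_const (g w)

lemma continuousAt_extensionDeriv {α : ℝ} (hα : α < 1) {p : ℝ≥0∞} (hp : 1 ≤ p)
    {g : Bdry n → 𝕜} (hg : MemLp g p volume) {P : Half n} (hP : 0 < P.2.2) :
    ContinuousAt (extensionDeriv α g) P := by
  obtain ⟨r, hr, B, hB, h⟩ := exists_bound_fderiv hα hp hg hP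
  refine continuousAt_of_dominated (bound := B) ?_ ?_ hB (ae_of_all _ fun w => ?_)
  · filter_upwards [Metric.ball_mem_nhds P hr] with Q hQ
    exact aestronglyMeasurable_fderiv_smulRight hα hg.1 (h Q hQ).1
  · filter_upwards [Metric.ball_mem_nhds P hr] with Q hQ
    exact ae_of_all _ (h Q hQ).2
  · have h1 : ContinuousAt (fun P : Half n => translate P w) P := by
      unfold translate; fun_prop
    have h2 := ContinuousAt.comp (f := fun P : Half n => translate P w)
      (continuousAt_fderiv_fullKernel (P := translate P w) hα hP) h1
    exact ContinuousAt.comp (f := fun P : Half n => fderiv ℝ (fullKernel α) (translate P w))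
      ((ContinuousLinearMap.smulRightL ℝ (Half n) 𝕜).flip (g w)).continuous.continuousAt h2

lemma extensionDeriv_apply {α : ℝ} (hα : α < 1) {p : ℝ≥0∞} (hp : 1 ≤ p)
    {g : Bdry n → 𝕜} (hg : MemLp g p volume) {P : Half n} (hP : 0 < P.2.2) (v : Half n) :
    extensionDeriv α g P v = ∫ w, fderiv ℝ (fullKernel α) (translate P w) v • g w := by
  rw [extensionDeriv, ContinuousLinearMap.integral_apply (integrable_fderiv_smulRight hα hp hg hP)]
  rfl

/-- The extension of a constant is constant, so the derivatives of the kernel have integral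
zero. -/
lemma integral_fderiv_fullKernel {α : ℝ} (hα : α < 1) {P : Half n} (hP : 0 < P.2.2)
    (v : Half n) : ∫ w : Bdry n, fderiv ℝ (fullKernel α) (translate P w) v = 0 := by
  have h1 : MemLp (fun _ : Bdry n => (1 : ℝ)) ∞ volume := memLp_top_const 1
  have h2 := hasFDerivAt_halfExtension hα le_top h1 hP
  have h3 : halfExtension α (fun _ : Bdry n => (1 : ℝ)) =ᶠ[nhds P] fun _ => 1 := by
    have ho : IsOpen {P : Half n | 0 < P.2.2} :=
      isOpen_lt continuous_const (continuous_snd.comp continuous_snd)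
    filter_upwards [ho.mem_nhds hP] with Q hQ
    obtain ⟨t, x, y⟩ := Q
    rw [← extension_eq_halfExtension _ _ _ hQ, extension_eq_integral _ _ _ hQ]
    simpa using integral_fullKernel hα hQ
  have h4 := h2.unique ((hasFDerivAt_const (1 : ℝ) P).congr_of_eventuallyEq h3)
  have h5 := extensionDeriv_apply hα le_top h1 hP v
  rw [h4] at h5
  simpa using h5.symm

lemma differentiableOn_extension {α : ℝ} (hα : α < 1) {p : ℝ≥0∞} (hp : 1 ≤ p)
    {g : Bdry n → 𝕜} (hg : MemLp g p volume) :
    DifferentiableOn ℝ (fun P : Half n => extension α g P.1 P.2.1 P.2.2) {P | 0 < P.2.2} :=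
  fun _ hP =>
    ((hasFDerivAt_halfExtension hα hp hg hP).differentiableAt.differentiableWithinAt).congr
    (fun _ hQ => extension_eq_halfExtension g _ _ hQ) (extension_eq_halfExtension g _ _ hP)

/-! ### Moduli of smoothness -/

lemma eLpNorm_le_const_mul {Y E F : Type*} [MeasurableSpace Y] {μ : Measure Y}
    [TopologicalSpace E] [ContinuousENorm E] [TopologicalSpace F] [ContinuousENorm F]
    {f : Y → E} {g : Y → F} {c : ℝ≥0∞} (hc : c ≠ ∞) (h : ∀ᵐ y ∂μ, ‖f y‖ₑ ≤ c * ‖g y‖ₑ)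
    (p : ℝ≥0∞) : eLpNorm f p μ ≤ c * eLpNorm g p μ := by
  lift c to NNReal using hc
  exact eLpNorm_le_nnreal_smul_eLpNorm_of_ae_le_mul' h p

/-- The norm `‖g(t, x' + h) - g(t, x')‖_{L_p}` of a first difference in `x'`. -/
def spaceModulus (p : ℝ≥0∞) (g : Bdry n → 𝕜) (h : EuclideanSpace ℝ (Fin n)) : ℝ≥0∞ :=
  eLpNorm (fun z : Bdry n => g (z.1, z.2 + h) - g z) p volume

/-- The norm `‖g(t, x' + h) - 2 g(t, x') + g(t, x' - h)‖_{L_p}` of a second difference in `x'`. -/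
def spaceModulus₂ (p : ℝ≥0∞) (g : Bdry n → 𝕜) (h : EuclideanSpace ℝ (Fin n)) : ℝ≥0∞ :=
  eLpNorm (fun z : Bdry n => g (z.1, z.2 + h) - 2 * g z + g (z.1, z.2 - h)) p volume

/-- The norm `‖g(t + τ, x') - g(t, x')‖_{L_p}` of a first difference in `t`. -/
def timeModulus (p : ℝ≥0∞) (g : Bdry n → 𝕜) (τ : ℝ) : ℝ≥0∞ :=
  eLpNorm (fun z : Bdry n => g (z.1 + τ, z.2) - g z) p volume

/-- The measure `dh / |h|^{d-1}` on `ℝ^{d-1}`. -/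
def spaceMeasure (n : ℕ) : Measure (EuclideanSpace ℝ (Fin n)) :=
  volume.withDensity fun h => ENNReal.ofReal ((‖h‖ ^ n)⁻¹)

/-- The measure `dτ / |τ|` on `ℝ`. -/
def timeMeasure : Measure ℝ := volume.withDensity fun τ => ENNReal.ofReal (|τ|⁻¹)

instance : SFinite (spaceMeasure n) := by unfold spaceMeasure; infer_instance

instance : SFinite timeMeasure := by unfold timeMeasure; infer_instance

lemma measurable_eLpNorm_of_uncurry {Y Z : Type*} [MeasurableSpace Y] [MeasurableSpace Z]
    {ν : Measure Z} [SFinite ν] {F : Y → Z → 𝕜} (hF : Measurable (Function.uncurry F))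
    (p : ℝ≥0∞) : Measurable fun w => eLpNorm (F w) p ν := by
  have h : Measurable (Function.uncurry fun w z => ‖F w z‖ₑ) := hF.enorm
  simpa only [eLpNorm_enorm] using measurable_eLpNorm_right h p

lemma measurable_spaceModulus (p : ℝ≥0∞) {g : Bdry n → 𝕜} (hg : Measurable g) :
    Measurable (spaceModulus p g) :=
  measurable_eLpNorm_of_uncurry (F := fun (h : EuclideanSpace ℝ (Fin n)) (z : Bdry n) =>
    g (z.1, z.2 + h) - g z) (by unfold Function.uncurry; fun_prop) p

lemma measurable_spaceModulus₂ (p : ℝ≥0∞) {g : Bdry n → 𝕜} (hg : Measurable g) :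
    Measurable (spaceModulus₂ p g) :=
  measurable_eLpNorm_of_uncurry (F := fun (h : EuclideanSpace ℝ (Fin n)) (z : Bdry n) =>
    g (z.1, z.2 + h) - 2 * g z + g (z.1, z.2 - h)) (by unfold Function.uncurry; fun_prop) p

lemma measurable_timeModulus (p : ℝ≥0∞) {g : Bdry n → 𝕜} (hg : Measurable g) :
    Measurable (timeModulus p g) :=
  measurable_eLpNorm_of_uncurry (F := fun (τ : ℝ) (z : Bdry n) => g (z.1 + τ, z.2) - g z)
    (by unfold Function.uncurry; fun_prop) p

lemma eLpNorm_comp_add_right (p : ℝ≥0∞) {f : Bdry n → 𝕜} (hf : AEStronglyMeasurable f volume)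
    (v : Bdry n) : eLpNorm (fun z => f (z + v)) p volume = eLpNorm f p volume :=
  eLpNorm_comp_measurePreserving hf (measurePreserving_add_right volume v)

lemma spaceModulus_le (p : ℝ≥0∞) (hp : 1 ≤ p) {g : Bdry n → 𝕜} (hg : Measurable g)
    (h : EuclideanSpace ℝ (Fin n)) : spaceModulus p g h ≤ 2 * eLpNorm g p volume := by
  have h1 : Measurable fun z : Bdry n => g (z + (0, h)) := by fun_prop
  have e : (fun z : Bdry n => g (z.1, z.2 + h) - g z) = (fun z => g (z + (0, h))) - g := by
    ext z; simp [Prod.add_def]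
  rw [spaceModulus, e, two_mul]
  refine (eLpNorm_sub_le h1.aestronglyMeasurable hg.aestronglyMeasurable hp).trans ?_
  rw [eLpNorm_comp_add_right p hg.aestronglyMeasurable]

/-- The identity `g(x + 2h) - g(x) = 2 (g(x + h) - g(x)) + (g(x + 2h) - 2 g(x + h) + g(x))`,
in norms. -/
lemma spaceModulus_le_two_smul {p : ℝ≥0∞} (hp : 1 ≤ p) {g : Bdry n → 𝕜} (hg : Measurable g)
    (h : EuclideanSpace ℝ (Fin n)) :
    spaceModulus p g h ≤ 2⁻¹ * spaceModulus₂ p g h + 2⁻¹ * spaceModulus p g ((2 : ℝ) • h) := by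
  set f₁ : Bdry n → 𝕜 := fun z => g (z.1, z.2 + (2 : ℝ) • h) - g z
  set f₂ : Bdry n → 𝕜 := fun z => g (z.1, z.2 + h) - 2 * g z + g (z.1, z.2 - h)
  have hf₁ : Measurable f₁ := by fun_prop
  have hf₂ : Measurable f₂ := by fun_prop
  have e : (fun z : Bdry n => g (z.1, z.2 + h) - g z) =
      (2⁻¹ : ℝ) • (f₁ - fun z => f₂ (z + (0, h))) := by
    ext z
    have h1 : z.2 + (2 : ℝ) • h = z.2 + h + h := by rw [two_smul, add_assoc]
    have h2 : ((z.1, z.2) : Bdry n) = z := rfl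
    simp only [f₁, f₂, Pi.smul_apply, Pi.sub_apply, add_zero, h1,
      add_sub_cancel_right, h2, Prod.add_def]
    rw [RCLike.real_smul_eq_coe_mul]
    push_cast
    ring
  rw [spaceModulus, e, eLpNorm_const_smul, ← mul_add]
  have h3 : ‖(2⁻¹ : ℝ)‖ₑ = 2⁻¹ := by
    rw [Real.enorm_eq_ofReal (by norm_num), ENNReal.ofReal_inv_of_pos two_pos]; simp
  rw [h3]
  gcongr
  rw [add_comm]
  refine (eLpNorm_sub_le hf₁.aestronglyMeasurable
    (hf₂.comp (measurable_add_const _)).aestronglyMeasurable hp).trans ?_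
  exact add_le_add le_rfl (eLpNorm_comp_add_right p hf₂.aestronglyMeasurable (0, h)).le

/-- Marchaud's inequality: the first modulus is controlled by the second one at all dyadic
multiples, because `g` is in `L_p`. -/
lemma spaceModulus_le_tsum {p : ℝ≥0∞} (hp : 1 ≤ p) {g : Bdry n → 𝕜} (hg : Measurable g)
    (hgp : eLpNorm g p volume ≠ ∞) (h : EuclideanSpace ℝ (Fin n)) :
    spaceModulus p g h ≤ ∑' k : ℕ, 2⁻¹ ^ (k + 1) * spaceModulus₂ p g ((2 : ℝ) ^ k • h) := by
  have hN : ∀ N : ℕ, spaceModulus p g h ≤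
      ∑ k ∈ Finset.range N, 2⁻¹ ^ (k + 1) * spaceModulus₂ p g ((2 : ℝ) ^ k • h) +
        2⁻¹ ^ N * spaceModulus p g ((2 : ℝ) ^ N • h) := by
    intro N
    induction N with
    | zero => simp
    | succ N ih =>
      refine ih.trans ?_
      rw [Finset.sum_range_succ, add_assoc]
      gcongr
      refine (mul_le_mul_right (spaceModulus_le_two_smul hp hg _) _).trans ?_
      rw [mul_add, ← mul_assoc, ← mul_assoc, ← pow_succ, smul_smul, ← pow_succ']
  have hlim : Filter.Tendsto (fun N : ℕ =>
      (∑' k : ℕ, 2⁻¹ ^ (k + 1) * spaceModulus₂ p g ((2 : ℝ) ^ k • h)) +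
        2⁻¹ ^ N * (2 * eLpNorm g p volume)) Filter.atTop
      (nhds ((∑' k : ℕ, 2⁻¹ ^ (k + 1) * spaceModulus₂ p g ((2 : ℝ) ^ k • h)) +
        0 * (2 * eLpNorm g p volume))) := by
    refine tendsto_const_nhds.add (ENNReal.Tendsto.mul_const ?_
      (Or.inr (ENNReal.mul_ne_top ENNReal.ofNat_ne_top hgp)))
    exact ENNReal.tendsto_pow_atTop_nhds_zero_of_lt_one (by simp)
  rw [zero_mul, add_zero] at hlim
  refine ge_of_tendsto' hlim fun N => (hN N).trans ?_
  gcongr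
  · exact ENNReal.sum_le_tsum _
  · exact spaceModulus_le p hp hg _

/-- The measure `dh / |h|^{d-1}` is invariant under dilations. -/
lemma map_smul_spaceMeasure {R : ℝ} (hR : 0 < R) :
    (spaceMeasure n).map (fun h => R • h) = spaceMeasure n := by
  refine Measure.ext_of_lintegral _ fun f hf => ?_
  rw [lintegral_map hf (measurable_const_smul R), spaceMeasure,
    lintegral_withDensity_eq_lintegral_mul _ (by fun_prop) hf,
    lintegral_withDensity_eq_lintegral_mul _ (by fun_prop) (g := fun h => f (R • h)) (by fun_prop)]
  have h1 := lintegral_comp_inv_smul (volume : Measure (EuclideanSpace ℝ (Fin n)))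
    (f := fun h => ENNReal.ofReal ((‖h‖ ^ n)⁻¹) * f h) (by fun_prop) (inv_pos.2 hR)
  rw [inv_inv, finrank_euclideanSpace_fin] at h1
  have h2 : ENNReal.ofReal (R ^ n) * ENNReal.ofReal (R⁻¹ ^ n) = 1 := by
    rw [← ENNReal.ofReal_mul (by positivity), ← mul_pow, mul_inv_cancel₀ hR.ne', one_pow,
      ENNReal.ofReal_one]
  simp only [Pi.mul_apply]
  rw [← one_mul (∫⁻ a, _ * f a), ← h2, mul_assoc, ← h1, ← lintegral_const_mul _ (by fun_prop)]
  refine lintegral_congr fun h => ?_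
  rw [← mul_assoc, ← ENNReal.ofReal_mul (by positivity), norm_smul, Real.norm_eq_abs,
    abs_of_pos hR]
  congr 2
  rw [mul_pow]
  field_simp

/-- The seminorm made of first differences in `x'`. -/
def spaceSeminorm₁ (r : ℝ) (p q : ℝ≥0∞) (g : Bdry n → 𝕜) : ℝ≥0∞ :=
  eLpNorm (fun h => spaceModulus p g h / ENNReal.ofReal (‖h‖ ^ r)) q (spaceMeasure n)

/-- Since `r < 1`, first differences may be replaced by second differences. -/
lemma exists_spaceSeminorm₁_le {r : ℝ} (hr : r < 1) :
    ∃ A : ℝ≥0∞, A ≠ ∞ ∧ ∀ (n : ℕ) (p q : ℝ≥0∞), 1 ≤ p → 1 ≤ q → ∀ g : Bdry n → 𝕜, Measurable g →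
      eLpNorm g p volume ≠ ∞ → spaceSeminorm₁ r p q g ≤ A * spaceSeminorm r p q g := by
  set ρ : ℝ := 2⁻¹ * 2 ^ r with hρ
  have hρ0 : 0 < ρ := by positivity
  have hρ1 : ρ < 1 := by
    have : (2 : ℝ) ^ r < 2 ^ (1 : ℝ) := Real.rpow_lt_rpow_of_exponent_lt one_lt_two hr
    rw [Real.rpow_one] at this
    rw [hρ]; linarith
  refine ⟨∑' k : ℕ, 2⁻¹ * ENNReal.ofReal ρ ^ k, ?_, fun n p q hp hq g hg hgp => ?_⟩
  · rw [ENNReal.tsum_mul_left, ENNReal.tsum_geometric]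
    refine ENNReal.mul_ne_top (by simp) (ENNReal.inv_ne_top.2 ?_)
    rw [← ENNReal.ofReal_one, ← ENNReal.ofReal_sub _ hρ0.le]
    simpa using hρ1
  set ψ : EuclideanSpace ℝ (Fin n) → ℝ≥0∞ := fun h =>
    spaceModulus₂ p g h / ENNReal.ofReal (‖h‖ ^ r) with hψ
  have hψm : Measurable ψ := by
    have := measurable_spaceModulus₂ p hg
    fun_prop
  have hle : ∀ h, spaceModulus p g h / ENNReal.ofReal (‖h‖ ^ r) ≤
      ∫⁻ k : ℕ, (2⁻¹ * ENNReal.ofReal ρ ^ k) * ψ ((2 : ℝ) ^ k • h) ∂Measure.count := by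
    intro h
    rw [lintegral_count]
    refine (ENNReal.div_le_div_right (spaceModulus_le_tsum hp hg hgp h) _).trans ?_
    rw [div_eq_mul_inv, ← ENNReal.tsum_mul_right]
    refine ENNReal.tsum_le_tsum fun k => ?_
    have e1 : ENNReal.ofReal (‖(2 : ℝ) ^ k • h‖ ^ r) =
        ENNReal.ofReal (2 ^ r) ^ k * ENNReal.ofReal (‖h‖ ^ r) := by
      rw [norm_smul, norm_pow, Real.norm_eq_abs, abs_two,
        Real.mul_rpow (by positivity) (norm_nonneg _), ENNReal.ofReal_mul (by positivity),
        ← ENNReal.ofReal_pow (by positivity), ← Real.rpow_natCast, ← Real.rpow_natCast,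
        ← Real.rpow_mul two_pos.le, ← Real.rpow_mul two_pos.le, mul_comm (k : ℝ)]
    have e2 : ENNReal.ofReal ρ ^ k = 2⁻¹ ^ k * ENNReal.ofReal (2 ^ r) ^ k := by
      rw [hρ, ENNReal.ofReal_mul (by norm_num), mul_pow, ENNReal.ofReal_inv_of_pos two_pos]
      simp
    have hb0 : ENNReal.ofReal (2 ^ r) ^ k ≠ 0 := pow_ne_zero _ (by positivity)
    have hbt : ENNReal.ofReal (2 ^ r) ^ k ≠ ∞ := ENNReal.pow_ne_top ENNReal.ofReal_ne_top
    simp only [hψ]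
    rw [e1, e2, div_eq_mul_inv, ENNReal.mul_inv (Or.inl hb0) (Or.inl hbt)]
    calc _ = 2⁻¹ ^ (k + 1) * spaceModulus₂ p g ((2 : ℝ) ^ k • h) *
          (ENNReal.ofReal (2 ^ r) ^ k * (ENNReal.ofReal (2 ^ r) ^ k)⁻¹) *
          (ENNReal.ofReal (‖h‖ ^ r))⁻¹ := by rw [ENNReal.mul_inv_cancel hb0 hbt, mul_one]
      _ ≤ _ := le_of_eq (by ring)
  have hF : Measurable (Function.uncurry fun (k : ℕ) (h : EuclideanSpace ℝ (Fin n)) =>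
      (2⁻¹ * ENNReal.ofReal ρ ^ k) * ψ ((2 : ℝ) ^ k • h)) :=
    measurable_from_prod_countable_right fun k => by
      simp only [Function.uncurry]
      fun_prop
  calc spaceSeminorm₁ r p q g ≤ eLpNorm (fun h => ∫⁻ k : ℕ, (2⁻¹ * ENNReal.ofReal ρ ^ k) *
        ψ ((2 : ℝ) ^ k • h) ∂Measure.count) q (spaceMeasure n) :=
        eLpNorm_mono_enorm fun h => by simpa using hle h
    _ ≤ ∫⁻ k : ℕ, eLpNorm (fun h => (2⁻¹ * ENNReal.ofReal ρ ^ k) * ψ ((2 : ℝ) ^ k • h)) q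
        (spaceMeasure n) ∂Measure.count := eLpNorm_lintegral_le hq hF
    _ ≤ ∑' k : ℕ, 2⁻¹ * ENNReal.ofReal ρ ^ k * spaceSeminorm r p q g := by
        rw [lintegral_count]
        refine ENNReal.tsum_le_tsum fun k => ?_
        have hc : 2⁻¹ * ENNReal.ofReal ρ ^ k ≠ ∞ :=
          ENNReal.mul_ne_top (by simp) (ENNReal.pow_ne_top ENNReal.ofReal_ne_top)
        have h1 := eLpNorm_le_const_mul (μ := spaceMeasure n)
          (f := fun h => (2⁻¹ * ENNReal.ofReal ρ ^ k) * ψ ((2 : ℝ) ^ k • h))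
          (g := fun h => ψ ((2 : ℝ) ^ k • h)) hc (ae_of_all _ fun h => le_rfl) q
        refine h1.trans (le_of_eq ?_)
        congr 1
        have h2 : (0 : ℝ) < 2 ^ k := by positivity
        have h3 := eLpNorm_map_measure (p := q) (μ := spaceMeasure n) (g := ψ)
          (f := fun h => (2 : ℝ) ^ k • h) hψm.aestronglyMeasurable
          (measurable_const_smul _).aemeasurable
        rw [map_smul_spaceMeasure h2] at h3
        exact h3.symm
    _ = _ := ENNReal.tsum_mul_right

/-! ### The upper bound -/

/-- The integral of the majorant against the differences of `g`, which dominates the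
derivatives of the extension. -/
def differenceIntegral (α : ℝ) (g : Bdry n → 𝕜) (y : ℝ) (z : Bdry n) : ℝ≥0∞ :=
  ∫⁻ w : Bdry n, ‖majorant α (w.1, w.2, y) • (g (z - w) - g z)‖ₑ

/-- The derivatives of the kernel have integral zero, so `g` may be replaced by its differences
in the derivatives of the extension. -/
lemma exists_extensionDeriv_le (n : ℕ) {α : ℝ} (hα : α < 1) :
    ∃ C, 0 < C ∧ ∀ p : ℝ≥0∞, 1 ≤ p → ∀ g : Bdry n → 𝕜, MemLp g p volume →
      ∀ (z : Bdry n) (y : ℝ), 0 < y → ∀ v : Half n,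
        ‖extensionDeriv α g (z.1, z.2, y) v‖ₑ ≤
          ENNReal.ofReal (C * (|v.1| / y ^ 2 + (‖v.2.1‖ + |v.2.2|) / y)) *
            differenceIntegral α g y z := by
  obtain ⟨C, hC, h⟩ := exists_abs_fderiv_fullKernel_le n hα
  refine ⟨C, hC, fun p hp g hg z y hy v => ?_⟩
  set P : Half n := (z.1, z.2, y) with hP
  have hy' : 0 < P.2.2 := hy
  set k : Bdry n → ℝ := fun w => fderiv ℝ (fullKernel α) (translate P w) v with hk
  have hint1 : Integrable fun w => k w • g w :=
    (integrable_fderiv_smulRight hα hp hg hy').apply_continuousLinearMap v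
  have hint2 : Integrable fun w => k w • g z :=
    (integrable_fderiv_smulRight hα le_top (memLp_top_const (g z)) hy').apply_continuousLinearMap v
  have e1 : extensionDeriv α g P v = ∫ w, k w • (g w - g z) := by
    simp only [smul_sub]
    rw [extensionDeriv_apply hα hp hg hy', integral_sub hint1 hint2, integral_smul_const,
      integral_fderiv_fullKernel hα hy', zero_smul, sub_zero]
  have e2 : extensionDeriv α g P v = ∫ w : Bdry n,
      fderiv ℝ (fullKernel α) (w.1, w.2, y) v • (g (z - w) - g z) := by
    rw [e1, ← integral_sub_left_eq_self _ volume z]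
    refine integral_congr_ae (ae_of_all _ fun w => ?_)
    simp [hk, translate, hP]
  rw [e2, differenceIntegral, ← lintegral_const_mul' _ _ ENNReal.ofReal_ne_top]
  refine (enorm_integral_le_lintegral_enorm _).trans (lintegral_mono fun w => ?_)
  rw [enorm_smul, enorm_smul, ← mul_assoc]
  gcongr
  have h0 : 0 ≤ majorant α (w.1, w.2, y) := majorant_nonneg (P := (w.1, w.2, y)) hy
  rw [Real.enorm_eq_ofReal_abs, Real.enorm_eq_ofReal h0, ← ENNReal.ofReal_mul (by positivity)]
  exact ENNReal.ofReal_le_ofReal (h (w.1, w.2, y) hy v)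

lemma eLpNorm_translate_sub_le {p : ℝ≥0∞} (hp : 1 ≤ p) {g : Bdry n → 𝕜} (hg : Measurable g)
    (w : Bdry n) : eLpNorm (fun z => g (z - w) - g z) p volume ≤
      spaceModulus p g (-w.2) + timeModulus p g (-w.1) := by
  set f : Bdry n → 𝕜 := fun z => g (z.1, z.2 + -w.2) - g z with hf
  have hfm : Measurable f := by fun_prop
  have e : (fun z => g (z - w) - g z) = (fun z => f (z + (-w.1, 0))) +
      fun z => g (z.1 + -w.1, z.2) - g z := by
    ext z
    simp [hf, Prod.add_def, sub_eq_add_neg]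
  have h2 : Measurable fun z : Bdry n => g (z.1 + -w.1, z.2) - g z := by fun_prop
  have h1 := eLpNorm_add_le
    (hfm.comp (measurable_add_const ((-w.1, 0) : Bdry n))).aestronglyMeasurable
    (μ := volume) h2.aestronglyMeasurable hp
  rw [e]
  exact h1.trans
    (add_le_add (eLpNorm_comp_add_right p hfm.aestronglyMeasurable (-w.1, 0)).le le_rfl)

/-- A parabolic difference is split into one in `x'` and one in `t`, by Minkowski's inequality. -/
lemma eLpNorm_differenceIntegral_le {α : ℝ} {p : ℝ≥0∞} (hp : 1 ≤ p) {g : Bdry n → 𝕜}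
    (hg : Measurable g) {y : ℝ} (hy : 0 < y) :
    eLpNorm (differenceIntegral α g y) p volume ≤
      (∫⁻ w : Bdry n, ENNReal.ofReal (majorant α (w.1, w.2, y)) * spaceModulus p g w.2) +
        ∫⁻ w : Bdry n, ENNReal.ofReal (majorant α (w.1, w.2, y)) * timeModulus p g w.1 := by
  have hm := (continuous_majorant (n := n) α hy).measurable
  have hF : Measurable (Function.uncurry fun (w z : Bdry n) =>
      ‖majorant α (w.1, w.2, y) • (g (z - w) - g z)‖ₑ) := by
    unfold Function.uncurry
    exact ((hm.comp measurable_fst).smul ((hg.comp (measurable_snd.sub measurable_fst)).sub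
      (hg.comp measurable_snd))).enorm
  have hs := measurable_spaceModulus p hg
  have ht := measurable_timeModulus p hg
  calc eLpNorm (differenceIntegral α g y) p volume
      ≤ ∫⁻ w : Bdry n, eLpNorm (fun z => ‖majorant α (w.1, w.2, y) • (g (z - w) - g z)‖ₑ) p
          volume := eLpNorm_lintegral_le hp hF
    _ ≤ ∫⁻ w : Bdry n, ENNReal.ofReal (majorant α (w.1, w.2, y)) *
          (spaceModulus p g (-w.2) + timeModulus p g (-w.1)) := by
        refine lintegral_mono fun w => ?_
        have h0 : 0 ≤ majorant α (w.1, w.2, y) := majorant_nonneg (P := (w.1, w.2, y)) hy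
        have h1 := eLpNorm_const_smul (majorant α (w.1, w.2, y)) (fun z => g (z - w) - g z) p
          (volume : Measure (Bdry n))
        rw [Real.enorm_eq_ofReal h0] at h1
        rw [eLpNorm_enorm]
        exact h1.le.trans (mul_le_mul_right (eLpNorm_translate_sub_le hp hg w) _)
    _ = ∫⁻ w : Bdry n, ENNReal.ofReal (majorant α (w.1, w.2, y)) *
          (spaceModulus p g w.2 + timeModulus p g w.1) := by
        -- The majorant is an even function of `w`.
        rw [← lintegral_neg_eq_self]
        refine lintegral_congr fun w => ?_
        simp [majorant, sqDist]
    _ = _ := by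
        simp only [mul_add]
        exact lintegral_add_left (hm.ennreal_ofReal.mul (hs.comp measurable_snd)) _

/-- A function of `s` that behaves like `s^a` at zero and like `s^{-2δ}` at infinity, with
`s = ρ / y`, is dominated by the logarithmic kernel. -/
lemma rpow_mul_le_logKernel {a δ ε y ρ : ℝ} (hy : 0 < y) (hρ : 0 < ρ) (ha : 0 < a) (hδ : 0 < δ)
    (h1 : ε ≤ a) (h2 : ε ≤ 2 * δ) :
    y ^ (-a) * (1 + (ρ / y) ^ 2) ^ (-(a / 2 + δ)) ≤ ρ ^ (-a) * logKernel ε y ρ := by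
  have hs : 0 < ρ / y := by positivity
  have e : y ^ (-a) = ρ ^ (-a) * (ρ / y) ^ a := by
    rw [Real.div_rpow hρ.le hy.le, Real.rpow_neg hy.le, Real.rpow_neg hρ.le]
    have := (Real.rpow_pos_of_pos hρ a).ne'
    field_simp
  have e2 : logKernel ε y ρ = Real.exp (-ε * |Real.log (ρ / y)|) := by
    rw [logKernel, Real.log_div hρ.ne' hy.ne']
  rw [e, e2, mul_assoc]
  gcongr
  generalize ρ / y = s at hs
  rcases le_total 1 s with h | h
  · have hl := Real.log_nonneg h
    calc s ^ a * (1 + s ^ 2) ^ (-(a / 2 + δ)) ≤ s ^ a * (s ^ 2) ^ (-(a / 2 + δ)) := by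
          refine mul_le_mul_of_nonneg_left (Real.rpow_le_rpow_of_nonpos (by positivity)
            (by linarith) (by linarith)) (by positivity)
      _ = Real.exp (-(2 * δ) * Real.log s) := by
          rw [← Real.rpow_natCast, ← Real.rpow_mul hs.le, ← Real.rpow_add hs,
            Real.rpow_def_of_pos hs]
          congr 1; push_cast; ring
      _ ≤ _ := by
          rw [abs_of_nonneg hl]
          gcongr
  · have hl := Real.log_nonpos hs.le h
    calc s ^ a * (1 + s ^ 2) ^ (-(a / 2 + δ)) ≤ s ^ a * 1 := by
          gcongr
          exact Real.rpow_le_one_of_one_le_of_nonpos (by nlinarith) (by linarith)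
      _ = Real.exp (Real.log s * a) := by rw [mul_one, Real.rpow_def_of_pos hs]
      _ ≤ _ := by
          rw [abs_of_nonpos hl]
          exact Real.exp_le_exp.2 (by nlinarith)

lemma ofReal_mul_ofReal_mul_eq {ρ a r K : ℝ} {φ : ℝ≥0∞} (hρ : 0 < ρ) (hK : 0 ≤ K) :
    ENNReal.ofReal (ρ ^ (-(a + r)) * K) * φ =
      ENNReal.ofReal ((ρ ^ a)⁻¹) * (ENNReal.ofReal K * (φ / ENNReal.ofReal (ρ ^ r))) := by
  have h : ρ ^ (-(a + r)) * K = (ρ ^ a)⁻¹ * (K * (ρ ^ r)⁻¹) := by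
    rw [neg_add, Real.rpow_add hρ, Real.rpow_neg hρ.le, Real.rpow_neg hρ.le]; ring
  rw [h, ENNReal.ofReal_mul (by positivity), ENNReal.ofReal_mul hK,
    ENNReal.ofReal_inv_of_pos (Real.rpow_pos_of_pos hρ r), div_eq_mul_inv]
  ring

/-- The contribution of the differences in `x'` at height `y`. -/
lemma exists_lintegral_space_le (n : ℕ) (hn : 1 ≤ n) {α r : ℝ} (hr0 : 0 < r) (hr : r < 1 - α) :
    ∃ A : ℝ≥0∞, A ≠ ∞ ∧ ∃ ε > 0, ∀ φ : EuclideanSpace ℝ (Fin n) → ℝ≥0∞, Measurable φ →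
      ∀ y, 0 < y → ENNReal.ofReal (y ^ (-r)) *
          ∫⁻ w : Bdry n, ENNReal.ofReal (majorant α (w.1, w.2, y)) * φ w.2 ≤
        A * ∫⁻ h, ENNReal.ofReal (logKernel ε y ‖h‖) * (φ h / ENNReal.ofReal (‖h‖ ^ r))
          ∂(spaceMeasure n) := by
  set δ := (1 - α - r) / 4 with hδ
  have hδ0 : 0 < δ := by rw [hδ]; linarith
  have hn0 : (1 : ℝ) ≤ n := by exact_mod_cast hn
  set ε := min r (2 * δ) with hε
  have : Nontrivial (EuclideanSpace ℝ (Fin n)) := by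
    have : Nonempty (Fin n) := ⟨⟨0, hn⟩⟩
    infer_instance
  refine ⟨∫⁻ τ : ℝ, ENNReal.ofReal ((1 + |τ|) ^ (-(1 + δ))),
    (lintegral_one_add_abs_lt_top (by linarith)).ne, ε, by positivity, fun φ hφ y hy => ?_⟩
  have hm : Measurable fun h : EuclideanSpace ℝ (Fin n) => logKernel ε y ‖h‖ :=
    (measurable_logKernel ε).comp (measurable_const.prodMk measurable_norm)
  have hle : ∀ w : Bdry n, ENNReal.ofReal (majorant α (w.1, w.2, y)) * φ w.2 ≤
      ENNReal.ofReal ((1 + |w.1| / y ^ 2) ^ (-(1 + δ))) * (ENNReal.ofReal (y ^ (-((n : ℝ) + 2)) *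
        (1 + (‖w.2‖ / y) ^ 2) ^ (-((n + r) / 2 + δ))) * φ w.2) := by
    intro w
    rw [← mul_assoc, ← ENNReal.ofReal_mul (by positivity)]
    gcongr
    -- The decay in `τ` is just enough for integrability; the rest is left to `z'`.
    refine (majorant_le_mul (P := (w.1, w.2, y)) hy (β₁ := 1 + δ) (β₂ := (n + r) / 2 + δ)
      (by positivity) (by positivity) (by rw [hδ, kernelExponent]; ring)).trans (le_of_eq ?_)
    ring
  calc _ ≤ ENNReal.ofReal (y ^ (-r)) * ∫⁻ w : Bdry n,
        ENNReal.ofReal ((1 + |w.1| / y ^ 2) ^ (-(1 + δ))) * (ENNReal.ofReal (y ^ (-((n : ℝ) + 2)) *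
          (1 + (‖w.2‖ / y) ^ 2) ^ (-((n + r) / 2 + δ))) * φ w.2) := by
        exact mul_le_mul_right (lintegral_mono hle) _
    _ = (∫⁻ τ : ℝ, ENNReal.ofReal ((1 + |τ|) ^ (-(1 + δ)))) *
        ∫⁻ h, ENNReal.ofReal (y ^ (-((n : ℝ) + r)) *
          (1 + (‖h‖ / y) ^ 2) ^ (-((n + r) / 2 + δ))) * φ h := by
        have hcomm : ∀ a b c d : ℝ≥0∞, a * (b * c * d) = c * (b * a * d) := by intros; ring
        rw [Measure.volume_eq_prod,
          lintegral_prod_mul (f := fun τ : ℝ => ENNReal.ofReal ((1 + |τ| / y ^ 2) ^ (-(1 + δ))))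
            (g := fun h => ENNReal.ofReal (y ^ (-((n : ℝ) + 2)) *
              (1 + (‖h‖ / y) ^ 2) ^ (-((n + r) / 2 + δ))) * φ h) (by fun_prop) (by fun_prop),
          lintegral_one_add_abs_div _ hy, hcomm,
          ← ENNReal.ofReal_mul (by positivity), ← lintegral_const_mul _ (by fun_prop)]
        congr 1
        refine lintegral_congr fun h => ?_
        rw [← mul_assoc, ← ENNReal.ofReal_mul (by positivity)]
        congr 2
        have e : y ^ (-((n : ℝ) + r)) = y ^ 2 * y ^ (-r) * y ^ (-((n : ℝ) + 2)) := by
          rw [← Real.rpow_natCast, ← Real.rpow_add hy, ← Real.rpow_add hy]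
          congr 1; push_cast; ring
        rw [e]; ring
    _ ≤ _ := by
        refine mul_le_mul_right ?_ _
        rw [spaceMeasure, lintegral_withDensity_eq_lintegral_mul _ (by fun_prop) (by fun_prop)]
        refine lintegral_mono_ae ?_
        filter_upwards [Measure.ae_ne volume (0 : EuclideanSpace ℝ (Fin n))] with h hh
        have hh0 : 0 < ‖h‖ := norm_pos_iff.2 hh
        have h1 := ofReal_mul_ofReal_mul_eq (φ := φ h) (a := n) (r := r) hh0
          (K := logKernel ε y ‖h‖) (Real.exp_pos _).le
        rw [Real.rpow_natCast] at h1
        rw [Pi.mul_apply, ← h1]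
        exact mul_le_mul_left (ENNReal.ofReal_le_ofReal (rpow_mul_le_logKernel hy hh0
          (by linarith) hδ0 ((min_le_left _ _).trans (by linarith)) (min_le_right _ _))) _

/-- The contribution of the differences in `t` at height `y`. -/
lemma exists_lintegral_time_le (n : ℕ) {α r : ℝ} (hr0 : 0 < r) (hr : r < 1 - α) :
    ∃ A : ℝ≥0∞, A ≠ ∞ ∧ ∃ ε > 0, ∀ φ : ℝ → ℝ≥0∞, Measurable φ →
      ∀ y, 0 < y → ENNReal.ofReal (y ^ (-r)) *
          ∫⁻ w : Bdry n, ENNReal.ofReal (majorant α (w.1, w.2, y)) * φ w.1 ≤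
        A * ∫⁻ τ, ENNReal.ofReal (logKernel ε y √|τ|) * (φ τ / ENNReal.ofReal (|τ| ^ (r / 2)))
          ∂timeMeasure := by
  set δ := (1 - α - r) / 4 with hδ
  have hδ0 : 0 < δ := by rw [hδ]; linarith
  have hn0 : (0 : ℝ) ≤ n := n.cast_nonneg
  set ε := min r (2 * δ) with hε
  refine ⟨∫⁻ z : EuclideanSpace ℝ (Fin n), ENNReal.ofReal ((1 + ‖z‖ ^ 2) ^ (-((n : ℝ) / 2 + δ))),
    (lintegral_one_add_sq_norm_lt_top (by linarith)).ne, ε, by positivity, fun φ hφ y hy => ?_⟩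
  have hm : Measurable fun τ : ℝ => logKernel ε y √|τ| :=
    (measurable_logKernel ε).comp (measurable_const.prodMk (by fun_prop))
  have hle : ∀ w : Bdry n, ENNReal.ofReal (majorant α (w.1, w.2, y)) * φ w.1 ≤
      (ENNReal.ofReal (y ^ (-((n : ℝ) + 2)) * (1 + |w.1| / y ^ 2) ^ (-((2 + r) / 2 + δ))) * φ w.1) *
        ENNReal.ofReal ((1 + (‖w.2‖ / y) ^ 2) ^ (-((n : ℝ) / 2 + δ))) := by
    intro w
    rw [mul_right_comm, ← ENNReal.ofReal_mul (by positivity)]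
    gcongr
    -- The decay in `z'` is just enough for integrability; the rest is left to `τ`.
    refine (majorant_le_mul (P := (w.1, w.2, y)) hy (β₁ := (2 + r) / 2 + δ) (β₂ := n / 2 + δ)
      (by positivity) (by positivity) (by rw [hδ, kernelExponent]; ring)).trans (le_of_eq ?_)
    ring
  calc _ ≤ ENNReal.ofReal (y ^ (-r)) * ∫⁻ w : Bdry n,
        (ENNReal.ofReal (y ^ (-((n : ℝ) + 2)) * (1 + |w.1| / y ^ 2) ^ (-((2 + r) / 2 + δ))) *
          φ w.1) * ENNReal.ofReal ((1 + (‖w.2‖ / y) ^ 2) ^ (-((n : ℝ) / 2 + δ))) := by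
        exact mul_le_mul_right (lintegral_mono hle) _
    _ = (∫⁻ z : EuclideanSpace ℝ (Fin n), ENNReal.ofReal ((1 + ‖z‖ ^ 2) ^ (-((n : ℝ) / 2 + δ)))) *
        ∫⁻ τ, ENNReal.ofReal (y ^ (-(2 + r)) *
          (1 + |τ| / y ^ 2) ^ (-((2 + r) / 2 + δ))) * φ τ := by
        have hcomm : ∀ a b c d : ℝ≥0∞, a * (d * (b * c)) = c * (b * a * d) := by intros; ring
        rw [Measure.volume_eq_prod,
          lintegral_prod_mul (f := fun τ : ℝ => ENNReal.ofReal (y ^ (-((n : ℝ) + 2)) *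
              (1 + |τ| / y ^ 2) ^ (-((2 + r) / 2 + δ))) * φ τ)
            (g := fun z : EuclideanSpace ℝ (Fin n) =>
              ENNReal.ofReal ((1 + (‖z‖ / y) ^ 2) ^ (-((n : ℝ) / 2 + δ))))
            (by fun_prop) (by fun_prop),
          lintegral_one_add_sq_norm_div _ hy, hcomm,
          ← ENNReal.ofReal_mul (by positivity), ← lintegral_const_mul _ (by fun_prop)]
        congr 1
        refine lintegral_congr fun τ => ?_
        rw [← mul_assoc, ← ENNReal.ofReal_mul (by positivity)]
        congr 2
        have e : y ^ (-(2 + r)) = y ^ n * y ^ (-r) * y ^ (-((n : ℝ) + 2)) := by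
          rw [← Real.rpow_natCast, ← Real.rpow_add hy, ← Real.rpow_add hy]
          congr 1; ring
        rw [e]; ring
    _ ≤ _ := by
        refine mul_le_mul_right ?_ _
        rw [timeMeasure, lintegral_withDensity_eq_lintegral_mul _ (by fun_prop) (by fun_prop)]
        refine lintegral_mono_ae ?_
        filter_upwards [Measure.ae_ne volume (0 : ℝ)] with τ hτ
        have hτ0 : 0 < |τ| := abs_pos.2 hτ
        have hs0 : 0 < √|τ| := Real.sqrt_pos.2 hτ0
        have h1 := ofReal_mul_ofReal_mul_eq (φ := φ τ) (a := 2) (r := r) hs0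
          (K := logKernel ε y √|τ|) (Real.exp_pos _).le
        have e1 : √|τ| ^ (2 : ℝ) = |τ| := by
          rw [Real.rpow_ofNat, Real.sq_sqrt hτ0.le]
        have e2 : √|τ| ^ r = |τ| ^ (r / 2) := by
          rw [Real.sqrt_eq_rpow, ← Real.rpow_mul hτ0.le]; congr 1; ring
        have e3 : |τ| / y ^ 2 = (√|τ| / y) ^ 2 := by
          rw [div_pow, Real.sq_sqrt hτ0.le]
        rw [e1, e2] at h1
        rw [Pi.mul_apply, ← h1, e3]
        exact mul_le_mul_left (ENNReal.ofReal_le_ofReal (rpow_mul_le_logKernel hy hs0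
          (by linarith) hδ0 ((min_le_left _ _).trans (by linarith)) (min_le_right _ _))) _

lemma map_norm_spaceMeasure (hn : 1 ≤ n) :
    ∃ c : ℝ≥0∞, c ≠ ∞ ∧ (spaceMeasure n).map norm = c • normalMeasure := by
  have : Nontrivial (EuclideanSpace ℝ (Fin n)) := by
    have : Nonempty (Fin n) := ⟨⟨0, hn⟩⟩
    infer_instance
  exact ⟨_, measure_ne_top _ _, map_norm_withDensity volume finrank_euclideanSpace_fin⟩

lemma map_sqrt_abs_timeMeasure :
    ∃ c : ℝ≥0∞, c ≠ ∞ ∧ timeMeasure.map (fun τ => √|τ|) = c • normalMeasure :=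
  ⟨_, ENNReal.mul_ne_top (measure_ne_top _ _) (by simp), map_sqrt_abs_withDensity⟩

/-- The differences of `g`, averaged against the majorant at height `y` and weighted by `y^{-r}`,
are controlled by the Besov seminorm. -/
lemma exists_eLpNorm_differenceIntegral_le (n : ℕ) (hn : 1 ≤ n) {α r : ℝ}
    (hr0 : 0 < r) (hr1 : r < 1) (hr : r < 1 - α) :
    ∃ A : ℝ≥0∞, A ≠ ∞ ∧ ∀ p q : ℝ≥0∞, 1 ≤ p → 1 ≤ q → ∀ g : Bdry n → 𝕜, Measurable g →
      eLpNorm g p volume ≠ ∞ →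
      eLpNorm (fun y : ℝ => ENNReal.ofReal (y ^ (-r)) *
        eLpNorm (differenceIntegral α g y) p volume) q normalMeasure ≤
        A * besovSeminorm r p q g := by
  obtain ⟨A₁, hA₁, ε₁, hε₁, h₁⟩ := exists_lintegral_space_le n hn hr0 hr
  obtain ⟨A₂, hA₂, ε₂, hε₂, h₂⟩ := exists_lintegral_time_le n hr0 hr
  obtain ⟨c₁, hc₁, hm₁⟩ := map_norm_spaceMeasure hn
  obtain ⟨c₂, hc₂, hm₂⟩ := map_sqrt_abs_timeMeasure
  have hsm : Measurable fun τ : ℝ => √|τ| := by fun_prop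
  obtain ⟨B₁, hB₁, hS₁⟩ := exists_eLpNorm_logKernel_le measurable_norm hc₁ hm₁ hε₁
  obtain ⟨B₂, hB₂, hS₂⟩ := exists_eLpNorm_logKernel_le hsm hc₂ hm₂ hε₂
  obtain ⟨M, hM, hMar⟩ := exists_spaceSeminorm₁_le (𝕜 := 𝕜) hr1
  refine ⟨A₁ * (B₁ * M) + A₂ * B₂, by finiteness, fun p q hp hq g hg hgp => ?_⟩
  set φ₁ : EuclideanSpace ℝ (Fin n) → ℝ≥0∞ := fun h =>
    spaceModulus p g h / ENNReal.ofReal (‖h‖ ^ r) with hφ₁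
  set φ₂ : ℝ → ℝ≥0∞ := fun τ => timeModulus p g τ / ENNReal.ofReal (|τ| ^ (r / 2)) with hφ₂
  have hs := measurable_spaceModulus p hg
  have ht := measurable_timeModulus p hg
  have hφ₁m : Measurable φ₁ := by fun_prop
  have hφ₂m : Measurable φ₂ := by fun_prop
  set E₁ : ℝ → ℝ≥0∞ := fun y =>
    ∫⁻ h, ENNReal.ofReal (logKernel ε₁ y ‖h‖) * φ₁ h ∂(spaceMeasure n) with hE₁
  set E₂ : ℝ → ℝ≥0∞ := fun y =>
    ∫⁻ τ, ENNReal.ofReal (logKernel ε₂ y √|τ|) * φ₂ τ ∂timeMeasure with hE₂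
  have hE₁m : Measurable E₁ := by
    refine Measurable.lintegral_prod_right (f := fun y h =>
      ENNReal.ofReal (logKernel ε₁ y ‖h‖) * φ₁ h) ?_
    exact ((measurable_logKernel ε₁).comp
      (measurable_fst.prodMk (measurable_norm.comp measurable_snd))).ennreal_ofReal.mul
      (hφ₁m.comp measurable_snd)
  have hE₂m : Measurable E₂ := by
    refine Measurable.lintegral_prod_right (f := fun y τ =>
      ENNReal.ofReal (logKernel ε₂ y √|τ|) * φ₂ τ) ?_
    exact ((measurable_logKernel ε₂).comp
      (measurable_fst.prodMk (hsm.comp measurable_snd))).ennreal_ofReal.mul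
      (hφ₂m.comp measurable_snd)
  have hle : ∀ᵐ y ∂normalMeasure, ‖ENNReal.ofReal (y ^ (-r)) *
      eLpNorm (differenceIntegral α g y) p volume‖ₑ ≤
        ‖((fun y => A₁ * E₁ y) + fun y => A₂ * E₂ y) y‖ₑ := by
    filter_upwards [ae_normalMeasure_pos] with y hy
    simp only [enorm_eq_self, Pi.add_apply]
    refine (mul_le_mul_right (eLpNorm_differenceIntegral_le hp hg hy) _).trans ?_
    rw [mul_add]
    exact add_le_add (h₁ _ hs y hy) (h₂ _ ht y hy)
  refine (eLpNorm_mono_enorm_ae hle).trans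
    ((eLpNorm_add_le (by fun_prop) (by fun_prop) hq).trans ?_)
  have k₁ : eLpNorm (fun y => A₁ * E₁ y) q normalMeasure ≤
      A₁ * (B₁ * (M * spaceSeminorm r p q g)) :=
    (eLpNorm_le_const_mul hA₁ (ae_of_all _ fun y => le_rfl) q).trans
      (mul_le_mul_right ((hS₁ q hq φ₁ hφ₁m).trans
        (mul_le_mul_right (hMar n p q hp hq g hg hgp) _)) _)
  have k₂ : eLpNorm (fun y => A₂ * E₂ y) q normalMeasure ≤ A₂ * (B₂ * timeSeminorm r p q g) :=
    (eLpNorm_le_const_mul hA₂ (ae_of_all _ fun y => le_rfl) q).trans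
      (mul_le_mul_right (hS₂ q hq φ₂ hφ₂m) _)
  calc _ ≤ A₁ * (B₁ * (M * spaceSeminorm r p q g)) + A₂ * (B₂ * timeSeminorm r p q g) :=
        add_le_add k₁ k₂
    _ = (A₁ * (B₁ * M)) * spaceSeminorm r p q g + (A₂ * B₂) * timeSeminorm r p q g := by ring
    _ ≤ (A₁ * (B₁ * M) + A₂ * B₂) * spaceSeminorm r p q g +
        (A₁ * (B₁ * M) + A₂ * B₂) * timeSeminorm r p q g := by
        gcongr
        · exact le_self_add
        · exact le_add_self
    _ = _ := by rw [besovSeminorm, mul_add]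

section Derivatives

variable {α : ℝ} {p : ℝ≥0∞} {g : Bdry n → 𝕜}

lemma hasDerivAt_extension_normal (hα : α < 1) (hp : 1 ≤ p) (hg : MemLp g p volume) (t : ℝ)
    (x : EuclideanSpace ℝ (Fin n)) {y : ℝ} (hy : 0 < y) :
    HasDerivAt (fun s => extension α g t x s) (extensionDeriv α g (t, x, y) (0, 0, 1)) y := by
  have h1 : HasDerivAt (fun s : ℝ => ((t, x, s) : Half n)) (0, 0, 1) y :=
    (hasDerivAt_const y t).prodMk ((hasDerivAt_const y x).prodMk (hasDerivAt_id y))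
  have h2 := (hasFDerivAt_halfExtension hα hp hg (P := (t, x, y)) hy).comp_hasDerivAt y h1
  refine h2.congr_of_eventuallyEq ?_
  filter_upwards [Ioi_mem_nhds hy] with s hs using extension_eq_halfExtension g t x hs

lemma hasDerivAt_extension_time (hα : α < 1) (hp : 1 ≤ p) (hg : MemLp g p volume) (t : ℝ)
    (x : EuclideanSpace ℝ (Fin n)) {y : ℝ} (hy : 0 < y) :
    HasDerivAt (fun s => extension α g s x y) (extensionDeriv α g (t, x, y) (1, 0, 0)) t := by
  have h1 : HasDerivAt (fun s : ℝ => ((s, x, y) : Half n)) (1, 0, 0) t :=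
    (hasDerivAt_id t).prodMk ((hasDerivAt_const t x).prodMk (hasDerivAt_const t y))
  have h2 := (hasFDerivAt_halfExtension hα hp hg (P := (t, x, y)) hy).comp_hasDerivAt t h1
  exact h2.congr_of_eventuallyEq
    (Filter.Eventually.of_forall fun s => extension_eq_halfExtension g s x hy)

lemma hasFDerivAt_extension_tangential (hα : α < 1) (hp : 1 ≤ p) (hg : MemLp g p volume) (t : ℝ)
    (x : EuclideanSpace ℝ (Fin n)) {y : ℝ} (hy : 0 < y) :
    HasFDerivAt (fun v => extension α g t v y)
      ((extensionDeriv α g (t, x, y)).comp ((ContinuousLinearMap.inr ℝ ℝ _).comp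
        (ContinuousLinearMap.inl ℝ (EuclideanSpace ℝ (Fin n)) ℝ))) x := by
  have h1 : HasFDerivAt (fun v : EuclideanSpace ℝ (Fin n) => ((t, v, y) : Half n))
      ((ContinuousLinearMap.inr ℝ ℝ _).comp
        (ContinuousLinearMap.inl ℝ (EuclideanSpace ℝ (Fin n)) ℝ)) x :=
    (hasFDerivAt_prodMk_right t (x, y)).comp x (hasFDerivAt_prodMk_left x y)
  have h2 := (hasFDerivAt_halfExtension hα hp hg (P := (t, x, y)) hy).comp x h1
  exact h2.congr_of_eventuallyEq
    (Filter.Eventually.of_forall fun v => extension_eq_halfExtension g t v hy)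

lemma timeDeriv_extension (hα : α < 1) (hp : 1 ≤ p) (hg : MemLp g p volume) (t : ℝ)
    (x : EuclideanSpace ℝ (Fin n)) {y : ℝ} (hy : 0 < y) :
    timeDeriv (extension α g) t x y = extensionDeriv α g (t, x, y) (1, 0, 0) :=
  (hasDerivAt_extension_time hα hp hg t x hy).deriv

lemma spatialGradient_extension (hα : α < 1) (hp : 1 ≤ p) (hg : MemLp g p volume) (t : ℝ)
    (x : EuclideanSpace ℝ (Fin n)) {y : ℝ} (hy : 0 < y) :
    spatialGradient (extension α g) t x y = WithLp.toLp 2 (Fin.snoc (α := fun _ => 𝕜)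
      (fun i : Fin n => extensionDeriv α g (t, x, y) (0, EuclideanSpace.single i 1, 0))
      (extensionDeriv α g (t, x, y) (0, 0, 1))) := by
  rw [spatialGradient, (hasDerivAt_extension_normal hα hp hg t x hy).deriv]
  congr 2
  ext i
  rw [((hasFDerivAt_extension_tangential hα hp hg t x hy).hasLineDerivAt _).lineDeriv]
  simp

end Derivatives

lemma enorm_euclidean_le_sum {m : ℕ} (v : EuclideanSpace 𝕜 (Fin m)) :
    ‖v‖ₑ ≤ ∑ i, ‖v i‖ₑ := by
  have h : v = ∑ i, EuclideanSpace.single i (v i) := by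
    ext j; simp
  calc ‖v‖ₑ = ‖∑ i, EuclideanSpace.single i (v i)‖ₑ := by rw [← h]
    _ ≤ ∑ i, ‖EuclideanSpace.single i (v i)‖ₑ := enorm_sum_le _ _
    _ = _ := by
      refine Finset.sum_congr rfl fun i _ => ?_
      rw [← ofReal_norm, ← ofReal_norm, PiLp.norm_single]

/-- The upper bound: the derivatives of the extension are dominated by `differenceIntegral`. -/
lemma exists_weightedNorm_le (n : ℕ) (hn : 1 ≤ n) {α r : ℝ} (hα : α < 1)
    (hr0 : 0 < r) (hr1 : r < 1) (hr : r < 1 - α) :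
    ∃ A : ℝ≥0∞, A ≠ ∞ ∧ ∀ p q : ℝ≥0∞, 1 ≤ p → 1 ≤ q → ∀ g : Bdry n → 𝕜, Measurable g →
      MemLp g p volume →
      weightedNorm r p q (extension α g) ≤ A * besovSeminorm r p q g := by
  obtain ⟨A, hA, h⟩ := exists_eLpNorm_differenceIntegral_le (𝕜 := 𝕜) n hn hr0 hr1 hr
  obtain ⟨C, hC, hD⟩ := exists_extensionDeriv_le (𝕜 := 𝕜) n hα
  refine ⟨(n + 1) * ENNReal.ofReal C * A + ENNReal.ofReal C * A, by finiteness,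
    fun p q hp hq g hg hgp => ?_⟩
  have hw : ∀ y : ℝ, 0 < y → ∀ k : ℝ, y ^ (k - r) * (C * (y ^ k)⁻¹) = C * y ^ (-r) := by
    intro y hy k
    have := (Real.rpow_pos_of_pos hy k).ne'
    rw [sub_eq_add_neg, Real.rpow_add hy]
    field_simp
  have h1 : mixedNorm p q (fun t x' xd => xd ^ (1 - r) • spatialGradient (extension α g) t x' xd) ≤
      (n + 1) * ENNReal.ofReal C * (A * besovSeminorm r p q g) := by
    refine (eLpNorm_le_const_mul (by finiteness) ?_ q).trans
      (mul_le_mul_right (h p q hp hq g hg hgp.2.ne) _)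
    filter_upwards [ae_normalMeasure_pos] with y hy
    simp only [enorm_eq_self]
    rw [mul_assoc, ← mul_assoc (ENNReal.ofReal C), ← ENNReal.ofReal_mul hC.le, ← mul_assoc]
    refine eLpNorm_le_const_mul (by finiteness) (ae_of_all _ fun z => ?_) p
    rw [spatialGradient_extension hα hp hgp z.1 z.2 hy, enorm_smul, enorm_eq_self]
    refine (mul_le_mul_right (enorm_euclidean_le_sum _) _).trans ?_
    have hc : ∀ i : Fin (n + 1), ‖(WithLp.toLp 2 (Fin.snoc (α := fun _ => 𝕜)
        (fun i : Fin n => extensionDeriv α g (z.1, z.2, y) (0, EuclideanSpace.single i 1, 0))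
        (extensionDeriv α g (z.1, z.2, y) (0, 0, 1))) : EuclideanSpace 𝕜 (Fin (n + 1))) i‖ₑ ≤
        ENNReal.ofReal (C * (y ^ (1 : ℝ))⁻¹) * differenceIntegral α g y z := by
      intro i
      refine Fin.lastCases ?_ (fun j => ?_) i
      · simpa using hD p hp g hgp z y hy (0, 0, 1)
      · simpa using hD p hp g hgp z y hy (0, EuclideanSpace.single j 1, 0)
    refine (mul_le_mul_right (Finset.sum_le_sum fun i _ => hc i) _).trans (le_of_eq ?_)
    rw [Finset.sum_const, Finset.card_univ, Fintype.card_fin, nsmul_eq_mul,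
      Real.enorm_eq_ofReal (by positivity), ← hw y hy 1,
      ENNReal.ofReal_mul (p := y ^ (1 - r)) (by positivity)]
    push_cast
    ring
  have h2 : mixedNorm p q (fun t x' xd => xd ^ (2 - r) • timeDeriv (extension α g) t x' xd) ≤
      ENNReal.ofReal C * (A * besovSeminorm r p q g) := by
    refine (eLpNorm_le_const_mul (by finiteness) ?_ q).trans
      (mul_le_mul_right (h p q hp hq g hg hgp.2.ne) _)
    filter_upwards [ae_normalMeasure_pos] with y hy
    simp only [enorm_eq_self]
    rw [← mul_assoc, ← ENNReal.ofReal_mul hC.le]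
    refine eLpNorm_le_const_mul (by finiteness) (ae_of_all _ fun z => ?_) p
    rw [timeDeriv_extension hα hp hgp z.1 z.2 hy, enorm_smul, enorm_eq_self]
    refine (mul_le_mul_right (hD p hp g hgp z y hy (1, 0, 0)) _).trans (le_of_eq ?_)
    rw [Real.enorm_eq_ofReal (by positivity), ← hw y hy 2, ← mul_assoc,
      ← ENNReal.ofReal_mul (by positivity)]
    simp
  calc _ ≤ _ := add_le_add h1 h2
    _ = _ := by ring

/-! ### Differences of the extension -/

lemma enorm_sub_le_lintegral_deriv {f f' : ℝ → 𝕜} {a b : ℝ} (hab : a ≤ b)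
    (hf : ∀ s ∈ Icc a b, HasDerivAt f (f' s) s) (hf' : ContinuousOn f' (Icc a b)) :
    ‖f b - f a‖ₑ ≤ ∫⁻ s in Ioc a b, ‖f' s‖ₑ := by
  rw [← uIcc_of_le hab] at hf hf'
  rw [← intervalIntegral.integral_eq_sub_of_hasDerivAt hf hf'.intervalIntegrable,
    intervalIntegral.integral_of_le hab]
  exact enorm_integral_le_lintegral_enorm _

section

variable {α : ℝ} {p : ℝ≥0∞} {g : Bdry n → 𝕜}

/-- The `L_p` norm of the derivative of the extension in the direction `v` at height `y`, extended
by zero to `y ≤ 0`. -/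
def derivNorm (α : ℝ) (p : ℝ≥0∞) (g : Bdry n → 𝕜) (v : Half n) (y : ℝ) : ℝ≥0∞ :=
  eLpNorm (fun z : Bdry n => if 0 < y then extensionDeriv α g (z.1, z.2, y) v else 0) p volume

lemma continuousOn_extensionDeriv (hα : α < 1) (hp : 1 ≤ p) (hg : MemLp g p volume) (v : Half n) :
    ContinuousOn (fun P => extensionDeriv α g P v) {P | 0 < P.2.2} := fun _ hP =>
  ((continuousAt_extensionDeriv hα hp hg hP).clm_apply continuousAt_const).continuousWithinAt

lemma measurable_extensionDeriv_ite (hα : α < 1) (hp : 1 ≤ p) (hg : MemLp g p volume)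
    (v : Half n) : Measurable (Function.uncurry fun (y : ℝ) (z : Bdry n) =>
      if 0 < y then extensionDeriv α g (z.1, z.2, y) v else 0) := by
  have hs : MeasurableSet {x : ℝ × Bdry n | 0 < x.1} := measurableSet_lt measurable_const
    measurable_fst
  have h : ContinuousOn (fun x : ℝ × Bdry n => extensionDeriv α g (x.2.1, x.2.2, x.1) v)
      {x : ℝ × Bdry n | 0 < x.1} :=
    (continuousOn_extensionDeriv hα hp hg v).comp (f := fun x : ℝ × Bdry n =>
      ((x.2.1, x.2.2, x.1) : Half n)) (by fun_prop) fun x hx => hx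
  classical
  exact h.measurable_piecewise (g := fun _ => 0) continuousOn_const hs

lemma measurable_derivNorm (hα : α < 1) (hp : 1 ≤ p) (hg : MemLp g p volume) (v : Half n) :
    Measurable (derivNorm α p g v) :=
  measurable_eLpNorm_of_uncurry (measurable_extensionDeriv_ite hα hp hg v) p

lemma derivNorm_of_pos (v : Half n) {y : ℝ} (hy : 0 < y) :
    derivNorm α p g v y =
      eLpNorm (fun z : Bdry n => extensionDeriv α g (z.1, z.2, y) v) p volume := by
  simp [derivNorm, hy]

lemma continuous_halfExtension (hα : α < 1) (hp : 1 ≤ p) (hg : MemLp g p volume) {y : ℝ}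
    (hy : 0 < y) : Continuous fun z : Bdry n => halfExtension α g (z.1, z.2, y) :=
  continuous_iff_continuousAt.2 fun z =>
    ContinuousAt.comp (f := fun z : Bdry n => ((z.1, z.2, y) : Half n)) (g := halfExtension α g)
      (hasFDerivAt_halfExtension hα hp hg (P := (z.1, z.2, y)) hy).continuousAt (by fun_prop)

lemma continuous_extensionDeriv_apply (hα : α < 1) (hp : 1 ≤ p) (hg : MemLp g p volume)
    (v : Half n) {y : ℝ} (hy : 0 < y) :
    Continuous fun z : Bdry n => extensionDeriv α g (z.1, z.2, y) v :=
  (continuousOn_extensionDeriv hα hp hg v).comp_continuous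
    (f := fun z : Bdry n => ((z.1, z.2, y) : Half n)) (by fun_prop) fun _ => hy

/-- Differences of the extension along the boundary are bounded by its derivatives at the same
height. -/
lemma eLpNorm_halfExtension_add_sub_le (hα : α < 1) (hp : 1 ≤ p) (hg : MemLp g p volume) {y : ℝ}
    (hy : 0 < y) (v : Bdry n) :
    eLpNorm (fun z : Bdry n => halfExtension α g (z.1 + v.1, z.2 + v.2, y) -
      halfExtension α g (z.1, z.2, y)) p volume ≤ derivNorm α p g (v.1, v.2, 0) y := by
  have hc := continuous_extensionDeriv_apply hα hp hg (v.1, v.2, 0) hy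
  have hc2 : Continuous fun x : ℝ × Bdry n =>
      extensionDeriv α g (x.2.1 + x.1 * v.1, x.2.2 + x.1 • v.2, y) (v.1, v.2, 0) :=
    hc.comp (f := fun x : ℝ × Bdry n => ((x.2.1 + x.1 * v.1, x.2.2 + x.1 • v.2) : Bdry n))
      (by fun_prop)
  have hpt : ∀ z : Bdry n, ‖halfExtension α g (z.1 + v.1, z.2 + v.2, y) -
      halfExtension α g (z.1, z.2, y)‖ₑ ≤ ∫⁻ s in Ioc (0 : ℝ) 1,
        ‖extensionDeriv α g (z.1 + s * v.1, z.2 + s • v.2, y) (v.1, v.2, 0)‖ₑ := by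
    intro z
    have h := enorm_sub_le_lintegral_deriv (a := 0) (b := 1) zero_le_one
      (f := fun s : ℝ => halfExtension α g (z.1 + s * v.1, z.2 + s • v.2, y))
      (f' := fun s : ℝ => extensionDeriv α g (z.1 + s * v.1, z.2 + s • v.2, y) (v.1, v.2, 0))
      (fun s _ => ?_) (hc2.comp (f := fun s : ℝ => (s, z)) (by fun_prop)).continuousOn
    · simpa using h
    · have h1 : HasDerivAt (fun s : ℝ => ((z.1 + s * v.1, z.2 + s • v.2, y) : Half n))
          (v.1, v.2, 0) s := by
        refine HasDerivAt.prodMk ?_ (HasDerivAt.prodMk ?_ (hasDerivAt_const s y))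
        · simpa using ((hasDerivAt_id s).mul_const v.1).const_add z.1
        · simpa using ((hasDerivAt_id s).smul_const v.2).const_add z.2
      exact (hasFDerivAt_halfExtension hα hp hg
        (P := (z.1 + s * v.1, z.2 + s • v.2, y)) hy).comp_hasDerivAt s h1
  calc _ ≤ eLpNorm (fun z : Bdry n => ∫⁻ s in Ioc (0 : ℝ) 1,
        ‖extensionDeriv α g (z.1 + s * v.1, z.2 + s • v.2, y) (v.1, v.2, 0)‖ₑ) p volume :=
        eLpNorm_mono_enorm fun z => by simpa using hpt z
    _ ≤ ∫⁻ s in Ioc (0 : ℝ) 1, eLpNorm (fun z : Bdry n =>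
        ‖extensionDeriv α g (z.1 + s * v.1, z.2 + s • v.2, y) (v.1, v.2, 0)‖ₑ) p volume :=
        eLpNorm_lintegral_le hp hc2.measurable.enorm
    _ = ∫⁻ s in Ioc (0 : ℝ) 1, derivNorm α p g (v.1, v.2, 0) y := by
        refine lintegral_congr fun s => ?_
        rw [derivNorm_of_pos _ hy, eLpNorm_enorm,
          ← eLpNorm_comp_add_right p hc.aestronglyMeasurable (s * v.1, s • v.2)]
        rfl
    _ = _ := by simp

/-- Differences of the extension in the normal direction. -/
lemma eLpNorm_halfExtension_sub_le (hα : α < 1) (hp : 1 ≤ p) (hg : MemLp g p volume) {ε y : ℝ}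
    (hε : 0 < ε) (hεy : ε ≤ y) :
    eLpNorm (fun z : Bdry n => halfExtension α g (z.1, z.2, y) -
      halfExtension α g (z.1, z.2, ε)) p volume ≤
        ∫⁻ s in Ioc 0 y, derivNorm α p g (0, 0, 1) s := by
  have hpt : ∀ z : Bdry n, ‖halfExtension α g (z.1, z.2, y) - halfExtension α g (z.1, z.2, ε)‖ₑ ≤
      ∫⁻ s in Ioc 0 y, ‖if 0 < s then extensionDeriv α g (z.1, z.2, s) (0, 0, 1) else 0‖ₑ := by
    intro z
    have hc : ContinuousOn (fun s : ℝ => extensionDeriv α g (z.1, z.2, s) (0, 0, 1)) (Icc ε y) :=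
      (continuousOn_extensionDeriv hα hp hg (0, 0, 1)).comp
        (f := fun s : ℝ => ((z.1, z.2, s) : Half n)) (by fun_prop) fun s hs => hε.trans_le hs.1
    have h := enorm_sub_le_lintegral_deriv hεy
      (f := fun s : ℝ => halfExtension α g (z.1, z.2, s))
      (f' := fun s : ℝ => extensionDeriv α g (z.1, z.2, s) (0, 0, 1)) (fun s hs => ?_) hc
    · refine h.trans ?_
      calc _ = ∫⁻ s in Ioc ε y,
            ‖if 0 < s then extensionDeriv α g (z.1, z.2, s) (0, 0, 1) else 0‖ₑ := by
            refine setLIntegral_congr_fun measurableSet_Ioc fun s hs => ?_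
            simp only [if_pos (hε.trans hs.1)]
        _ ≤ _ := lintegral_mono_set (Ioc_subset_Ioc_left hε.le)
    · have h1 : HasDerivAt (fun s : ℝ => ((z.1, z.2, s) : Half n)) (0, 0, 1) s :=
        (hasDerivAt_const s z.1).prodMk ((hasDerivAt_const s z.2).prodMk (hasDerivAt_id s))
      exact (hasFDerivAt_halfExtension hα hp hg (P := (z.1, z.2, s))
        (hε.trans_le hs.1)).comp_hasDerivAt s h1
  calc _ ≤ eLpNorm (fun z : Bdry n => ∫⁻ s in Ioc 0 y,
        ‖if 0 < s then extensionDeriv α g (z.1, z.2, s) (0, 0, 1) else 0‖ₑ) p volume :=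
        eLpNorm_mono_enorm fun z => by simpa using hpt z
    _ ≤ ∫⁻ s in Ioc 0 y, eLpNorm (fun z : Bdry n =>
        ‖if 0 < s then extensionDeriv α g (z.1, z.2, s) (0, 0, 1) else 0‖ₑ) p volume :=
        eLpNorm_lintegral_le hp (measurable_extensionDeriv_ite hα hp hg _).enorm
    _ = _ := by simp only [eLpNorm_enorm, derivNorm]

end

/-! ### The boundary values of the extension -/

/-- Translations are continuous in `L_1`. -/
lemma tendsto_eLpNorm_translate_sub {G : Bdry n → 𝕜} (hG : MemLp G 1 volume) :
    Filter.Tendsto (fun w : Bdry n => eLpNorm (fun z => G (z - w) - G z) 1 volume) (nhds 0)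
      (nhds 0) := by
  have : Fact ((1 : ℝ≥0∞) ≤ 1) := ⟨le_rfl⟩
  set T : Bdry n → C(Bdry n, Bdry n) := fun w => ⟨fun z => z - w, by fun_prop⟩ with hT
  have hTc : Continuous T := by
    exact ContinuousMap.continuous_of_continuous_uncurry T (by
      change Continuous fun x : Bdry n × Bdry n => x.2 - x.1
      fun_prop)
  have hTm : ∀ w, MeasurePreserving (T w) (volume : Measure (Bdry n)) volume := fun w =>
    measurePreserving_sub_right volume w
  have h := Filter.Tendsto.compMeasurePreservingLp (p := 1) (ν := (volume : Measure (Bdry n)))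
    (f := fun _ : Bdry n => hG.toLp G) (f₀ := hG.toLp G) (l := nhds 0) tendsto_const_nhds
    hTc.continuousAt hTm (hTm 0) ENNReal.one_ne_top
  rw [tendsto_iff_edist_tendsto_0] at h
  refine h.congr fun w => ?_
  rw [Lp.edist_def]
  refine eLpNorm_congr_ae ?_
  have h1 : ∀ w, Lp.compMeasurePreserving (T w) (hTm w) (hG.toLp G) =ᵐ[volume]
      fun z => G (z - w) := by
    intro w
    refine (Lp.coeFn_compMeasurePreserving _ (hTm w)).trans ?_
    exact (hTm w).quasiMeasurePreserving.ae_eq_comp hG.coeFn_toLp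
  filter_upwards [h1 w, h1 0] with z hz hz0
  rw [Pi.sub_apply, hz, hz0, sub_zero]

/-- The parabolic dilation `(τ, z') ↦ (y² τ, y z')`. -/
def dilate (y : ℝ) (w : Bdry n) : Bdry n := (y ^ 2 * w.1, y • w.2)

lemma continuous_dilate (w : Bdry n) : Continuous fun y => dilate y w := by
  unfold dilate; fun_prop

lemma measurable_dilate (y : ℝ) : Measurable (dilate (n := n) y) := by
  unfold dilate; fun_prop

lemma map_dilate {y : ℝ} (hy : 0 < y) : (volume : Measure (Bdry n)).map (dilate y) =
    ENNReal.ofReal (y ^ (-((n : ℝ) + 2))) • volume := by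
  have h1 := Measure.map_addHaar_smul (volume : Measure ℝ) (pow_pos hy 2).ne'
  have h2 := Measure.map_addHaar_smul (volume : Measure (EuclideanSpace ℝ (Fin n))) hy.ne'
  have h3 := Measure.map_prod_map (volume : Measure ℝ)
    (volume : Measure (EuclideanSpace ℝ (Fin n))) (f := fun τ : ℝ => y ^ 2 • τ)
    (g := fun z => y • z) (measurable_const_smul _) (measurable_const_smul _)
  rw [Measure.volume_eq_prod]
  refine h3.symm.trans ?_
  rw [h1, h2, Measure.prod_smul_left, Measure.prod_smul_right, smul_smul,
    ← ENNReal.ofReal_mul (by positivity)]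
  congr 2
  rw [Module.finrank_self, finrank_euclideanSpace_fin, pow_one, abs_of_pos (by positivity),
    abs_of_pos (by positivity), Real.rpow_neg hy.le, Real.rpow_add hy, Real.rpow_natCast,
    ← mul_inv, Real.rpow_two, mul_comm]

lemma majorant_dilate (α : ℝ) {y : ℝ} (hy : 0 < y) (w : Bdry n) :
    majorant α ((dilate y w).1, (dilate y w).2, y) =
      y ^ (-((n : ℝ) + 2)) * majorant α (w.1, w.2, 1) := by
  have e : sqDist ((dilate y w).1, (dilate y w).2, y) + |(dilate y w).1| =
      y ^ (2 : ℝ) * (sqDist (w.1, w.2, 1) + |w.1|) := by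
    simp only [sqDist, dilate, norm_smul, Real.norm_eq_abs, abs_mul, abs_of_pos hy, abs_pow,
      Real.rpow_two]
    ring
  have := sqDist_pos (P := (w.1, w.2, 1)) one_pos
  simp only [majorant]
  rw [e, Real.mul_rpow (by positivity) (by positivity), ← Real.rpow_mul hy.le, Real.one_rpow,
    one_mul, ← mul_assoc, ← Real.rpow_add hy]
  congr 2
  rw [kernelExponent]
  ring

/-- Parabolic dilation carries the majorant at height `1` to the majorant at height `y`. -/
lemma lintegral_majorant_mul (α : ℝ) {y : ℝ} (hy : 0 < y) {ω : Bdry n → ℝ≥0∞}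
    (hω : Measurable ω) : ∫⁻ w : Bdry n, ENNReal.ofReal (majorant α (w.1, w.2, y)) * ω w =
      ∫⁻ w : Bdry n, ENNReal.ofReal (majorant α (w.1, w.2, 1)) * ω (dilate y w) := by
  have hm : Measurable fun w : Bdry n => ENNReal.ofReal (majorant α (w.1, w.2, y)) :=
    (continuous_majorant α hy).measurable.ennreal_ofReal
  have h := lintegral_map (μ := (volume : Measure (Bdry n))) (hm.mul hω) (measurable_dilate y)
  simp only [map_dilate hy, lintegral_smul_measure, Pi.mul_apply, majorant_dilate α hy] at h
  have hc : (0 : ℝ) < y ^ (-((n : ℝ) + 2)) := Real.rpow_pos_of_pos hy _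
  simp only [ENNReal.ofReal_mul hc.le, mul_assoc] at h
  rw [lintegral_const_mul' _ _ ENNReal.ofReal_ne_top] at h
  exact (ENNReal.mul_right_inj (by simpa using hc) ENNReal.ofReal_ne_top).1 h

section

variable {α : ℝ} {p : ℝ≥0∞} {g : Bdry n → 𝕜}

/-- Translations are continuous in `L_1` of a ball, for functions in `L_p`. -/
lemma tendsto_setLIntegral_translate_sub (hp : 1 ≤ p) (hg : MemLp g p volume) (R : ℝ) :
    Filter.Tendsto (fun w : Bdry n => ∫⁻ z in Metric.closedBall 0 R, ‖g (z - w) - g z‖ₑ)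
      (nhds 0) (nhds 0) := by
  have hB : MeasurableSet (Metric.closedBall (0 : Bdry n) (R + 1)) :=
    Metric.isClosed_closedBall.measurableSet
  set G : Bdry n → 𝕜 := (Metric.closedBall (0 : Bdry n) (R + 1)).indicator g with hG
  have : IsFiniteMeasure (volume.restrict (Metric.closedBall (0 : Bdry n) (R + 1))) :=
    ⟨by simpa using (isCompact_closedBall (0 : Bdry n) (R + 1)).measure_lt_top⟩
  have hG1 : MemLp G 1 volume := (memLp_indicator_iff_restrict hB).2
    ((hg.restrict _).mono_exponent hp)
  refine tendsto_of_tendsto_of_tendsto_of_le_of_le' tendsto_const_nhds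
    (tendsto_eLpNorm_translate_sub hG1) (Filter.Eventually.of_forall fun _ => zero_le) ?_
  filter_upwards [Metric.closedBall_mem_nhds (0 : Bdry n) one_pos] with w hw
  rw [eLpNorm_one_eq_lintegral_enorm]
  refine le_trans (le_of_eq ?_) (setLIntegral_le_lintegral (Metric.closedBall 0 R) _)
  refine setLIntegral_congr_fun Metric.isClosed_closedBall.measurableSet fun z hz => ?_
  rw [mem_closedBall_zero_iff] at hz hw
  have h1 : z ∈ Metric.closedBall (0 : Bdry n) (R + 1) :=
    mem_closedBall_zero_iff.2 (by linarith)
  have h2 : z - w ∈ Metric.closedBall (0 : Bdry n) (R + 1) :=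
    mem_closedBall_zero_iff.2 ((norm_sub_le _ _).trans (by linarith))
  simp only [hG, indicator_of_mem h1, indicator_of_mem h2]

lemma exists_setLIntegral_translate_sub_le (hp : 1 ≤ p) (hg : MemLp g p volume) (R : ℝ) :
    ∃ M : ℝ≥0∞, M ≠ ∞ ∧ ∀ w : Bdry n,
      ∫⁻ z in Metric.closedBall 0 R, ‖g (z - w) - g z‖ₑ ≤ M := by
  have : IsFiniteMeasure (volume.restrict (Metric.closedBall (0 : Bdry n) R)) :=
    ⟨by simpa using (isCompact_closedBall (0 : Bdry n) R).measure_lt_top⟩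
  refine ⟨2 * eLpNorm g p volume * (volume.restrict (Metric.closedBall (0 : Bdry n) R)) univ ^
    (1 / (1 : ℝ≥0∞).toReal - 1 / p.toReal), ?_, fun w => ?_⟩
  · refine ENNReal.mul_ne_top (ENNReal.mul_ne_top (by simp) hg.2.ne)
      (ENNReal.rpow_ne_top_of_nonneg ?_ (measure_ne_top _ _))
    rcases eq_or_ne p ∞ with rfl | hpt
    · simp
    · have : 1 ≤ p.toReal := by simpa using ENNReal.toReal_mono hpt hp
      simpa using inv_le_one_of_one_le₀ this
  · have h1 : MemLp (fun z => g (z - w)) p volume :=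
      hg.comp_measurePreserving (measurePreserving_sub_right volume w)
    have h2 : AEStronglyMeasurable (fun z => g (z - w) - g z)
        (volume.restrict (Metric.closedBall (0 : Bdry n) R)) := (h1.sub hg).1.restrict
    rw [← eLpNorm_one_eq_lintegral_enorm]
    refine (eLpNorm_le_eLpNorm_mul_rpow_measure_univ hp h2).trans ?_
    gcongr
    refine (eLpNorm_mono_measure _ Measure.restrict_le_self).trans ?_
    refine (eLpNorm_sub_le h1.1 hg.1 hp).trans ?_
    rw [two_mul]
    gcongr
    exact (eLpNorm_comp_measurePreserving hg.1 (measurePreserving_sub_right volume w)).le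

lemma exists_enorm_halfExtension_sub_le (n : ℕ) {α : ℝ} (hα : α < 1) :
    ∃ C, 0 < C ∧ ∀ (p : ℝ≥0∞), 1 ≤ p → ∀ g : Bdry n → 𝕜, MemLp g p volume →
      ∀ (z : Bdry n) (y : ℝ), 0 < y → ‖halfExtension α g (z.1, z.2, y) - g z‖ₑ ≤
        ENNReal.ofReal C * ∫⁻ w : Bdry n, ENNReal.ofReal (majorant α (w.1, w.2, y)) *
          ‖g (z - w) - g z‖ₑ := by
  obtain ⟨C, hC, hK⟩ := exists_abs_fullKernel_le n hα
  refine ⟨C, hC, fun p hp g hgp z y hy => ?_⟩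
  have hi : Integrable fun w : Bdry n => fullKernel α (w.1, w.2, y) • g (z - w) := by
    refine ((integrable_fullKernel_smul hα hp hgp (P := (z.1, z.2, y)) hy).comp_sub_left
      z).congr (ae_of_all _ fun w => ?_)
    simp [translate]
  -- The kernel is normalized.
  have e : halfExtension α g (z.1, z.2, y) - g z =
      ∫ w : Bdry n, fullKernel α (w.1, w.2, y) • (g (z - w) - g z) := by
    simp only [smul_sub]
    rw [integral_sub hi ((integrable_fullKernel hα hy).smul_const _), integral_smul_const,
      integral_fullKernel hα hy, one_smul, ← extension_eq_halfExtension g z.1 z.2 hy,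
      extension_eq_integral g z.1 z.2 hy]
  rw [e, ← lintegral_const_mul' _ _ ENNReal.ofReal_ne_top]
  refine (enorm_integral_le_lintegral_enorm _).trans (lintegral_mono fun w => ?_)
  rw [enorm_smul, ← mul_assoc, ← ENNReal.ofReal_mul hC.le, Real.enorm_eq_ofReal_abs]
  exact mul_le_mul_left (ENNReal.ofReal_le_ofReal (hK _ hy)) _

/-- The boundary values of the extension are `g`, locally in `L_1`: the kernel at height `y` is
dominated by the parabolic dilates of a fixed integrable function. -/
lemma tendsto_setLIntegral_halfExtension_sub (hα : α < 1) (hp : 1 ≤ p) (hg : Measurable g)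
    (hgp : MemLp g p volume) (R : ℝ) :
    Filter.Tendsto (fun y : ℝ => ∫⁻ z in Metric.closedBall (0 : Bdry n) R,
      ‖halfExtension α g (z.1, z.2, y) - g z‖ₑ) (nhdsWithin 0 (Ioi 0)) (nhds 0) := by
  obtain ⟨C, hC, hK⟩ := exists_enorm_halfExtension_sub_le (𝕜 := 𝕜) n hα
  obtain ⟨M, hM, hωM⟩ := exists_setLIntegral_translate_sub_le hp hgp R
  set B : Measure (Bdry n) := volume.restrict (Metric.closedBall 0 R) with hB
  have hm : Measurable fun x : Bdry n × Bdry n => ‖g (x.2 - x.1) - g x.2‖ₑ := by fun_prop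
  have hωm : Measurable fun w : Bdry n => ∫⁻ z, ‖g (z - w) - g z‖ₑ ∂B :=
    hm.lintegral_prod_right'
  obtain ⟨ω, hω⟩ : ∃ ω : Bdry n → ℝ≥0∞, ω = fun w => ∫⁻ z, ‖g (z - w) - g z‖ₑ ∂B := ⟨_, rfl⟩
  have hlim₀ : Filter.Tendsto ω (nhds 0) (nhds 0) :=
    hω ▸ tendsto_setLIntegral_translate_sub hp hgp R
  rw [← hω] at hωm
  replace hωM : ∀ w, ω w ≤ M := hω ▸ hωM
  have hswap : ∀ y : ℝ, 0 < y → ∫⁻ z, (∫⁻ w : Bdry n, ENNReal.ofReal (majorant α (w.1, w.2, y)) *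
      ‖g (z - w) - g z‖ₑ) ∂B =
        ∫⁻ w : Bdry n, ENNReal.ofReal (majorant α (w.1, w.2, y)) * ω w := by
    intro y hy
    have hmy : Measurable fun w : Bdry n => ENNReal.ofReal (majorant α (w.1, w.2, y)) :=
      (continuous_majorant α hy).measurable.ennreal_ofReal
    have hmm : Measurable fun x : Bdry n × Bdry n =>
        ENNReal.ofReal (majorant α (x.2.1, x.2.2, y)) * ‖g (x.1 - x.2) - g x.1‖ₑ :=
      (hmy.comp measurable_snd).mul (hm.comp measurable_swap)
    rw [lintegral_lintegral_swap hmm.aemeasurable, hω]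
    exact lintegral_congr fun w => lintegral_const_mul' _ _ ENNReal.ofReal_ne_top
  have hmaj : Measurable fun w : Bdry n => ENNReal.ofReal (majorant α (w.1, w.2, 1)) :=
    (continuous_majorant α one_pos).measurable.ennreal_ofReal
  have hle : ∀ y : ℝ, 0 < y → ∫⁻ z, ‖halfExtension α g (z.1, z.2, y) - g z‖ₑ ∂B ≤
      ENNReal.ofReal C *
        ∫⁻ w : Bdry n, ENNReal.ofReal (majorant α (w.1, w.2, 1)) * ω (dilate y w) := by
    intro y hy
    refine (lintegral_mono fun z => hK p hp g hgp z y hy).trans (le_of_eq ?_)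
    rw [lintegral_const_mul' _ _ ENNReal.ofReal_ne_top, hswap y hy,
      lintegral_majorant_mul α hy hωm]
  have hlim : Filter.Tendsto (fun y : ℝ => ENNReal.ofReal C *
      ∫⁻ w : Bdry n, ENNReal.ofReal (majorant α (w.1, w.2, 1)) * ω (dilate y w))
      (nhdsWithin 0 (Ioi 0)) (nhds (ENNReal.ofReal C * ∫⁻ _ : Bdry n, 0)) := by
    refine ENNReal.Tendsto.const_mul ?_ (Or.inr ENNReal.ofReal_ne_top)
    refine tendsto_lintegral_filter_of_dominated_convergence
      (fun w : Bdry n => ENNReal.ofReal (majorant α (w.1, w.2, 1)) * M)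
      (Filter.Eventually.of_forall fun y => hmaj.mul (hωm.comp (measurable_dilate y)))
      (Filter.Eventually.of_forall fun y => ae_of_all _ fun w => ?_) ?_ (ae_of_all _ fun w => ?_)
    · exact mul_le_mul_right (hωM _) _
    · rw [lintegral_mul_const _ hmaj]
      exact ENNReal.mul_ne_top (integrable_majorant hα one_pos).lintegral_lt_top.ne hM
    · have h1 : Filter.Tendsto (fun y : ℝ => dilate y w) (nhdsWithin 0 (Ioi 0)) (nhds 0) := by
        have := (continuous_dilate w).tendsto 0
        have h0 : dilate 0 w = 0 := by simp [dilate]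
        rw [h0] at this
        exact this.mono_left nhdsWithin_le_nhds
      have h2 := ENNReal.Tendsto.const_mul (a := ENNReal.ofReal (majorant α (w.1, w.2, 1)))
        (hlim₀.comp h1) (Or.inr ENNReal.ofReal_ne_top)
      simpa using h2
  simp only [lintegral_zero, mul_zero] at hlim
  refine tendsto_of_tendsto_of_tendsto_of_le_of_le' tendsto_const_nhds hlim
    (Filter.Eventually.of_forall fun _ => zero_le) ?_
  filter_upwards [self_mem_nhdsWithin] with y hy using hle y hy

lemma eLpNorm_le_of_forall_closedBall {f : Bdry n → 𝕜} (hf : AEStronglyMeasurable f volume)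
    {K : ℝ≥0∞}
    (h : ∀ k : ℕ, eLpNorm f p (volume.restrict (Metric.closedBall (0 : Bdry n) k)) ≤ K) :
    eLpNorm f p volume ≤ K := by
  have hB : ∀ k : ℕ, MeasurableSet (Metric.closedBall (0 : Bdry n) k) := fun k =>
    Metric.isClosed_closedBall.measurableSet
  refine (Lp.eLpNorm_lim_le_liminf_eLpNorm
    (f := fun k : ℕ => (Metric.closedBall (0 : Bdry n) k).indicator f)
    (fun k => hf.indicator (hB k)) f (ae_of_all _ fun z => ?_)).trans ?_
  · refine tendsto_const_nhds.congr' ?_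
    filter_upwards [Filter.eventually_ge_atTop ⌈‖z‖⌉₊] with k hk
    rw [indicator_of_mem]
    exact mem_closedBall_zero_iff.2 (Nat.ceil_le.1 hk)
  · refine (Filter.liminf_le_liminf (Filter.Eventually.of_forall fun k => ?_)).trans
      (Filter.liminf_const K).le
    rw [eLpNorm_indicator_eq_eLpNorm_restrict (hB k)]
    exact h k

/-- The distance of `g` to its extension at height `y` is controlled by the normal derivative
below `y`. -/
lemma eLpNorm_sub_halfExtension_le (hα : α < 1) (hp : 1 ≤ p) (hg : Measurable g)
    (hgp : MemLp g p volume) {y : ℝ} (hy : 0 < y) :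
    eLpNorm (fun z : Bdry n => halfExtension α g (z.1, z.2, y) - g z) p volume ≤
      ∫⁻ s in Ioc 0 y, derivNorm α p g (0, 0, 1) s := by
  have hU : ∀ ε : ℝ, 0 < ε → AEStronglyMeasurable
      (fun z : Bdry n => halfExtension α g (z.1, z.2, ε)) volume := fun ε hε =>
    (continuous_halfExtension hα hp hgp hε).aestronglyMeasurable
  refine eLpNorm_le_of_forall_closedBall ((hU y hy).sub hgp.1) fun k => ?_
  -- Along a sequence of heights the extension converges to `g` almost everywhere in the ball,
  -- so Fatou's lemma applies.
  obtain ⟨ε, -, hε0, hε⟩ := exists_seq_strictAnti_tendsto' hy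
  have hlim : Filter.Tendsto (fun j => eLpNorm
      ((fun z : Bdry n => halfExtension α g (z.1, z.2, ε j)) - g) 1
      (volume.restrict (Metric.closedBall (0 : Bdry n) k))) Filter.atTop (nhds 0) := by
    simp only [eLpNorm_one_eq_lintegral_enorm, Pi.sub_apply]
    exact (tendsto_setLIntegral_halfExtension_sub hα hp hg hgp k).comp
      (tendsto_nhdsWithin_iff.2 ⟨hε, Filter.Eventually.of_forall fun j => (hε0 j).1⟩)
  have hmeas := tendstoInMeasure_of_tendsto_eLpNorm one_ne_zero
    (fun j => (hU (ε j) (hε0 j).1).restrict) hgp.1.restrict hlim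
  obtain ⟨φ, -, hae⟩ := hmeas.exists_seq_tendsto_ae
  refine (Lp.eLpNorm_lim_le_liminf_eLpNorm
    (f := fun j => fun z : Bdry n =>
      halfExtension α g (z.1, z.2, y) - halfExtension α g (z.1, z.2, ε (φ j)))
    (fun j => ((hU y hy).sub (hU _ (hε0 _).1)).restrict) _ ?_).trans ?_
  · filter_upwards [hae] with z hz using tendsto_const_nhds.sub hz
  · refine (Filter.liminf_le_liminf (Filter.Eventually.of_forall fun j => ?_)).trans
      (Filter.liminf_const (∫⁻ s in Ioc 0 y, derivNorm α p g (0, 0, 1) s)).le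
    exact (eLpNorm_mono_measure _ Measure.restrict_le_self).trans
      (eLpNorm_halfExtension_sub_le hα hp hgp (hε0 _).1 (hε0 _).2.le)

end

/-! ### The lower bound -/

/-- Functions dominated by a function of `ρ`, when `ρ` carries the measure to a multiple of
`dy / y`. -/
lemma eLpNorm_le_of_map_eq_smul {Z : Type*} [MeasurableSpace Z] {ν : Measure Z} {ρ : Z → ℝ}
    (hρ : Measurable ρ) {c : ℝ≥0∞} (hν : ν.map ρ = c • normalMeasure) {q : ℝ≥0∞} (hq : 1 ≤ q)
    {F : Z → ℝ≥0∞} {Ψ : ℝ → ℝ≥0∞} (hΨ : Measurable Ψ) (h : ∀ z, 0 < ρ z → F z ≤ Ψ (ρ z)) :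
    eLpNorm F q ν ≤ (1 + c) * eLpNorm Ψ q normalMeasure := by
  have hpos : ∀ᵐ z ∂ν, 0 < ρ z := by
    refine ae_of_ae_map (p := fun y => 0 < y) hρ.aemeasurable ?_
    rw [hν]
    exact Measure.ae_smul_measure ae_normalMeasure_pos c
  have h1 : eLpNorm F q ν ≤ eLpNorm (Ψ ∘ ρ) q ν :=
    eLpNorm_mono_enorm_ae (hpos.mono fun z hz => by simpa using h z hz)
  rw [← eLpNorm_map_measure hΨ.aestronglyMeasurable hρ.aemeasurable, hν] at h1
  refine h1.trans ((eLpNorm_smul_measure_le c Ψ q _).trans ?_)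
  rw [smul_eq_mul]
  gcongr
  have hq0 : 0 ≤ (1 / q).toReal := ENNReal.toReal_nonneg
  have hq1 : (1 / q).toReal ≤ 1 := by
    refine ENNReal.toReal_le_of_le_ofReal zero_le_one ?_
    simpa using hq
  calc c ^ (1 / q).toReal ≤ (1 + c) ^ (1 / q).toReal :=
        ENNReal.rpow_le_rpow le_add_self hq0
    _ ≤ (1 + c) ^ (1 : ℝ) := ENNReal.rpow_le_rpow_of_exponent_le le_self_add hq1
    _ = 1 + c := ENNReal.rpow_one _

/-- The pointwise form of Hardy's inequality in logarithmic coordinates. -/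
lemma rpow_mul_lintegral_Ioc_le (r : ℝ) {D : ℝ → ℝ≥0∞} (hD : Measurable D) {y : ℝ}
    (hy : 0 < y) : ENNReal.ofReal (y ^ (-r)) * ∫⁻ s in Ioc 0 y, D s ≤
      ∫⁻ s, ENNReal.ofReal (logKernel r y s) * (ENNReal.ofReal (s ^ (1 - r)) * D s)
        ∂normalMeasure := by
  have hk : Measurable fun s => ENNReal.ofReal (logKernel r y s) :=
    ((measurable_logKernel r).comp (f := fun s : ℝ => (y, s)) (by fun_prop)).ennreal_ofReal
  rw [normalMeasure, lintegral_withDensity_eq_lintegral_mul _ (by fun_prop) (by fun_prop),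
    ← lintegral_const_mul _ hD]
  refine le_trans (le_of_eq ?_) (lintegral_mono_set (s := Ioc 0 y) fun s hs => hs.1)
  refine setLIntegral_congr_fun measurableSet_Ioc fun s hs => ?_
  have hs0 : 0 < s := hs.1
  have hK : logKernel r y s = s ^ r * y ^ (-r) := by
    rw [logKernel, abs_of_nonpos (sub_nonpos.2 (Real.log_le_log hs0 hs.2)),
      Real.rpow_def_of_pos hs0, Real.rpow_def_of_pos hy, ← Real.exp_add]
    congr 1
    ring
  have he : y ^ (-r) = s⁻¹ * (logKernel r y s * s ^ (1 - r)) := by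
    rw [hK, Real.rpow_sub hs0, Real.rpow_one]
    have := (Real.rpow_pos_of_pos hs0 r).ne'
    field_simp
  simp only [Pi.mul_apply]
  rw [he, ENNReal.ofReal_mul (by positivity),
    ENNReal.ofReal_mul (p := logKernel r y s) (Real.exp_nonneg _)]
  ring

section

variable {α : ℝ} {p : ℝ≥0∞} {g : Bdry n → 𝕜}

lemma derivNorm_smul (c : ℝ) (v : Half n) (y : ℝ) :
    derivNorm α p g (c • v) y = ‖c‖ₑ * derivNorm α p g v y := by
  rw [derivNorm, derivNorm, ← eLpNorm_const_smul]
  congr 1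
  ext z
  by_cases hy : 0 < y <;> simp [hy]

lemma derivNorm_tangential_le (hα : α < 1) (hp : 1 ≤ p) (hg : MemLp g p volume)
    (ζ : EuclideanSpace ℝ (Fin n)) {y : ℝ} (hy : 0 < y) :
    derivNorm α p g (0, ζ, 0) y ≤
      ‖ζ‖ₑ * ∑ i, derivNorm α p g (0, EuclideanSpace.single i 1, 0) y := by
  have hv : ((0, ζ, 0) : Half n) =
      ∑ i, ζ i • ((0, EuclideanSpace.single i 1, 0) : Half n) := by
    ext j
    · simp [Prod.fst_sum]
    · simp [Prod.fst_sum, Prod.snd_sum, Pi.single_apply]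
    · simp [Prod.snd_sum]
  have h2 : (fun z : Bdry n => extensionDeriv α g (z.1, z.2, y) (0, ζ, 0)) =
      ∑ i, fun z : Bdry n => ζ i •
        extensionDeriv α g (z.1, z.2, y) (0, EuclideanSpace.single i 1, 0) := by
    ext z
    rw [hv, map_sum, Finset.sum_apply]
    simp only [map_smul]
  rw [derivNorm_of_pos _ hy, h2]
  refine (eLpNorm_sum_le (fun i _ => ((continuous_extensionDeriv_apply hα hp hg _
    hy).const_smul _).aestronglyMeasurable) hp).trans ?_
  rw [Finset.mul_sum]
  refine Finset.sum_le_sum fun i _ => ?_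
  rw [derivNorm_of_pos _ hy]
  refine (eLpNorm_const_smul (ζ i) _ p volume).le.trans ?_
  gcongr
  exact enorm_le_iff_norm_le.2 (PiLp.norm_apply_le ζ i)

/-- The distance of `g` to its extension at height `y`. -/
def traceDist (α : ℝ) (p : ℝ≥0∞) (g : Bdry n → 𝕜) (y : ℝ) : ℝ≥0∞ :=
  eLpNorm (fun z : Bdry n => halfExtension α g (z.1, z.2, y) - g z) p volume

/-- A first difference of `g` is compared with that of the extension at any height. -/
lemma eLpNorm_add_sub_le (hα : α < 1) (hp : 1 ≤ p) (hg : MemLp g p volume) {y : ℝ}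
    (hy : 0 < y) (v : Bdry n) :
    eLpNorm (fun z : Bdry n => g (z.1 + v.1, z.2 + v.2) - g z) p volume ≤
      derivNorm α p g (v.1, v.2, 0) y + 2 * traceDist α p g y := by
  have hU := (continuous_halfExtension hα hp hg hy).aestronglyMeasurable (μ := volume)
  have hD := hU.sub hg.1
  have hmp := measurePreserving_add_right (volume : Measure (Bdry n)) v
  have h1 := eLpNorm_halfExtension_add_sub_le hα hp hg hy v
  have h2 := eLpNorm_comp_add_right p hD v
  set U : Bdry n → 𝕜 := fun z => halfExtension α g (z.1, z.2, y) with hUdef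
  have hUv : AEStronglyMeasurable (fun z => U (z + v)) volume := hU.comp_measurePreserving hmp
  have hDv : AEStronglyMeasurable (fun z => (U - g) (z + v)) volume :=
    hD.comp_measurePreserving hmp
  have e : (fun z : Bdry n => g (z.1 + v.1, z.2 + v.2) - g z) =
      ((fun z => U (z + v)) - U) - ((fun z => (U - g) (z + v)) - (U - g)) := by
    ext z
    simp only [Pi.sub_apply]
    have hz : ((z.1 + v.1, z.2 + v.2) : Bdry n) = z + v := rfl
    rw [hz]
    ring
  rw [e]
  refine (eLpNorm_sub_le (hUv.sub hU) (hDv.sub hD) hp).trans (add_le_add h1 ?_)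
  refine (eLpNorm_sub_le hDv hD hp).trans ?_
  rw [h2, two_mul]
  rfl

/-- A second difference is the sum of the first differences with steps `h` and `-h`. -/
lemma spaceModulus₂_le (hp : 1 ≤ p) (hg : Measurable g) (h : EuclideanSpace ℝ (Fin n)) :
    spaceModulus₂ p g h ≤ spaceModulus p g h + spaceModulus p g (-h) := by
  have h1 : Measurable fun z : Bdry n => g (z.1, z.2 + h) - g z := by fun_prop
  have h2 : Measurable fun z : Bdry n => g (z.1, z.2 + -h) - g z := by fun_prop
  refine le_trans (le_of_eq ?_)
    (eLpNorm_add_le h1.aestronglyMeasurable h2.aestronglyMeasurable hp)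
  rw [spaceModulus₂]
  congr 1
  ext z
  simp only [Pi.add_apply, ← sub_eq_add_neg]
  ring

end

/-- The weighted distance of `g` to its extension is controlled by the normal derivative, by
Hardy's inequality. -/
lemma exists_traceDist_le {r : ℝ} (hr0 : 0 < r) :
    ∃ A : ℝ≥0∞, A ≠ ∞ ∧ ∀ {n : ℕ} {α : ℝ} {p q : ℝ≥0∞} {g : Bdry n → 𝕜}, α < 1 → 1 ≤ p → 1 ≤ q →
      Measurable g → MemLp g p volume → ∃ E : ℝ → ℝ≥0∞, Measurable E ∧
        (∀ y, 0 < y → ENNReal.ofReal (y ^ (-r)) * traceDist α p g y ≤ E y) ∧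
        eLpNorm E q normalMeasure ≤ A * eLpNorm (fun y => ENNReal.ofReal (y ^ (1 - r)) *
          derivNorm α p g (0, 0, 1) y) q normalMeasure := by
  have hid : normalMeasure.map id = (1 : ℝ≥0∞) • normalMeasure := by
    rw [Measure.map_id, one_smul]
  obtain ⟨A, hA, h⟩ := exists_eLpNorm_logKernel_le measurable_id ENNReal.one_ne_top hid hr0
  refine ⟨A, hA, fun {n α p q g} hα hp hq hg hgp => ?_⟩
  have hD := measurable_derivNorm hα hp hgp (0, 0, 1)
  have hφ : Measurable fun y : ℝ => ENNReal.ofReal (y ^ (1 - r)) * derivNorm α p g (0, 0, 1) y := by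
    fun_prop
  refine ⟨_, ?_, fun y hy => ?_, h q hq _ hφ⟩
  · refine Measurable.lintegral_prod_right (f := fun y s => ENNReal.ofReal (logKernel r y s) *
      (ENNReal.ofReal (s ^ (1 - r)) * derivNorm α p g (0, 0, 1) s)) ?_
    exact (measurable_logKernel r).ennreal_ofReal.mul (hφ.comp measurable_snd)
  · exact (mul_le_mul_right (eLpNorm_sub_halfExtension_le hα hp hg hgp hy) _).trans
      (rpow_mul_lintegral_Ioc_le r hD hy)

section

variable {α r : ℝ} {p : ℝ≥0∞} {g : Bdry n → 𝕜}

lemma ofReal_mul_derivNorm_le_of_norm_le {V : Type*} [NormedAddCommGroup V] [NormedSpace ℝ V]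
    {F : Bdry n → V} {c y : ℝ} (hc : 0 ≤ c) (hy : 0 < y) (v : Half n)
    (h : ∀ z : Bdry n, ‖extensionDeriv α g (z.1, z.2, y) v‖ ≤ ‖F z‖) :
    ENNReal.ofReal c * derivNorm α p g v y ≤ eLpNorm (fun z => c • F z) p volume := by
  rw [derivNorm_of_pos _ hy, ← Real.enorm_eq_ofReal hc, ← eLpNorm_const_smul]
  refine eLpNorm_mono fun z => ?_
  rw [Pi.smul_apply, norm_smul, norm_smul]
  exact mul_le_mul_of_nonneg_left (h z) (norm_nonneg c)

lemma eLpNorm_rpow_mul_derivNorm_normal_le (hα : α < 1) (hp : 1 ≤ p) (hg : MemLp g p volume)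
    (q : ℝ≥0∞) : eLpNorm (fun y : ℝ => ENNReal.ofReal (y ^ (1 - r)) *
      derivNorm α p g (0, 0, 1) y) q normalMeasure ≤ weightedNorm r p q (extension α g) := by
  refine le_trans (eLpNorm_mono_enorm_ae ?_) le_self_add
  filter_upwards [ae_normalMeasure_pos] with y hy
  simp only [enorm_eq_self]
  refine ofReal_mul_derivNorm_le_of_norm_le (by positivity) hy _ fun z => ?_
  rw [spatialGradient_extension hα hp hg z.1 z.2 hy]
  refine le_trans (le_of_eq ?_) (PiLp.norm_apply_le _ (Fin.last n))
  simp

lemma eLpNorm_rpow_mul_derivNorm_tangential_le (hα : α < 1) (hp : 1 ≤ p) (hg : MemLp g p volume)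
    (q : ℝ≥0∞) (i : Fin n) : eLpNorm (fun y : ℝ => ENNReal.ofReal (y ^ (1 - r)) *
      derivNorm α p g (0, EuclideanSpace.single i 1, 0) y) q normalMeasure ≤
        weightedNorm r p q (extension α g) := by
  refine le_trans (eLpNorm_mono_enorm_ae ?_) le_self_add
  filter_upwards [ae_normalMeasure_pos] with y hy
  simp only [enorm_eq_self]
  refine ofReal_mul_derivNorm_le_of_norm_le (by positivity) hy _ fun z => ?_
  rw [spatialGradient_extension hα hp hg z.1 z.2 hy]
  refine le_trans (le_of_eq ?_) (PiLp.norm_apply_le _ i.castSucc)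
  simp

lemma eLpNorm_rpow_mul_derivNorm_time_le (hα : α < 1) (hp : 1 ≤ p) (hg : MemLp g p volume)
    (q : ℝ≥0∞) : eLpNorm (fun y : ℝ => ENNReal.ofReal (y ^ (2 - r)) *
      derivNorm α p g (1, 0, 0) y) q normalMeasure ≤ weightedNorm r p q (extension α g) := by
  refine le_trans (eLpNorm_mono_enorm_ae ?_) le_add_self
  filter_upwards [ae_normalMeasure_pos] with y hy
  simp only [enorm_eq_self]
  refine ofReal_mul_derivNorm_le_of_norm_le (by positivity) hy _ fun z => ?_
  rw [timeDeriv_extension hα hp hg z.1 z.2 hy]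

/-- Second differences in `x'` with step `h`, compared with the extension at height `‖h‖`. -/
lemma spaceModulus₂_div_le (hα : α < 1) (hp : 1 ≤ p) (hg : Measurable g)
    (hgp : MemLp g p volume) (h : EuclideanSpace ℝ (Fin n)) (hh : 0 < ‖h‖) :
    spaceModulus₂ p g h / ENNReal.ofReal (‖h‖ ^ r) ≤
      4 * (ENNReal.ofReal (‖h‖ ^ (-r)) * traceDist α p g ‖h‖) +
        2 * ∑ i, ENNReal.ofReal (‖h‖ ^ (1 - r)) *
          derivNorm α p g (0, EuclideanSpace.single i 1, 0) ‖h‖ := by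
  have hm : ∀ k : EuclideanSpace ℝ (Fin n), ‖k‖ = ‖h‖ → spaceModulus p g k ≤
      ENNReal.ofReal ‖h‖ * ∑ i, derivNorm α p g (0, EuclideanSpace.single i 1, 0) ‖h‖ +
        2 * traceDist α p g ‖h‖ := by
    intro k hk
    have h1 := eLpNorm_add_sub_le hα hp hgp hh ((0, k) : Bdry n)
    simp only [add_zero] at h1
    refine h1.trans (add_le_add ?_ le_rfl)
    rw [← hk, ofReal_norm]
    exact derivNorm_tangential_le hα hp hgp k (hk ▸ hh)
  have h2 := (spaceModulus₂_le hp hg h).trans (add_le_add (hm h rfl) (hm (-h) (norm_neg h)))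
  refine (ENNReal.div_le_div_right h2 _).trans (le_of_eq ?_)
  have e1 : ‖h‖ ^ (1 - r) = ‖h‖ ^ (-r) * ‖h‖ := by
    rw [sub_eq_neg_add, Real.rpow_add hh, Real.rpow_one]
  rw [← Finset.mul_sum, e1, ENNReal.ofReal_mul (by positivity), Real.rpow_neg hh.le,
    ENNReal.ofReal_inv_of_pos (by positivity), div_eq_mul_inv]
  ring

/-- First differences in `t` with step `τ`, compared with the extension at height `√|τ|`. -/
lemma timeModulus_div_le (hα : α < 1) (hp : 1 ≤ p)
    (hgp : MemLp g p volume) (τ : ℝ) (hτ : 0 < √|τ|) :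
    timeModulus p g τ / ENNReal.ofReal (|τ| ^ (r / 2)) ≤
      2 * (ENNReal.ofReal (√|τ| ^ (-r)) * traceDist α p g √|τ|) +
        ENNReal.ofReal (√|τ| ^ (2 - r)) * derivNorm α p g (1, 0, 0) √|τ| := by
  have h1 := eLpNorm_add_sub_le hα hp hgp hτ ((τ, 0) : Bdry n)
  simp only [add_zero] at h1
  have hv : ((τ, 0, 0) : Half n) = τ • ((1, 0, 0) : Half n) := by ext <;> simp
  rw [hv, derivNorm_smul, Real.enorm_eq_ofReal_abs] at h1
  refine (ENNReal.div_le_div_right h1 _).trans (le_of_eq ?_)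
  have e : |τ| = √|τ| ^ (2 : ℝ) := by rw [Real.rpow_two, Real.sq_sqrt (abs_nonneg τ)]
  have e1 : |τ| ^ (r / 2) = √|τ| ^ r := by
    rw [Real.sqrt_eq_rpow, ← Real.rpow_mul (abs_nonneg τ)]
    congr 1
    ring
  have e2 : √|τ| ^ (2 - r) = √|τ| ^ (-r) * |τ| := by
    rw [sub_eq_neg_add, Real.rpow_add hτ, ← e]
  rw [e1, e2, ENNReal.ofReal_mul (by positivity), Real.rpow_neg hτ.le,
    ENNReal.ofReal_inv_of_pos (by positivity), div_eq_mul_inv]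
  ring

end

/-- The lower bound: the moduli of smoothness of `g` at the scale `y` are compared with the
derivatives of the extension at height `y`. -/
lemma exists_besovSeminorm_le (n : ℕ) (hn : 1 ≤ n) {α r : ℝ} (hα : α < 1) (hr0 : 0 < r) :
    ∃ A : ℝ≥0∞, A ≠ ∞ ∧ ∀ p q : ℝ≥0∞, 1 ≤ p → 1 ≤ q → ∀ g : Bdry n → 𝕜, Measurable g →
      MemLp g p volume →
      besovSeminorm r p q g ≤ A * weightedNorm r p q (extension α g) := by
  obtain ⟨A, hA, hE⟩ := exists_traceDist_le (𝕜 := 𝕜) hr0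
  obtain ⟨c₁, hc₁, hm₁⟩ := map_norm_spaceMeasure hn
  obtain ⟨c₂, hc₂, hm₂⟩ := map_sqrt_abs_timeMeasure
  refine ⟨(1 + c₁) * (4 * A + 2 * n) + (1 + c₂) * (2 * A + 1), by finiteness,
    fun p q hp hq g hg hgp => ?_⟩
  obtain ⟨E, hEm, hEle, hEnorm⟩ := hE (q := q) hα hp hq hg hgp
  set W := weightedNorm r p q (extension α g) with hW
  replace hEnorm : eLpNorm E q normalMeasure ≤ A * W :=
    hEnorm.trans (mul_le_mul_right (eLpNorm_rpow_mul_derivNorm_normal_le hα hp hgp q) _)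
  set D : Fin n → ℝ → ℝ≥0∞ := fun i y => ENNReal.ofReal (y ^ (1 - r)) *
    derivNorm α p g (0, EuclideanSpace.single i 1, 0) y with hD
  set T : ℝ → ℝ≥0∞ := fun y => ENNReal.ofReal (y ^ (2 - r)) * derivNorm α p g (1, 0, 0) y with hT
  have hDm : ∀ i, Measurable (D i) := fun i => by
    have := measurable_derivNorm hα hp hgp (0, EuclideanSpace.single i 1, 0)
    fun_prop
  have hTm : Measurable T := by
    have := measurable_derivNorm hα hp hgp (1, 0, 0)
    fun_prop
  have hsum : Measurable (∑ i, D i) := by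
    rw [Finset.sum_fn]
    exact Finset.measurable_sum _ fun i _ => hDm i
  have hcm : ∀ (k : ℝ≥0∞) (F : ℝ → ℝ≥0∞), k ≠ ∞ →
      eLpNorm (fun y => k * F y) q normalMeasure ≤ k * eLpNorm F q normalMeasure :=
    fun k F hk => eLpNorm_le_const_mul hk (ae_of_all _ fun y => le_rfl) q
  have hs : spaceSeminorm r p q g ≤ (1 + c₁) * (4 * (A * W) + 2 * (n * W)) := by
    refine (eLpNorm_le_of_map_eq_smul measurable_norm hm₁ hq
      (Ψ := (fun y => 4 * E y) + fun y => 2 * (∑ i, D i) y)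
      ((hEm.const_mul 4).add (hsum.const_mul 2)) fun h hh => ?_).trans
      (mul_le_mul_right ?_ _)
    · refine (spaceModulus₂_div_le hα hp hg hgp h hh).trans ?_
      rw [Pi.add_apply, Finset.sum_apply]
      exact add_le_add (mul_le_mul_right (hEle _ hh) _) le_rfl
    · refine (eLpNorm_add_le (hEm.const_mul 4).aestronglyMeasurable
        (hsum.const_mul 2).aestronglyMeasurable hq).trans (add_le_add ?_ ?_)
      · exact (hcm 4 E (by simp)).trans (mul_le_mul_right hEnorm _)
      · refine (hcm 2 _ (by simp)).trans (mul_le_mul_right ?_ _)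
        refine (eLpNorm_sum_le (fun i _ => (hDm i).aestronglyMeasurable) hq).trans ?_
        refine (Finset.sum_le_sum fun i _ =>
          eLpNorm_rpow_mul_derivNorm_tangential_le hα hp hgp q i).trans (le_of_eq ?_)
        simp [hW]
  have ht : timeSeminorm r p q g ≤ (1 + c₂) * (2 * (A * W) + W) := by
    refine (eLpNorm_le_of_map_eq_smul (ρ := fun τ => √|τ|) (by fun_prop) hm₂ hq
      (Ψ := (fun y => 2 * E y) + T) ((hEm.const_mul 2).add hTm) fun τ hτ => ?_).trans
      (mul_le_mul_right ?_ _)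
    · refine (timeModulus_div_le hα hp hgp τ hτ).trans ?_
      exact add_le_add (mul_le_mul_right (hEle _ hτ) _) le_rfl
    · refine (eLpNorm_add_le (hEm.const_mul 2).aestronglyMeasurable
        hTm.aestronglyMeasurable hq).trans (add_le_add ?_ ?_)
      · exact (hcm 2 E (by simp)).trans (mul_le_mul_right hEnorm _)
      · exact eLpNorm_rpow_mul_derivNorm_time_le hα hp hgp q
  exact (add_le_add hs ht).trans (le_of_eq (by ring))

/-! ### Reduction to measurable functions -/

lemma ae_eq_comp_add {E : Type*} {g g' : Bdry n → E} (h : g =ᵐ[volume] g') (v : Bdry n) :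
    (fun z => g (z + v)) =ᵐ[volume] fun z => g' (z + v) :=
  (measurePreserving_add_right volume v).quasiMeasurePreserving.ae_eq_comp h

lemma extension_congr_ae {g g' : Bdry n → 𝕜} (h : g =ᵐ[volume] g') (α : ℝ) :
    extension α g = extension α g' := by
  ext t x y
  have hmp := Measure.measurePreserving_sub_left volume ((t, x) : Bdry n)
  have h1 : (fun w : Bdry n => g ((t, x) - w)) =ᵐ[volume] fun w => g' ((t, x) - w) :=
    hmp.quasiMeasurePreserving.ae_eq_comp h
  refine setIntegral_congr_ae measurableSet_past (h1.mono fun w hw _ => ?_)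
  rw [integrand, integrand]
  exact congrArg _ hw

lemma besovSeminorm_congr_ae {g g' : Bdry n → 𝕜} (h : g =ᵐ[volume] g') (r : ℝ) (p q : ℝ≥0∞) :
    besovSeminorm r p q g = besovSeminorm r p q g' := by
  rw [besovSeminorm, besovSeminorm, spaceSeminorm, spaceSeminorm, timeSeminorm, timeSeminorm]
  congr 2
  · ext v
    congr 1
    refine eLpNorm_congr_ae ?_
    filter_upwards [h, ae_eq_comp_add h (0, v), ae_eq_comp_add h (0, -v)] with z h0 h1 h2
    have e1 : z + (0, v) = (z.1, z.2 + v) := by ext <;> simp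
    have e2 : z + (0, -v) = (z.1, z.2 - v) := by ext <;> simp [sub_eq_add_neg]
    rw [e1] at h1
    rw [e2] at h2
    rw [h0, h1, h2]
  · ext τ
    congr 1
    refine eLpNorm_congr_ae ?_
    filter_upwards [h, ae_eq_comp_add h (τ, 0)] with z h0 h1
    have e1 : z + (τ, 0) = (z.1 + τ, z.2) := by ext <;> simp
    rw [e1] at h1
    rw [h0, h1]

/-- Both bounds with one constant, which depends only on the dimension, `α` and `r`. -/
lemma exists_besovSeminorm_equiv (n : ℕ) (hn : 1 ≤ n) {α r : ℝ} (hα : α < 1)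
    (hr0 : 0 < r) (hr1 : r < 1) (hr : r < 1 - α) :
    ∃ C : ℝ, 0 < C ∧ ∀ p q : ℝ≥0∞, 1 ≤ p → 1 ≤ q → ∀ g : Bdry n → 𝕜, MemLp g p volume →
      ENNReal.ofReal C⁻¹ * besovSeminorm r p q g ≤ weightedNorm r p q (extension α g) ∧
      weightedNorm r p q (extension α g) ≤ ENNReal.ofReal C * besovSeminorm r p q g := by
  obtain ⟨A, hA, h⟩ := exists_besovSeminorm_le (𝕜 := 𝕜) n hn hα hr0
  obtain ⟨B, hB, h'⟩ := exists_weightedNorm_le (𝕜 := 𝕜) n hn hα hr0 hr1 hr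
  have hC : 0 < A.toReal + B.toReal + 1 := by positivity
  have hAC : A ≤ ENNReal.ofReal (A.toReal + B.toReal + 1) := by
    rw [ENNReal.le_ofReal_iff_toReal_le hA hC.le]
    linarith [B.toReal_nonneg]
  have hBC : B ≤ ENNReal.ofReal (A.toReal + B.toReal + 1) := by
    rw [ENNReal.le_ofReal_iff_toReal_le hB hC.le]
    linarith [A.toReal_nonneg]
  refine ⟨_, hC, fun p q hp hq g hg => ?_⟩
  have hae := hg.1.ae_eq_mk
  have hm : Measurable (hg.1.mk g) := hg.1.stronglyMeasurable_mk.measurable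
  have hg' : MemLp (hg.1.mk g) p volume := (memLp_congr_ae hae).1 hg
  rw [besovSeminorm_congr_ae hae, extension_congr_ae hae, ENNReal.ofReal_inv_of_pos hC]
  constructor
  · rw [ENNReal.inv_mul_le_iff (by simpa using hC) ENNReal.ofReal_ne_top]
    exact (h p q hp hq _ hm hg').trans (mul_le_mul_left hAC _)
  · exact (h' p q hp hq _ hm hg').trans (mul_le_mul_left hBC _)

end ParabolicBesov

end

theorem mainTheorem8 {𝕜 : Type*} [RCLike 𝕜] (n : ℕ) (hn : 1 ≤ n) (α r : ℝ) (hα : α < 1)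
    (hr0 : 0 < r) (hr1 : r < min (1 - α) 1) :
    ∃ C : ℝ, 0 < C ∧ ∀ (p q : ℝ≥0∞), 1 ≤ p → 1 ≤ q →
      ∀ g : ParabolicBesov.Bdry n → 𝕜, MemLp g p volume →
        (∀ (t : ℝ) (x' : EuclideanSpace ℝ (Fin n)) (xd : ℝ), 0 < xd →
          IntegrableOn (ParabolicBesov.integrand α g t x' xd) (ParabolicBesov.past n) volume) ∧
        DifferentiableOn ℝ
          (fun P : ℝ × EuclideanSpace ℝ (Fin n) × ℝ =>
            ParabolicBesov.extension α g P.1 P.2.1 P.2.2)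
          {P | 0 < P.2.2} ∧
        ENNReal.ofReal (C⁻¹) * ParabolicBesov.besovSeminorm r p q g ≤
          ParabolicBesov.weightedNorm r p q (ParabolicBesov.extension α g) ∧
        ParabolicBesov.weightedNorm r p q (ParabolicBesov.extension α g) ≤
          ENNReal.ofReal C * ParabolicBesov.besovSeminorm r p q g := by
  obtain ⟨C, hC, h⟩ := ParabolicBesov.exists_besovSeminorm_equiv (𝕜 := 𝕜) n hn hα hr0
    (hr1.trans_le (min_le_right _ _)) (hr1.trans_le (min_le_left _ _))
  exact ⟨C, hC, fun p q hp hq g hg =>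
    ⟨fun t x' _ hy => ParabolicBesov.integrableOn_integrand hα hp hg t x' hy,
      ParabolicBesov.differentiableOn_extension hα hp hg, h p q hp hq g hg⟩⟩
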